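/- Let $\Omega\subset\mathbb R^N$ ($N\ge 2$) be a bounded open set. For a measurable $p(\cdot)\ge 1$ bounded on $\Omega$, $L^{p(\cdot)}(\Omega)$ is the space of measurable $v$ with $\int_\Omega|v|^{p(x)}dx<\infty$, with the Luxemburg norm $\|v\|_{p(\cdot)}=\inf\{t>0:\int_\Omega|v/t|^{p(x)}dx\le1\}$; $W^{1,p(\cdot)}(\Omega)$ is the space of $v\in L^{p(\cdot)}(\Omega)$ with weak gradient satisfying $|\nabla v|\in L^{p(\cdot)}(\Omega)$, with $\|v\|_{1,p(\cdot)}=\|v\|_{p(\cdot)}+\|\nabla v\|_{p(\cdot)}$; and $W^{1,p(\cdot)}_0(\Omega)=W^{1,p(\cdot)}(\Omega)\cap W^{1,1}_0(\Omega)$ (i.e. $v=0$ on $\partial\Omega$), where $W_0^{1,1}(\Omega)$ is the closure of $C_c^\infty(\Omega)$ in $W^{1,1}(\Omega)$. For $k>0$ let $T_k(s)=\max\{-k,\min\{s,k\}\}$. Let $p,r,\gamma$ be continuous on $\overline\Omega$ with $1<p(x)<N$, $0<r(x)$, $p(x)-1<r(x)$, $0<\gamma(x)<1$ and $p(x)>1+\frac{1-\gamma(x)}{r(x)}$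 for all $x\in\overline\Omega$, and with $|\nabla\gamma|\in L^\infty(\Omega)$. Let $a,b$ be measurable with $0<\alpha\le a\le\beta$ and $0<\mu\le b\le\nu$ a.e. in $\Omega$, for constants $\alpha,\beta,\mu,\nu$. Let $f\in L^1(\Omega)$, $f\ge0$ a.e., $f$ not a.e. zero, and let $(f_n)_{n\ge1}$ be measurable with $0\le f_n\le n$ and $f_n\le f$ a.e. in $\Omega$, and $f_n\to f$ in $L^1(\Omega)$. For each $n\ge1$ let $u_n\in W_0^{1,p(\cdot)}(\Omega)\cap L^\infty(\Omega)$ satisfy $$\int_\Omega a|\nabla u_n|^{p(x)-2}\nabla u_n\cdot\nabla\varphi\,dx+\int_\Omega b\,|u_n|^{r(x)-1}u_n\varphi\,dx=\int_\Omega\frac{f_n\,\varphi}{\left(|u_n|+\frac1n\right)^{\gamma(x)}}\,dx\qquad\forall\varphi\in W_0^{1,p(\cdot)}(\Omega)\cap L^\infty(\Omega).$$ Put $q(x)=\dfrac{p(x)}{1+\frac{1-\gamma(x)}{r(x)}}$, and let $u\in W_0^{1,q(\cdot)}(\Omega)$ and a strictly increasing sequence of indices $(n_j)$ be such that $u_{n_j}\to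 u$ a.e. in $\Omega$. If for every $k>0$ the sequence $(T_k(u_n))_{n\ge1}$ is bounded in $W_0^{1,p(\cdot)}(\Omega)$, then for every $k>0$ one has $T_k(u)\in W_0^{1,p(\cdot)}(\Omega)$ and $$T_k(u_{n_j})\to T_k(u)\quad\text{strongly in }W_0^{1,p(\cdot)}(\Omega)\text{ as }j\to\infty.$$ In particular, along a further subsequence of $(n_j)$, $\nabla u_{n_j}\to\nabla u$ a.e. in $\Omega$. -/

import Mathlib

open MeasureTheory Filter Topology
open scoped ENNReal NNReal ContDiff

noncomputable section

namespace VarSobolev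

/-- The truncation at level `k`: `T_k(s) = max {-k, min {s, k}}`. -/
def trunc (k s : ℝ) : ℝ := max (-k) (min s k)

section Lebesgue

variable {N : ℕ} {F : Type*} [NormedAddCommGroup F] [NormedSpace ℝ F]

/-- The modular `ρ_{p(·)}(u) = ∫_Ω |u(x)|^{p(x)} dx`, as an extended nonnegative number. -/
def modular (Ω : Set (EuclideanSpace ℝ (Fin N))) (p : EuclideanSpace ℝ (Fin N) → ℝ)
    (u : EuclideanSpace ℝ (Fin N) → F) : ℝ≥0∞ :=
  ∫⁻ x in Ω, ENNReal.ofReal (‖u x‖ ^ p x)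

/-- `u ∈ L^{p(·)}(Ω)`: `u` is measurable on `Ω` with finite modular. -/
def MemLpVar (Ω : Set (EuclideanSpace ℝ (Fin N))) (p : EuclideanSpace ℝ (Fin N) → ℝ)
    (u : EuclideanSpace ℝ (Fin N) → F) : Prop :=
  AEStronglyMeasurable u (volume.restrict Ω) ∧ modular Ω p u < ⊤

/-- The Luxemburg norm `inf {t > 0 : ρ_{p(·)}(u / t) ≤ 1}`
(with the value `∞` if there is no such `t`). -/
def luxNorm (Ω : Set (EuclideanSpace ℝ (Fin N))) (p : EuclideanSpace ℝ (Fin N) → ℝ)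
    (u : EuclideanSpace ℝ (Fin N) → F) : ℝ≥0∞ :=
  sInf (ENNReal.ofReal '' {t : ℝ | 0 < t ∧ modular Ω p (fun x => t⁻¹ • u x) ≤ 1})

end Lebesgue

section Sobolev

variable {N : ℕ}

/-- `φ ∈ C_c^∞(Ω)`. -/
def IsTestFun (Ω : Set (EuclideanSpace ℝ (Fin N))) (φ : EuclideanSpace ℝ (Fin N) → ℝ) : Prop :=
  ContDiff ℝ ∞ φ ∧ HasCompactSupport φ ∧ tsupport φ ⊆ Ω

/-- `G` is a weak gradient of `u` in the open set `Ω`: both are locally integrable in `Ω` and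
`∫_Ω u ∇φ = - ∫_Ω φ G` for every `φ ∈ C_c^∞(Ω)`. -/
def HasWeakGrad (Ω : Set (EuclideanSpace ℝ (Fin N))) (u : EuclideanSpace ℝ (Fin N) → ℝ)
    (G : EuclideanSpace ℝ (Fin N) → EuclideanSpace ℝ (Fin N)) : Prop :=
  LocallyIntegrableOn u Ω ∧ LocallyIntegrableOn G Ω ∧
    ∀ φ : EuclideanSpace ℝ (Fin N) → ℝ, IsTestFun Ω φ →
      ∫ x in Ω, u x • gradient φ x = - ∫ x in Ω, φ x • G x

/-- `u` has a weak gradient in `Ω`. -/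
def WeaklyDiff (Ω : Set (EuclideanSpace ℝ (Fin N))) (u : EuclideanSpace ℝ (Fin N) → ℝ) : Prop :=
  ∃ G, HasWeakGrad Ω u G

open Classical in
/-- The weak gradient `∇u` of `u` in `Ω`, which is unique up to equality a.e. in `Ω`
(a value without meaning is used if `u` has no weak gradient). -/
def weakGrad (Ω : Set (EuclideanSpace ℝ (Fin N))) (u : EuclideanSpace ℝ (Fin N) → ℝ) :
    EuclideanSpace ℝ (Fin N) → EuclideanSpace ℝ (Fin N) :=
  if h : WeaklyDiff Ω u then h.choose else 0

/-- `u ∈ W^{1,p(·)}(Ω)`. -/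
def MemW (Ω : Set (EuclideanSpace ℝ (Fin N))) (p : EuclideanSpace ℝ (Fin N) → ℝ)
    (u : EuclideanSpace ℝ (Fin N) → ℝ) : Prop :=
  WeaklyDiff Ω u ∧ MemLpVar Ω p u ∧ MemLpVar Ω p (weakGrad Ω u)

/-- `u ∈ W_0^{1,1}(Ω)`, the closure of `C_c^∞(Ω)` in `W^{1,1}(Ω)`. -/
def MemW011 (Ω : Set (EuclideanSpace ℝ (Fin N))) (u : EuclideanSpace ℝ (Fin N) → ℝ) : Prop :=
  WeaklyDiff Ω u ∧ IntegrableOn u Ω ∧ IntegrableOn (weakGrad Ω u) Ω ∧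
    ∃ φ : ℕ → EuclideanSpace ℝ (Fin N) → ℝ, (∀ j, IsTestFun Ω (φ j)) ∧
      Tendsto (fun j => ∫⁻ x in Ω, ‖u x - φ j x‖ₑ) atTop (𝓝 0) ∧
      Tendsto (fun j => ∫⁻ x in Ω, ‖weakGrad Ω u x - gradient (φ j) x‖ₑ) atTop (𝓝 0)

/-- `u ∈ W_0^{1,p(·)}(Ω)`: the functions in `W^{1,p(·)}(Ω)` with `u = 0` on `∂Ω`, the boundary
condition being understood as `u ∈ W_0^{1,1}(Ω)` (for a bounded Lipschitz domain this says that
the trace of `u` vanishes). -/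
def MemW0 (Ω : Set (EuclideanSpace ℝ (Fin N))) (p : EuclideanSpace ℝ (Fin N) → ℝ)
    (u : EuclideanSpace ℝ (Fin N) → ℝ) : Prop :=
  MemW Ω p u ∧ MemW011 Ω u

/-- The norm `‖u‖_{1,p(·)} = ‖u‖_{p(·)} + ‖∇u‖_{p(·)}` of `u ∈ W^{1,p(·)}(Ω)`. -/
def sobNorm (Ω : Set (EuclideanSpace ℝ (Fin N))) (p : EuclideanSpace ℝ (Fin N) → ℝ)
    (u : EuclideanSpace ℝ (Fin N) → ℝ) : ℝ≥0∞ :=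
  luxNorm Ω p u + luxNorm Ω p (weakGrad Ω u)

/-- `u` is essentially bounded on `Ω` (used for functions that are measurable on `Ω`). -/
def EssBdd (Ω : Set (EuclideanSpace ℝ (Fin N))) (u : EuclideanSpace ℝ (Fin N) → ℝ) : Prop :=
  ∃ C : ℝ, ∀ᵐ x ∂(volume.restrict Ω), |u x| ≤ C

/-- `u ∈ W_0^{1,p(·)}(Ω) ∩ L^∞(Ω)` is a solution of the approximate problem
`-div (a |∇u|^{p-2} ∇u) + b |u|^{r-1} u = g / (|u| + 1/n)^γ` in `Ω`, `u = 0` on `∂Ω`,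
tested against all `φ ∈ W_0^{1,p(·)}(Ω) ∩ L^∞(Ω)`. -/
def IsApproxSol (Ω : Set (EuclideanSpace ℝ (Fin N)))
    (p r γ a b g : EuclideanSpace ℝ (Fin N) → ℝ) (n : ℕ)
    (u : EuclideanSpace ℝ (Fin N) → ℝ) : Prop :=
  MemW0 Ω p u ∧ EssBdd Ω u ∧
    ∀ φ : EuclideanSpace ℝ (Fin N) → ℝ, MemW0 Ω p φ → EssBdd Ω φ →
      (∫ x in Ω, a x * (‖weakGrad Ω u x‖ ^ (p x - 2) *
          inner ℝ (weakGrad Ω u x) (weakGrad Ω φ x)))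
        + (∫ x in Ω, b x * (|u x| ^ (r x - 1) * u x) * φ x)
      = ∫ x in Ω, g x / (|u x| + 1 / (n : ℝ)) ^ γ x * φ x

end Sobolev

end VarSobolev

end

open VarSobolev

/-! The equation is tested with `T_{2k}(u_n - T_h(u_n) + T_k(u_n) - T_k(u))`, where `k ≤ h` and `1 ≤
h`. The solutions are nonnegative, as testing with `min(u_n, 0)` shows, so on `{u_n ≤ h}` the test
function is `T_k(u_n) - T_k(u)`. Three pointwise bounds feed `ProblemData.main_estimate`.

The singular term needs only a bound from above. Where the test function `φ` is positive and `u_n ≤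
h`, one has `φ ≤ u_n`, so the term is at most `f φ^(1-γ)`, which vanishes in the limit by dominated
convergence. Where `u_n > h ≥ 1` the denominator is at least 1, and the term is at most `2k f min(1,
u_n/h)`, small for large `h`. The absorption term has a good sign on `{u_n ≥ k}` and is bounded on
`{u_n < k}`. The diffusion term on `{u_n < k}` is the flux of `T_k(u_n)` against `∇T_k(u_n) -
∇T_k(u)`. On `{u_n ≥ k}` its only bad part lives in `{u_n < h + 2k}` and is controlled by `χ_{u_n ≥
k} |∇T_k(u)| |∇T_{h+2k}(u_n)|^(p-1)`. There the first factor tends to 0 in `L^p` and the second is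
bounded in the dual space. Letting `n → ∞` and then `h → ∞`, the upper limit of `∫ a
|∇T_k(u_n)|^(p-2) ∇T_k(u_n) · (∇T_k(u_n) - ∇T_k(u))` is at most 0
(`ApproxSeq.eventually_diffusion_lt`).

The bound on the truncations makes `∇T_k(u_n)` converge weakly to `∇T_k(u)`, which therefore lies in
`L^p` (`TendstoDistrib.integrable_rpow_limit`, `TendstoDistrib.tendsto_inner`). Hence the flux of
the limit, integrated against the same difference, tends to 0, and so does the monotonicity
integral. The quantitative monotonicity of `ξ ↦ |ξ|^(p-2) ξ`, uniform in the exponent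
(`exists_rpow_norm_sub_le`), turns this directly into strong convergence. A diagonal choice over `k
→ ∞` gives the a.e. convergence of the gradients. -/

namespace VarSobolev

/-! ### Test functions and integration by parts. -/

section TestFunctions

variable {N : ℕ} {Ω : Set (EuclideanSpace ℝ (Fin N))} {φ ψ : EuclideanSpace ℝ (Fin N) → ℝ}

theorem IsTestFun.continuous_gradient (h : IsTestFun Ω φ) : Continuous (gradient φ) := by
  have h1 : Continuous (fderiv ℝ φ) := h.1.continuous_fderiv (by simp)
  exact (InnerProductSpace.toDual ℝ (EuclideanSpace ℝ (Fin N))).symm.continuous.comp h1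

theorem IsTestFun.hasCompactSupport_gradient (h : IsTestFun Ω φ) :
    HasCompactSupport (gradient φ) := by
  have h1 : HasCompactSupport (fderiv ℝ φ) := h.2.1.fderiv ℝ
  exact h1.comp_left (g := (InnerProductSpace.toDual ℝ (EuclideanSpace ℝ (Fin N))).symm)
    (map_zero _)

theorem IsTestFun.integrable (h : IsTestFun Ω φ) : Integrable φ :=
  h.1.continuous.integrable_of_hasCompactSupport h.2.1

theorem IsTestFun.integrable_gradient (h : IsTestFun Ω φ) : Integrable (gradient φ) :=
  h.continuous_gradient.integrable_of_hasCompactSupport h.hasCompactSupport_gradient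

theorem IsTestFun.eq_zero_of_notMem (h : IsTestFun Ω φ) {x : EuclideanSpace ℝ (Fin N)}
    (hx : x ∉ Ω) : φ x = 0 :=
  image_eq_zero_of_notMem_tsupport fun hx' => hx (h.2.2 hx')

theorem IsTestFun.exists_bound (h : IsTestFun Ω φ) :
    ∃ C : ℝ, 0 ≤ C ∧ ∀ x, ‖φ x‖ ≤ C ∧ ‖gradient φ x‖ ≤ C := by
  obtain ⟨C, hC⟩ := h.2.1.exists_bound_of_continuous h.1.continuous
  obtain ⟨D, hD⟩ := h.hasCompactSupport_gradient.exists_bound_of_continuous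
    h.continuous_gradient
  exact ⟨max C D, (norm_nonneg _).trans ((hC 0).trans (le_max_left _ _)),
    fun x => ⟨(hC x).trans (le_max_left _ _), (hD x).trans (le_max_right _ _)⟩⟩

theorem IsTestFun.inner_gradient (x v : EuclideanSpace ℝ (Fin N)) :
    inner ℝ v (gradient φ x) = fderiv ℝ φ x v := by
  rw [real_inner_comm]
  exact inner_gradient_left ..

/-- Both integrands vanish off `Ω`, so the integrals may be taken over the whole space. Pairing with
a fixed vector then leaves integration by parts for one directional derivative. -/
theorem IsTestFun.integral_smul_gradient (hφ : IsTestFun Ω φ) (hψ : IsTestFun Ω ψ) :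
    ∫ x in Ω, φ x • gradient ψ x = - ∫ x in Ω, ψ x • gradient φ x := by
  obtain ⟨C, hC0, hC⟩ := hφ.exists_bound
  obtain ⟨D, hD0, hD⟩ := hψ.exists_bound
  have i1 : Integrable (fun x => φ x • gradient ψ x) :=
    hψ.integrable_gradient.bdd_smul C hφ.1.continuous.aestronglyMeasurable
      (Eventually.of_forall fun x => (hC x).1)
  have i2 : Integrable (fun x => ψ x • gradient φ x) :=
    hφ.integrable_gradient.bdd_smul D hψ.1.continuous.aestronglyMeasurable
      (Eventually.of_forall fun x => (hD x).1)
  rw [setIntegral_eq_integral_of_forall_compl_eq_zero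
      (fun x hx => by rw [hφ.eq_zero_of_notMem hx, zero_smul]),
    setIntegral_eq_integral_of_forall_compl_eq_zero
      (fun x hx => by rw [hψ.eq_zero_of_notMem hx, zero_smul])]
  refine ext_inner_left ℝ fun v => ?_
  rw [inner_neg_right, ← integral_inner i1, ← integral_inner i2]
  simp only [inner_smul_right, IsTestFun.inner_gradient]
  have j1 := i1.const_inner (𝕜 := ℝ) v
  have j2 := i2.const_inner (𝕜 := ℝ) v
  simp only [inner_smul_right, IsTestFun.inner_gradient] at j1 j2
  rw [integral_mul_fderiv_eq_neg_fderiv_mul_of_integrable]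
  · congr 1
    exact integral_congr_ae (Eventually.of_forall fun x => mul_comm _ _)
  · simpa only [mul_comm] using j2
  · exact j1
  · exact hψ.integrable.bdd_mul (c := C) hφ.1.continuous.aestronglyMeasurable
      (Eventually.of_forall fun x => (hC x).1)
  · exact fun x _ => hφ.1.differentiable (by simp) x
  · exact fun x _ => hψ.1.differentiable (by simp) x

end TestFunctions

/-! ### Uniqueness of weak gradients; the space `W_0^{1,1}`. -/

section WeakGradient

variable {N : ℕ} {Ω : Set (EuclideanSpace ℝ (Fin N))}

/-- The fundamental lemma of the calculus of variations, applied to `G - G'`. It frees later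
arguments from the arbitrary choice made in `weakGrad`. -/
theorem HasWeakGrad.ae_eq (hΩ : IsOpen Ω) {u : EuclideanSpace ℝ (Fin N) → ℝ}
    {G G' : EuclideanSpace ℝ (Fin N) → EuclideanSpace ℝ (Fin N)}
    (h : HasWeakGrad Ω u G) (h' : HasWeakGrad Ω u G') : G =ᵐ[volume.restrict Ω] G' := by
  have key : ∀ᵐ x ∂(volume : Measure (EuclideanSpace ℝ (Fin N))), x ∈ Ω → (G - G') x = 0 := by
    refine hΩ.ae_eq_zero_of_integral_contDiff_smul_eq_zero (h.2.1.sub h'.2.1) ?_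
    intro g hg hgc hgs
    have hint : ∀ F : EuclideanSpace ℝ (Fin N) → EuclideanSpace ℝ (Fin N),
        LocallyIntegrableOn F Ω → IntegrableOn (fun x => g x • F x) Ω := by
      intro F hF
      have h1 : IntegrableOn F (tsupport g) := hF.integrableOn_compact_subset hgs hgc
      obtain ⟨C, hC⟩ := hgc.exists_bound_of_continuous hg.continuous
      have h2 : IntegrableOn (fun x => g x • F x) (tsupport g) :=
        Integrable.bdd_smul h1 C hg.continuous.aestronglyMeasurable
          (Eventually.of_forall hC)
      have h3 : Integrable (fun x => g x • F x) :=
        (integrableOn_iff_integrable_of_support_subset (by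
          intro x hx
          by_contra hxn
          simp [image_eq_zero_of_notMem_tsupport hxn] at hx)).1 h2
      exact h3.integrableOn
    rw [← setIntegral_eq_integral_of_forall_compl_eq_zero (s := Ω)
      (fun x hx => by rw [image_eq_zero_of_notMem_tsupport (fun hx' => hx (hgs hx')), zero_smul])]
    simp only [Pi.sub_apply, smul_sub]
    rw [integral_sub (hint G h.2.1) (hint G' h'.2.1)]
    have e1 := h.2.2 g ⟨hg, hgc, hgs⟩
    have e2 := h'.2.2 g ⟨hg, hgc, hgs⟩
    rw [e1] at e2
    rw [neg_injective e2, sub_self]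
  rw [EventuallyEq, ae_restrict_iff' hΩ.measurableSet]
  filter_upwards [key] with x hx hxΩ
  exact sub_eq_zero.1 (hx hxΩ)

theorem WeaklyDiff.hasWeakGrad {u : EuclideanSpace ℝ (Fin N) → ℝ} (h : WeaklyDiff Ω u) :
    HasWeakGrad Ω u (weakGrad Ω u) := by
  rw [weakGrad, dif_pos h]
  exact h.choose_spec

/-- `u ∈ W_0^{1,1}(Ω)` with weak gradient `G`. -/
structure HasW011Grad (Ω : Set (EuclideanSpace ℝ (Fin N))) (u : EuclideanSpace ℝ (Fin N) → ℝ)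
    (G : EuclideanSpace ℝ (Fin N) → EuclideanSpace ℝ (Fin N)) : Prop where
  integrable : IntegrableOn u Ω
  integrable_grad : IntegrableOn G Ω
  approx : ∃ φ : ℕ → EuclideanSpace ℝ (Fin N) → ℝ, (∀ j, IsTestFun Ω (φ j)) ∧
      Tendsto (fun j => ∫⁻ x in Ω, ‖u x - φ j x‖ₑ) atTop (𝓝 0) ∧
      Tendsto (fun j => ∫⁻ x in Ω, ‖G x - gradient (φ j) x‖ₑ) atTop (𝓝 0)

variable {u v : EuclideanSpace ℝ (Fin N) → ℝ}
  {G H : EuclideanSpace ℝ (Fin N) → EuclideanSpace ℝ (Fin N)}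

theorem tendsto_integral_smul_of_tendsto_lintegral {α F : Type*} [MeasurableSpace α]
    {μ : Measure α} [NormedAddCommGroup F] [NormedSpace ℝ F]
    {c : α → ℝ} {f : α → F} {g : ℕ → α → F}
    (hcm : AEStronglyMeasurable c μ) {C : ℝ} (hC : ∀ x, ‖c x‖ ≤ C)
    (hf : Integrable f μ) (hg : ∀ j, Integrable (g j) μ)
    (h : Tendsto (fun j => ∫⁻ x, ‖f x - g j x‖ₑ ∂μ) atTop (𝓝 0)) :
    Tendsto (fun j => ∫ x, c x • g j x ∂μ) atTop (𝓝 (∫ x, c x • f x ∂μ)) := by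
  refine tendsto_integral_of_L1 _ (hf.bdd_smul C hcm (Eventually.of_forall hC)).aestronglyMeasurable
    (Eventually.of_forall fun j => (hg j).bdd_smul C hcm (Eventually.of_forall hC)) ?_
  have h2 : Tendsto (fun j => ENNReal.ofReal C * ∫⁻ x, ‖f x - g j x‖ₑ ∂μ) atTop (𝓝 0) := by
    simpa using ENNReal.Tendsto.const_mul h (Or.inr ENNReal.ofReal_ne_top)
  refine tendsto_of_tendsto_of_tendsto_of_le_of_le tendsto_const_nhds h2 (fun _ => zero_le) ?_
  intro j
  dsimp only
  rw [← lintegral_const_mul' _ _ ENNReal.ofReal_ne_top]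
  refine lintegral_mono fun x => ?_
  rw [Pi.smul_apply', ← smul_sub, enorm_smul, ← enorm_neg (f x - g j x), neg_sub]
  gcongr
  rw [← ofReal_norm]
  exact ENNReal.ofReal_le_ofReal (hC x)

/-- Integration by parts holds for the approximating test functions, and both sides pass to the
limit because a test function and its gradient are bounded. -/
theorem HasW011Grad.hasWeakGrad (h : HasW011Grad Ω u G) : HasWeakGrad Ω u G := by
  refine ⟨h.integrable.locallyIntegrableOn, h.integrable_grad.locallyIntegrableOn, ?_⟩
  intro ψ hψ
  obtain ⟨φ, hφ, h1, h2⟩ := h.approx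
  obtain ⟨C, -, hC⟩ := hψ.exists_bound
  have t2 := tendsto_integral_smul_of_tendsto_lintegral
    hψ.1.continuous.aestronglyMeasurable (fun x => (hC x).1) h.integrable_grad
    (fun j => (hφ j).integrable_gradient.integrableOn) h2
  have t1 : Tendsto (fun j => ∫ x in Ω, φ j x • gradient ψ x) atTop
      (𝓝 (∫ x in Ω, u x • gradient ψ x)) := by
    have hin : ∀ w : EuclideanSpace ℝ (Fin N) → ℝ, IntegrableOn w Ω →
        IntegrableOn (fun x => w x • gradient ψ x) Ω := fun w hw =>
      Integrable.smul_bdd hw C hψ.continuous_gradient.aestronglyMeasurable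
        (Eventually.of_forall fun x => (hC x).2)
    refine tendsto_integral_of_L1 _ (hin u h.integrable).aestronglyMeasurable
      (Eventually.of_forall fun j => hin _ (hφ j).integrable.integrableOn) ?_
    have h2 : Tendsto (fun j => (∫⁻ x in Ω, ‖u x - φ j x‖ₑ) * ENNReal.ofReal C) atTop (𝓝 0) := by
      simpa using ENNReal.Tendsto.mul_const h1 (Or.inr ENNReal.ofReal_ne_top)
    refine tendsto_of_tendsto_of_tendsto_of_le_of_le tendsto_const_nhds h2
      (fun _ => zero_le) ?_
    intro j
    dsimp only
    rw [← lintegral_mul_const' _ _ ENNReal.ofReal_ne_top]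
    refine lintegral_mono fun x => ?_
    rw [← sub_smul, enorm_smul, ← enorm_neg (u x - φ j x), neg_sub]
    gcongr
    rw [← ofReal_norm]
    exact ENNReal.ofReal_le_ofReal (hC x).2
  refine tendsto_nhds_unique t1 ?_
  simp only [fun j => (hφ j).integral_smul_gradient hψ]
  exact t2.neg

theorem HasW011Grad.weakGrad_ae (hΩ : IsOpen Ω) (h : HasW011Grad Ω u G) :
    weakGrad Ω u =ᵐ[volume.restrict Ω] G :=
  HasWeakGrad.ae_eq hΩ (WeaklyDiff.hasWeakGrad ⟨G, h.hasWeakGrad⟩) h.hasWeakGrad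

theorem HasW011Grad.congr (h : HasW011Grad Ω u G) (hu : u =ᵐ[volume.restrict Ω] v)
    (hG : G =ᵐ[volume.restrict Ω] H) : HasW011Grad Ω v H := by
  obtain ⟨φ, hφ, h1, h2⟩ := h.approx
  refine ⟨Integrable.congr h.integrable hu, Integrable.congr h.integrable_grad hG, φ, hφ, ?_, ?_⟩
  · refine h1.congr fun j => lintegral_congr_ae ?_
    filter_upwards [hu] with x hx
    rw [hx]
  · refine h2.congr fun j => lintegral_congr_ae ?_
    filter_upwards [hG] with x hx
    rw [hx]

theorem MemW011.hasW011Grad (h : MemW011 Ω u) : HasW011Grad Ω u (weakGrad Ω u) :=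
  ⟨h.2.1, h.2.2.1, h.2.2.2⟩

theorem HasW011Grad.memW011 (hΩ : IsOpen Ω) (h : HasW011Grad Ω u G) : MemW011 Ω u := by
  have h' := h.congr (EventuallyEq.refl _ u) (h.weakGrad_ae hΩ).symm
  exact ⟨⟨G, h.hasWeakGrad⟩, h'.integrable, h'.integrable_grad, h'.approx⟩

theorem HasW011Grad.exists_close (h : HasW011Grad Ω u G) {ε : ℝ≥0∞} (hε : 0 < ε) :
    ∃ φ, IsTestFun Ω φ ∧ ∫⁻ x in Ω, ‖u x - φ x‖ₑ < ε ∧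
      ∫⁻ x in Ω, ‖G x - gradient φ x‖ₑ < ε := by
  obtain ⟨φ, hφ, h1, h2⟩ := h.approx
  obtain ⟨j, hj⟩ := ((h1.eventually_lt_const hε).and (h2.eventually_lt_const hε)).exists
  exact ⟨φ j, hφ j, hj⟩

/-- `W_0^{1,1}(Ω)` is closed in `W^{1,1}(Ω)`. -/
theorem HasW011Grad.of_tendsto {un : ℕ → EuclideanSpace ℝ (Fin N) → ℝ}
    {Gn : ℕ → EuclideanSpace ℝ (Fin N) → EuclideanSpace ℝ (Fin N)}
    (h : ∀ n, HasW011Grad Ω (un n) (Gn n)) (hu : IntegrableOn u Ω) (hG : IntegrableOn G Ω)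
    (h1 : Tendsto (fun n => ∫⁻ x in Ω, ‖u x - un n x‖ₑ) atTop (𝓝 0))
    (h2 : Tendsto (fun n => ∫⁻ x in Ω, ‖G x - Gn n x‖ₑ) atTop (𝓝 0)) : HasW011Grad Ω u G := by
  have hpos : ∀ n : ℕ, (0 : ℝ≥0∞) < ((n : ℝ≥0∞) + 1)⁻¹ := fun n => by simp
  -- Diagonal choice: the `n`-th test function is within `1/(n+1)` of the `n`-th member of the
  -- sequence.
  choose φ hφ c1 c2 using fun n => (h n).exists_close (hpos n)
  have h0 : Tendsto (fun n : ℕ => ((n : ℝ≥0∞) + 1)⁻¹) atTop (𝓝 0) := by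
    have := (tendsto_add_atTop_iff_nat (f := fun n : ℕ => ((n : ℝ≥0∞))⁻¹) 1).2
      ENNReal.tendsto_inv_nat_nhds_zero
    simpa using this
  refine ⟨hu, hG, φ, hφ, ?_, ?_⟩
  · refine tendsto_of_tendsto_of_tendsto_of_le_of_le tendsto_const_nhds
      (by simpa using h1.add h0) (fun _ => zero_le) fun n => ?_
    calc ∫⁻ x in Ω, ‖u x - φ n x‖ₑ
        ≤ ∫⁻ x in Ω, (‖u x - un n x‖ₑ + ‖un n x - φ n x‖ₑ) := lintegral_mono fun x => by
          simpa using enorm_add_le (u x - un n x) (un n x - φ n x)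
      _ = (∫⁻ x in Ω, ‖u x - un n x‖ₑ) + ∫⁻ x in Ω, ‖un n x - φ n x‖ₑ :=
          lintegral_add_left' (hu.aestronglyMeasurable.sub
            (h n).integrable.aestronglyMeasurable).enorm _
      _ ≤ _ := by gcongr; exact (c1 n).le
  · refine tendsto_of_tendsto_of_tendsto_of_le_of_le tendsto_const_nhds
      (by simpa using h2.add h0) (fun _ => zero_le) fun n => ?_
    calc ∫⁻ x in Ω, ‖G x - gradient (φ n) x‖ₑ
        ≤ ∫⁻ x in Ω, (‖G x - Gn n x‖ₑ + ‖Gn n x - gradient (φ n) x‖ₑ) :=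
          lintegral_mono fun x => by
            simpa using enorm_add_le (G x - Gn n x) (Gn n x - gradient (φ n) x)
      _ = (∫⁻ x in Ω, ‖G x - Gn n x‖ₑ) + ∫⁻ x in Ω, ‖Gn n x - gradient (φ n) x‖ₑ :=
          lintegral_add_left' (hG.aestronglyMeasurable.sub
            (h n).integrable_grad.aestronglyMeasurable).enorm _
      _ ≤ _ := by gcongr; exact (c2 n).le

theorem HasW011Grad.const_mul (c : ℝ) (h : HasW011Grad Ω u G) :
    HasW011Grad Ω (fun x => c * u x) (fun x => c • G x) := by
  obtain ⟨φ, hφ, h1, h2⟩ := h.approx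
  refine ⟨h.integrable.const_mul c, h.integrable_grad.smul c, fun j x => c * φ j x,
    fun j => ⟨contDiff_const.mul (hφ j).1, (hφ j).2.1.mul_left,
      (tsupport_mul_subset_right (f := fun _ => c)).trans (hφ j).2.2⟩, ?_, ?_⟩
  · have : Tendsto (fun j => ‖c‖ₑ * ∫⁻ x in Ω, ‖u x - φ j x‖ₑ) atTop (𝓝 0) := by
      simpa using ENNReal.Tendsto.const_mul h1 (Or.inr enorm_ne_top)
    refine this.congr fun j => ?_
    rw [← lintegral_const_mul' _ _ enorm_ne_top]
    simp only [← mul_sub, enorm_mul]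
  · have : Tendsto (fun j => ‖c‖ₑ * ∫⁻ x in Ω, ‖G x - gradient (φ j) x‖ₑ) atTop (𝓝 0) := by
      simpa using ENNReal.Tendsto.const_mul h2 (Or.inr enorm_ne_top)
    refine this.congr fun j => ?_
    rw [← lintegral_const_mul' _ _ enorm_ne_top]
    refine lintegral_congr fun x => ?_
    have : gradient (fun x => c * φ j x) x = c • gradient (φ j) x := by
      simp only [gradient]
      rw [fderiv_const_mul (((hφ j).1.differentiable (by simp)) x)]
      simp
    rw [this, ← smul_sub, enorm_smul]

theorem HasW011Grad.add (h : HasW011Grad Ω u G) (h' : HasW011Grad Ω v H) :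
    HasW011Grad Ω (fun x => u x + v x) (fun x => G x + H x) := by
  obtain ⟨φ, hφ, h1, h2⟩ := h.approx
  obtain ⟨ψ, hψ, h3, h4⟩ := h'.approx
  refine ⟨h.integrable.add h'.integrable, h.integrable_grad.add h'.integrable_grad,
    fun j x => φ j x + ψ j x, fun j => ⟨(hφ j).1.add (hψ j).1, (hφ j).2.1.add (hψ j).2.1,
      (tsupport_add _ _).trans (Set.union_subset (hφ j).2.2 (hψ j).2.2)⟩, ?_, ?_⟩
  · refine tendsto_of_tendsto_of_tendsto_of_le_of_le tendsto_const_nhds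
      (by simpa using h1.add h3) (fun _ => zero_le) fun j => ?_
    have hm : AEMeasurable (fun x => ‖u x - φ j x‖ₑ) (volume.restrict Ω) :=
      (h.integrable.aestronglyMeasurable.sub (hφ j).1.continuous.aestronglyMeasurable).enorm
    refine le_of_le_of_eq ?_ (lintegral_add_left' hm _)
    refine lintegral_mono fun x => ?_
    dsimp only
    rw [add_sub_add_comm]
    exact enorm_add_le _ _
  · refine tendsto_of_tendsto_of_tendsto_of_le_of_le tendsto_const_nhds
      (by simpa using h2.add h4) (fun _ => zero_le) fun j => ?_
    have hm : AEMeasurable (fun x => ‖G x - gradient (φ j) x‖ₑ) (volume.restrict Ω) :=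
      (h.integrable_grad.aestronglyMeasurable.sub
        (hφ j).continuous_gradient.aestronglyMeasurable).enorm
    refine le_of_le_of_eq ?_ (lintegral_add_left' hm _)
    refine lintegral_mono fun x => ?_
    dsimp only
    have : gradient (fun x => φ j x + ψ j x) x = gradient (φ j) x + gradient (ψ j) x := by
      simp only [gradient]
      rw [fderiv_fun_add (((hφ j).1.differentiable (by simp)) x)
        (((hψ j).1.differentiable (by simp)) x)]
      simp
    rw [this, add_sub_add_comm]
    exact enorm_add_le _ _

theorem HasW011Grad.sub (h : HasW011Grad Ω u G) (h' : HasW011Grad Ω v H) :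
    HasW011Grad Ω (fun x => u x - v x) (fun x => G x - H x) := by
  simpa [sub_eq_add_neg] using h.add (h'.const_mul (-1))

end WeakGradient

theorem tendsto_lintegral_enorm_sub_of_dominated {α F : Type*} [MeasurableSpace α]
    {μ : Measure α} [NormedAddCommGroup F] {fn : ℕ → α → F} {f : α → F} {bound : α → ℝ}
    (hm : ∀ n, AEStronglyMeasurable (fn n) μ) (hb : Integrable bound μ)
    (hle : ∀ n, ∀ᵐ x ∂μ, ‖fn n x‖ ≤ bound x)
    (hlim : ∀ᵐ x ∂μ, Tendsto (fun n => fn n x) atTop (𝓝 (f x))) :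
    Tendsto (fun n => ∫⁻ x, ‖f x - fn n x‖ₑ ∂μ) atTop (𝓝 0) := by
  refine (tendsto_lintegral_norm_of_dominated_convergence hm hb.hasFiniteIntegral hle hlim).congr
    fun n => lintegral_congr fun x => ?_
  rw [ofReal_norm, ← enorm_neg, neg_sub]

/-! ### Chain rule and truncation in `W_0^{1,1}`. -/

section ChainRule

variable {N : ℕ} {Ω : Set (EuclideanSpace ℝ (Fin N))} {u : EuclideanSpace ℝ (Fin N) → ℝ}
  {G : EuclideanSpace ℝ (Fin N) → EuclideanSpace ℝ (Fin N)}

theorem abs_sub_le_of_deriv_le {Φ : ℝ → ℝ} (hΦ : ContDiff ℝ ∞ Φ) {C : ℝ}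
    (hC : ∀ s, |deriv Φ s| ≤ C) (s t : ℝ) : |Φ s - Φ t| ≤ C * |s - t| :=
  Convex.norm_image_sub_le_of_norm_deriv_le (s := Set.univ)
    (fun x _ => hΦ.differentiable (by simp) x) (fun x _ => hC x) convex_univ
    (Set.mem_univ t) (Set.mem_univ s)

/-- Composing the approximating test functions with `Φ` gives test functions again, since `Φ 0 = 0`.
The gradient error splits into `(Φ'(u) - Φ'(φ_j)) G`, handled by dominated convergence, and `Φ'(φ_j)
(G - ∇φ_j)`, handled by the bound on `Φ'`. -/
theorem HasW011Grad.comp_contDiff (h : HasW011Grad Ω u G) {Φ : ℝ → ℝ} (hΦ : ContDiff ℝ ∞ Φ)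
    (h0 : Φ 0 = 0) {C : ℝ} (hC : ∀ s, |deriv Φ s| ≤ C) :
    HasW011Grad Ω (fun x => Φ (u x)) (fun x => deriv Φ (u x) • G x) := by
  have hL := abs_sub_le_of_deriv_le hΦ hC
  have hΦ' : Continuous (deriv Φ) := hΦ.continuous_deriv (by simp)
  have hC0 : 0 ≤ C := (abs_nonneg _).trans (hC 0)
  have hum := h.integrable.aestronglyMeasurable
  have hdm : ∀ {w : EuclideanSpace ℝ (Fin N) → ℝ}, AEStronglyMeasurable w (volume.restrict Ω) →
      AEStronglyMeasurable (fun x => deriv Φ (w x)) (volume.restrict Ω) := fun hw =>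
    hΦ'.comp_aestronglyMeasurable hw
  obtain ⟨φ, hφ, h1, h2⟩ := h.approx
  have hmeas : TendstoInMeasure (volume.restrict Ω) φ atTop u := by
    refine tendstoInMeasure_of_tendsto_eLpNorm one_ne_zero
      (fun j => (hφ j).1.continuous.aestronglyMeasurable) hum ?_
    refine h1.congr fun j => ?_
    rw [eLpNorm_one_eq_lintegral_enorm]
    refine lintegral_congr fun x => ?_
    rw [← enorm_neg, neg_sub, Pi.sub_apply]
  -- Dominated convergence of `Φ'(φ_j) G` needs a.e. convergence of `φ_j`, which `L^1` convergence
  -- supplies only along a subsequence.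
  obtain ⟨ns, hns, hae⟩ := hmeas.exists_seq_tendsto_ae
  have h1' := h1.comp hns.tendsto_atTop
  have h2' := h2.comp hns.tendsto_atTop
  refine ⟨?_, ?_, fun j x => Φ (φ (ns j) x), fun j => ⟨hΦ.comp (hφ _).1,
    (hφ _).2.1.comp_left h0, (closure_mono ?_).trans (hφ (ns j)).2.2⟩, ?_, ?_⟩
  · refine Integrable.mono' (h.integrable.abs.const_mul C)
      (hΦ.continuous.comp_aestronglyMeasurable hum) (Eventually.of_forall fun x => ?_)
    simpa [h0] using hL (u x) 0
  · exact Integrable.bdd_smul h.integrable_grad C (hdm hum) (Eventually.of_forall fun x => hC _)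
  · intro x hx hx'
    exact hx (by simp [hx', h0])
  · have hl : Tendsto (fun j => ENNReal.ofReal C * ∫⁻ x in Ω, ‖u x - φ (ns j) x‖ₑ) atTop (𝓝 0) := by
      simpa using ENNReal.Tendsto.const_mul h1' (Or.inr ENNReal.ofReal_ne_top)
    refine tendsto_of_tendsto_of_tendsto_of_le_of_le tendsto_const_nhds hl
      (fun _ => zero_le) fun j => ?_
    dsimp only
    rw [← lintegral_const_mul' _ _ ENNReal.ofReal_ne_top]
    refine lintegral_mono fun x => ?_
    rw [← ofReal_norm, ← ofReal_norm, ← ENNReal.ofReal_mul hC0]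
    exact ENNReal.ofReal_le_ofReal (hL _ _)
  · have hl : Tendsto (fun j => ENNReal.ofReal C * ∫⁻ x in Ω, ‖G x - gradient (φ (ns j)) x‖ₑ)
        atTop (𝓝 0) := by
      simpa using ENNReal.Tendsto.const_mul h2' (Or.inr ENNReal.ofReal_ne_top)
    have hd : Tendsto (fun j => ∫⁻ x in Ω, ‖deriv Φ (u x) • G x - deriv Φ (φ (ns j) x) • G x‖ₑ)
        atTop (𝓝 0) := by
      refine tendsto_lintegral_enorm_sub_of_dominated (bound := fun x => C * ‖G x‖)
        (fun n => (hdm (hφ _).1.continuous.aestronglyMeasurable).smul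
          h.integrable_grad.aestronglyMeasurable) (h.integrable_grad.norm.const_mul C)
        (fun n => Eventually.of_forall fun x => ?_) ?_
      · rw [norm_smul]
        gcongr
        exact hC _
      · filter_upwards [hae] with x hx
        exact ((hΦ'.tendsto _).comp hx).smul_const _
    refine tendsto_of_tendsto_of_tendsto_of_le_of_le tendsto_const_nhds
      (by simpa using hd.add hl) (fun _ => zero_le) fun j => ?_
    dsimp only
    have hm : AEMeasurable (fun x => ‖deriv Φ (u x) • G x - deriv Φ (φ (ns j) x) • G x‖ₑ)
        (volume.restrict Ω) :=
      (((hdm hum).smul h.integrable_grad.aestronglyMeasurable).sub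
        ((hdm (hφ _).1.continuous.aestronglyMeasurable).smul
          h.integrable_grad.aestronglyMeasurable)).enorm
    rw [← lintegral_const_mul' _ _ ENNReal.ofReal_ne_top]
    refine le_of_le_of_eq ?_ (lintegral_add_left' hm _)
    refine lintegral_mono fun x => ?_
    have hg : gradient (fun x => Φ (φ (ns j) x)) x
        = deriv Φ (φ (ns j) x) • gradient (φ (ns j)) x := by
      simp only [gradient]
      have hc : HasFDerivAt (fun x => Φ (φ (ns j) x))
          (deriv Φ (φ (ns j) x) • fderiv ℝ (φ (ns j)) x) x :=
        (hΦ.differentiable (by simp) _).hasDerivAt.comp_hasFDerivAt x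
          ((hφ (ns j)).1.differentiable (by simp) x).hasFDerivAt
      rw [hc.fderiv]
      simp
    rw [hg]
    have hb : ‖deriv Φ (φ (ns j) x) • (G x - gradient (φ (ns j)) x)‖ₑ
        ≤ ENNReal.ofReal C * ‖G x - gradient (φ (ns j)) x‖ₑ := by
      rw [enorm_smul]
      gcongr
      rw [← ofReal_norm]
      exact ENNReal.ofReal_le_ofReal (hC _)
    refine le_trans ?_ (add_le_add le_rfl hb)
    refine le_of_eq_of_le ?_ (enorm_add_le _ _)
    congr 1
    rw [smul_sub]
    abel

/-- Dominated convergence and closedness of `W_0^{1,1}` suffice. No continuity of `g` is asked for,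
so at a kink of `Ψ` its value is whatever the chosen smoothing produces. -/
theorem HasW011Grad.comp_of_tendsto (h : HasW011Grad Ω u G) {Φ : ℕ → ℝ → ℝ} {Ψ g : ℝ → ℝ}
    (hΦ : ∀ m, ContDiff ℝ ∞ (Φ m)) (h0 : ∀ m, Φ m 0 = 0) {C : ℝ}
    (hC : ∀ m s, |deriv (Φ m) s| ≤ C) (hΨ : ∀ s, Tendsto (fun m => Φ m s) atTop (𝓝 (Ψ s)))
    (hg : ∀ s, Tendsto (fun m => deriv (Φ m) s) atTop (𝓝 (g s))) :
    HasW011Grad Ω (fun x => Ψ (u x)) (fun x => g (u x) • G x) := by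
  have hm := fun m => h.comp_contDiff (hΦ m) (h0 m) (hC m)
  have b1 : ∀ m, ∀ᵐ x ∂(volume.restrict Ω), ‖Φ m (u x)‖ ≤ C * |u x| := fun m =>
    Eventually.of_forall fun x => by
      simpa [h0 m] using abs_sub_le_of_deriv_le (hΦ m) (hC m) (u x) 0
  have b2 : ∀ m, ∀ᵐ x ∂(volume.restrict Ω), ‖deriv (Φ m) (u x) • G x‖ ≤ C * ‖G x‖ := fun m =>
    Eventually.of_forall fun x => by
      rw [norm_smul]
      gcongr
      exact hC m _
  have l1 : ∀ᵐ x ∂(volume.restrict Ω), Tendsto (fun m => Φ m (u x)) atTop (𝓝 (Ψ (u x))) :=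
    Eventually.of_forall fun x => hΨ _
  have l2 : ∀ᵐ x ∂(volume.restrict Ω),
      Tendsto (fun m => deriv (Φ m) (u x) • G x) atTop (𝓝 (g (u x) • G x)) :=
    Eventually.of_forall fun x => (hg _).smul_const _
  have m1 := fun m => (hm m).integrable.aestronglyMeasurable
  have m2 := fun m => (hm m).integrable_grad.aestronglyMeasurable
  refine HasW011Grad.of_tendsto hm ?_ ?_
    (tendsto_lintegral_enorm_sub_of_dominated m1 (h.integrable.abs.const_mul C) b1 l1)
    (tendsto_lintegral_enorm_sub_of_dominated m2 (h.integrable_grad.norm.const_mul C) b2 l2)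
  · refine Integrable.mono' (h.integrable.abs.const_mul C)
      (aestronglyMeasurable_of_tendsto_ae atTop m1 l1) ?_
    filter_upwards [l1, ae_all_iff.2 b1] with x hx hb
    exact le_of_tendsto hx.norm (Eventually.of_forall hb)
  · refine Integrable.mono' (h.integrable_grad.norm.const_mul C)
      (aestronglyMeasurable_of_tendsto_ae atTop m2 l2) ?_
    filter_upwards [l2, ae_all_iff.2 b2] with x hx hb
    exact le_of_tendsto hx.norm (Eventually.of_forall hb)

/-- A chain rule for `s ↦ |s - c| - |c|`, with a one-parameter family of values for its derivative
at `c`. -/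
theorem HasW011Grad.abs_sub_aux (h : HasW011Grad Ω u G) (c σ : ℝ) :
    HasW011Grad Ω (fun x => |u x - c| - |c|)
      (fun x => (if u x = c then σ / √(σ ^ 2 + 1) else (u x - c) / |u x - c|) • G x) := by
  have hε : ∀ m : ℕ, (0 : ℝ) < 1 / ((m : ℝ) + 1) := fun m => by positivity
  have hlim : Tendsto (fun m : ℕ => 1 / ((m : ℝ) + 1)) atTop (𝓝 0) :=
    tendsto_one_div_add_atTop_nhds_zero_nat
  have hpos : ∀ (m : ℕ) (s : ℝ),
      0 < (s - c + σ * (1 / ((m : ℝ) + 1))) ^ 2 + (1 / ((m : ℝ) + 1)) ^ 2 := fun m s => by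
    have := hε m
    positivity
  have hder : ∀ (m : ℕ) (s : ℝ), HasDerivAt
      (fun s => √((s - c + σ * (1 / ((m : ℝ) + 1))) ^ 2 + (1 / ((m : ℝ) + 1)) ^ 2)
        - √((0 - c + σ * (1 / ((m : ℝ) + 1))) ^ 2 + (1 / ((m : ℝ) + 1)) ^ 2))
      ((s - c + σ * (1 / ((m : ℝ) + 1))) /
        √((s - c + σ * (1 / ((m : ℝ) + 1))) ^ 2 + (1 / ((m : ℝ) + 1)) ^ 2)) s := by
    intro m s
    have h1 : HasDerivAt (fun s : ℝ => s - c + σ * (1 / ((m : ℝ) + 1))) 1 s :=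
      ((hasDerivAt_id s).sub_const c).add_const _
    have h2 := (((h1.pow 2).add_const ((1 / ((m : ℝ) + 1)) ^ 2)).sqrt (hpos m s).ne').sub_const
      (√((0 - c + σ * (1 / ((m : ℝ) + 1))) ^ 2 + (1 / ((m : ℝ) + 1)) ^ 2))
    refine h2.congr_deriv ?_
    simp only [Nat.cast_ofNat, Pi.pow_apply]
    rw [mul_one, Nat.add_one_sub_one, pow_one, mul_div_mul_left _ _ two_ne_zero]
  have hsqrt : ∀ s : ℝ, Tendsto
      (fun m : ℕ => √((s - c + σ * (1 / ((m : ℝ) + 1))) ^ 2 + (1 / ((m : ℝ) + 1)) ^ 2)) atTop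
      (𝓝 |s - c|) := by
    intro s
    have hcont : Continuous fun e : ℝ => √((s - c + σ * e) ^ 2 + e ^ 2) := by fun_prop
    have := (hcont.tendsto 0).comp hlim
    simpa [Function.comp_def, Real.sqrt_sq_eq_abs] using this
  -- The smoothing is `√((s - c + σε)² + ε²)` with `ε = 1/(m+1)`, normalised to vanish at 0. The
  -- shift `σε` disappears in the limit function, yet its derivative at `c` is `σ/√(σ²+1)` for every
  -- `m`.
  have key := h.comp_of_tendsto
    (Φ := fun m s => √((s - c + σ * (1 / ((m : ℝ) + 1))) ^ 2 + (1 / ((m : ℝ) + 1)) ^ 2)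
        - √((0 - c + σ * (1 / ((m : ℝ) + 1))) ^ 2 + (1 / ((m : ℝ) + 1)) ^ 2))
    (Ψ := fun s => |s - c| - |c|)
    (g := fun s => if s = c then σ / √(σ ^ 2 + 1) else (s - c) / |s - c|) (C := 1)
    ?_ ?_ ?_ ?_ ?_
  · exact key
  · intro m
    refine ContDiff.sub (ContDiff.sqrt (by fun_prop) fun s => (hpos m s).ne') contDiff_const
  · intro m
    simp
  · intro m s
    rw [(hder m s).deriv, abs_div, abs_of_nonneg (Real.sqrt_nonneg _)]
    refine div_le_one_of_le₀ (Real.abs_le_sqrt ?_) (Real.sqrt_nonneg _)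
    have := hε m
    nlinarith [sq_nonneg (1 / ((m : ℝ) + 1))]
  · intro s
    have := (hsqrt s).sub (hsqrt 0)
    simpa using this
  · intro s
    simp only [fun m => (hder m s).deriv]
    by_cases hs : s = c
    · subst hs
      rw [if_pos rfl]
      refine tendsto_const_nhds.congr fun m => ?_
      have he := hε m
      rw [sub_self, zero_add,
        show (σ * (1 / ((m : ℝ) + 1))) ^ 2 + (1 / ((m : ℝ) + 1)) ^ 2
          = (σ ^ 2 + 1) * (1 / ((m : ℝ) + 1)) ^ 2 by ring,
        Real.sqrt_mul (by positivity), Real.sqrt_sq he.le, mul_div_mul_right _ _ he.ne']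
    · rw [if_neg hs]
      refine Tendsto.div ?_ (hsqrt s) (abs_ne_zero.2 (sub_ne_zero.2 hs))
      simpa using (hlim.const_mul σ).const_add (s - c)

/-- The smoothings with `σ = 0` and `σ = 1` give two weak gradients of the same function, which on
`{u = c}` are `0` and a nonzero multiple of `G`. Uniqueness forces `G` to vanish there. -/
theorem HasW011Grad.grad_eq_zero_of_eq (hΩ : IsOpen Ω) (h : HasW011Grad Ω u G) (c : ℝ) :
    ∀ᵐ x ∂(volume.restrict Ω), u x = c → G x = 0 := by
  have h0 := (h.abs_sub_aux c 0).hasWeakGrad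
  have h1 := (h.abs_sub_aux c 1).hasWeakGrad
  filter_upwards [h0.ae_eq hΩ h1] with x hx hc
  have : (1 / √(1 ^ 2 + 1) : ℝ) ≠ 0 := by positivity
  simp only [hc, if_true, zero_div, zero_smul] at hx
  exact (smul_eq_zero.1 hx.symm).resolve_left this

theorem HasW011Grad.abs_sub (h : HasW011Grad Ω u G) (c : ℝ) :
    HasW011Grad Ω (fun x => |u x - c| - |c|) (fun x => ((u x - c) / |u x - c|) • G x) := by
  refine (h.abs_sub_aux c 0).congr (EventuallyEq.refl _ _) (Eventually.of_forall fun x => ?_)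
  by_cases hx : u x = c <;> simp [hx]

theorem trunc_eq_abs {k : ℝ} (hk : 0 ≤ k) (s : ℝ) :
    trunc k s = 1 / 2 * ((|s - -k| - |-k|) - (|s - k| - |k|)) := by
  unfold trunc
  rw [abs_neg]
  rcases le_total s (-k) with h1 | h1
  · rw [abs_of_nonpos (by linarith : s - -k ≤ 0), abs_of_nonpos (by linarith : s - k ≤ 0),
      min_eq_left (by linarith), max_eq_left h1]
    ring
  · rcases le_total s k with h2 | h2
    · rw [abs_of_nonneg (by linarith : 0 ≤ s - -k), abs_of_nonpos (by linarith : s - k ≤ 0),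
        min_eq_left h2, max_eq_right h1]
      ring
    · rw [abs_of_nonneg (by linarith : 0 ≤ s - -k), abs_of_nonneg (by linarith : 0 ≤ s - k),
        min_eq_right h2, max_eq_right (by linarith)]
      ring

/-- A truncation is half a difference of two shifted absolute values. On the level sets `u = ±k`,
where their derivatives give the wrong factor, `G` vanishes. -/
theorem HasW011Grad.trunc (hΩ : IsOpen Ω) (h : HasW011Grad Ω u G) {k : ℝ} (hk : 0 < k) :
    HasW011Grad Ω (fun x => trunc k (u x)) (fun x => if |u x| < k then G x else 0) := by
  refine (((h.abs_sub (-k)).sub (h.abs_sub k)).const_mul (1 / 2)).congr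
    (Eventually.of_forall fun x => (trunc_eq_abs hk.le _).symm) ?_
  filter_upwards [h.grad_eq_zero_of_eq hΩ k, h.grad_eq_zero_of_eq hΩ (-k)] with x h1 h2
  rcases lt_trichotomy (u x) k with hx | hx | hx
  · rcases lt_trichotomy (u x) (-k) with hy | hy | hy
    · rw [if_neg (by rw [abs_lt]; intro h; linarith [h.1]), abs_of_neg (by linarith),
        abs_of_neg (by linarith), div_neg, div_neg, div_self (by linarith), div_self (by linarith)]
      simp
    · simp [h2 hy]
    · rw [if_pos (abs_lt.2 ⟨hy, hx⟩), abs_of_pos (by linarith), abs_of_neg (by linarith), div_neg,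
        div_self (by linarith), div_self (by linarith), ← sub_smul, smul_smul]
      norm_num
  · simp [h1 hx]
  · rw [if_neg (by rw [abs_lt]; intro h; linarith [h.2]), abs_of_pos (by linarith),
        abs_of_pos (by linarith), div_self (by linarith), div_self (by linarith)]
    simp

theorem HasW011Grad.min_zero (hΩ : IsOpen Ω) (h : HasW011Grad Ω u G) :
    HasW011Grad Ω (fun x => min (u x) 0) (fun x => if u x < 0 then G x else 0) := by
  refine ((h.sub (h.abs_sub 0)).const_mul (1 / 2)).congr (Eventually.of_forall fun x => ?_) ?_
  · rcases le_total (u x) 0 with hx | hx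
    · simp only [sub_zero, abs_zero, abs_of_nonpos hx, min_eq_left hx]
      ring
    · simp [abs_of_nonneg hx, min_eq_right hx]
  filter_upwards [h.grad_eq_zero_of_eq hΩ 0] with x h1
  rcases lt_trichotomy (u x) 0 with hx | hx | hx
  · rw [if_pos hx, sub_zero, abs_of_neg hx, div_neg, div_self hx.ne, neg_smul, one_smul,
      sub_neg_eq_add, ← two_smul ℝ, smul_smul]
    norm_num
  · simp [h1 hx]
  · simp [abs_of_pos hx, hx.ne', hx.le]

end ChainRule

/-! ### Young's inequality and monotonicity, uniform in the exponent. -/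

section Inequalities

theorem rpow_sub_one_mul_self {t p : ℝ} (ht : 0 ≤ t) (hp : 1 < p) : t ^ (p - 1) * t = t ^ p := by
  rcases ht.eq_or_lt with rfl | ht
  · rw [mul_zero, Real.zero_rpow (by linarith)]
  · rw [← Real.rpow_add_one ht.ne', sub_add_cancel]

theorem rpow_sub_two_mul_self {t p : ℝ} (ht : 0 ≤ t) (hp : 1 < p) :
    t ^ (p - 2) * t = t ^ (p - 1) := by
  rcases ht.eq_or_lt with rfl | ht
  · rw [mul_zero, Real.zero_rpow (by linarith)]
  · rw [← Real.rpow_add_one ht.ne']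
    congr 1
    ring

/-- Young's inequality with a small factor on the term `t ^ p`. -/
theorem mul_rpow_sub_one_le {s t p P δ : ℝ} (hs : 0 ≤ s) (ht : 0 ≤ t) (hp : 1 < p) (hP : p ≤ P)
    (hδ : 0 < δ) (hδ1 : δ ≤ 1) : s * t ^ (p - 1) ≤ δ * t ^ p + δ⁻¹ ^ P * s ^ p := by
  have h1 : 0 ≤ t ^ p := Real.rpow_nonneg ht _
  have h2 : 0 ≤ s ^ p := Real.rpow_nonneg hs _
  have h3 : 0 ≤ t ^ (p - 1) := Real.rpow_nonneg ht _
  have hδ' : 1 ≤ δ⁻¹ := (one_le_inv₀ hδ).2 hδ1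
  rcases le_total s (δ * t) with h | h
  · have : s * t ^ (p - 1) ≤ δ * t ^ p := by
      rw [← rpow_sub_one_mul_self ht hp]
      nlinarith
    have : 0 ≤ δ⁻¹ ^ P * s ^ p := by positivity
    linarith
  · have h4 : t ≤ δ⁻¹ * s := by
      rw [inv_mul_eq_div, le_div_iff₀ hδ]
      linarith
    have h5 : t ^ (p - 1) ≤ δ⁻¹ ^ (p - 1) * s ^ (p - 1) := by
      rw [← Real.mul_rpow (by positivity) hs]
      exact Real.rpow_le_rpow ht h4 (by linarith)
    have h6 : δ⁻¹ ^ (p - 1) ≤ δ⁻¹ ^ P := Real.rpow_le_rpow_of_exponent_le hδ' (by linarith)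
    calc s * t ^ (p - 1) ≤ s * (δ⁻¹ ^ (p - 1) * s ^ (p - 1)) := by gcongr
      _ = δ⁻¹ ^ (p - 1) * s ^ p := by rw [← rpow_sub_one_mul_self hs hp]; ring
      _ ≤ δ⁻¹ ^ P * s ^ p := by gcongr
      _ ≤ δ * t ^ p + δ⁻¹ ^ P * s ^ p := by
        have : 0 ≤ δ * t ^ p := by positivity
        linarith

/-- Young's inequality with a small factor on the term `s ^ p`. -/
theorem exists_mul_le_rpow_add {q : ℝ} (hq : 1 < q) {δ : ℝ} (hδ : 0 < δ) :
    ∃ C : ℝ, 0 ≤ C ∧ ∀ p s y : ℝ, q ≤ p → 0 ≤ s → 0 ≤ y →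
      y * s ≤ δ * s ^ p + C * y ^ (p / (p - 1)) := by
  wlog hδ1 : δ ≤ 1
  · obtain ⟨C, hC, h⟩ := this hq one_pos le_rfl
    refine ⟨C, hC, fun p s y hp hs hy => (h p s y hp hs hy).trans ?_⟩
    have : 0 ≤ s ^ p := Real.rpow_nonneg hs _
    nlinarith
  -- This `d ≤ 1` satisfies `d^(p-1) ≤ δ` for every `p ≥ q` at once. With `y = t^(p-1)`, the two
  -- cases `t ≤ d s` and `d s ≤ t` each need only one of the two terms.
  set d := δ ^ (q - 1)⁻¹ with hd
  have hd0 : 0 < d := Real.rpow_pos_of_pos hδ _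
  have hd1 : d ≤ 1 := Real.rpow_le_one hδ.le hδ1 (inv_nonneg.2 (by linarith))
  have hdq : d ^ (q - 1) = δ := Real.rpow_inv_rpow hδ.le (by linarith)
  refine ⟨d⁻¹, by positivity, fun p s y hp hs hy => ?_⟩
  have hp1 : 1 < p := by linarith
  set t := y ^ (p - 1)⁻¹ with ht
  have ht0 : 0 ≤ t := Real.rpow_nonneg hy _
  have hy' : y = t ^ (p - 1) := (Real.rpow_inv_rpow hy (by linarith)).symm
  have hy'' : y ^ (p / (p - 1)) = t ^ p := by
    rw [ht, ← Real.rpow_mul hy]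
    congr 1
    field_simp
  have h1 : 0 ≤ s ^ p := Real.rpow_nonneg hs _
  have h2 : 0 ≤ t ^ p := Real.rpow_nonneg ht0 _
  rw [hy'']
  rcases le_total t (d * s) with h | h
  · have h3 : y ≤ δ * s ^ (p - 1) := by
      rw [hy', ← hdq]
      calc t ^ (p - 1) ≤ (d * s) ^ (p - 1) := Real.rpow_le_rpow ht0 h (by linarith)
        _ = d ^ (p - 1) * s ^ (p - 1) := Real.mul_rpow hd0.le hs
        _ ≤ d ^ (q - 1) * s ^ (p - 1) := by
          gcongr ?_ * _
          exact Real.rpow_le_rpow_of_exponent_ge hd0 hd1 (by linarith)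
    have h4 : y * s ≤ δ * s ^ p := by
      rw [← rpow_sub_one_mul_self hs hp1]
      nlinarith
    have : 0 ≤ d⁻¹ * t ^ p := by positivity
    linarith
  · have h3 : s ≤ d⁻¹ * t := by
      rw [inv_mul_eq_div, le_div_iff₀ hd0]
      linarith
    have h4 : y * s ≤ d⁻¹ * t ^ p := by
      rw [← rpow_sub_one_mul_self ht0 hp1, ← hy']
      nlinarith
    have : 0 ≤ δ * s ^ p := by positivity
    linarith

variable {E : Type*} [NormedAddCommGroup E] [InnerProductSpace ℝ E]

/-- Separates a radial part, nonnegative because powers are monotone, from an angular part,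
nonnegative by Cauchy–Schwarz. It covers `p < 2` and `p ≥ 2` alike. -/
theorem inner_rpow_smul_sub {p : ℝ} (hp : 1 < p) (ξ η : E) :
    inner ℝ (‖ξ‖ ^ (p - 2) • ξ - ‖η‖ ^ (p - 2) • η) (ξ - η)
      = (‖ξ‖ ^ (p - 1) - ‖η‖ ^ (p - 1)) * (‖ξ‖ - ‖η‖)
        + (‖ξ‖ ^ (p - 2) + ‖η‖ ^ (p - 2)) * (‖ξ‖ * ‖η‖ - inner ℝ ξ η) := by
  rw [← rpow_sub_two_mul_self (norm_nonneg ξ) hp, ← rpow_sub_two_mul_self (norm_nonneg η) hp]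
  simp only [inner_sub_left, inner_sub_right, real_inner_smul_left, real_inner_self_eq_norm_sq,
    real_inner_comm ξ η]
  ring

theorem rpow_norm_sub_mul_nonneg {p : ℝ} (hp : 1 < p) {s t : ℝ} (hs : 0 ≤ s) (ht : 0 ≤ t) :
    0 ≤ (s ^ (p - 1) - t ^ (p - 1)) * (s - t) := by
  rcases le_total s t with h | h
  · exact mul_nonneg_of_nonpos_of_nonpos
      (sub_nonpos.2 (Real.rpow_le_rpow hs h (by linarith))) (by linarith)
  · exact mul_nonneg (sub_nonneg.2 (Real.rpow_le_rpow ht h (by linarith))) (by linarith)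

theorem inner_rpow_smul_sub_nonneg {p : ℝ} (hp : 1 < p) (ξ η : E) :
    0 ≤ inner ℝ (‖ξ‖ ^ (p - 2) • ξ - ‖η‖ ^ (p - 2) • η) (ξ - η) := by
  rw [inner_rpow_smul_sub hp]
  have h1 := rpow_norm_sub_mul_nonneg hp (norm_nonneg ξ) (norm_nonneg η)
  have h2 : 0 ≤ ‖ξ‖ * ‖η‖ - inner ℝ ξ η := sub_nonneg.2 (real_inner_le_norm ξ η)
  positivity

/-- Uniform strict monotonicity of `ξ ↦ |ξ|^{p-2} ξ`, for `p` in a compact subinterval of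
`(1, ∞)`. -/
theorem exists_rpow_norm_sub_le {q P : ℝ} (hq : 1 < q) {δ : ℝ} (hδ : 0 < δ) :
    ∃ C : ℝ, 0 ≤ C ∧ ∀ (p : ℝ) (ξ η : E), q ≤ p → p ≤ P →
      ‖ξ - η‖ ^ p ≤ δ * (‖ξ‖ ^ p + ‖η‖ ^ p)
        + C * inner ℝ (‖ξ‖ ^ (p - 2) • ξ - ‖η‖ ^ (p - 2) • η) (ξ - η) := by
  wlog hδ1 : δ ≤ 1
  · obtain ⟨C, hC, h⟩ := this (E := E) (P := P) hq one_pos le_rfl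
    refine ⟨C, hC, fun p ξ η hp hP => (h p ξ η hp hP).trans ?_⟩
    have : 0 ≤ ‖ξ‖ ^ p + ‖η‖ ^ p := by positivity
    nlinarith
  -- `c` measures the relative gap of the powers when `t ≤ (1 - δ/2) s`. The two entries of the
  -- minimum `m` are the lower bounds from the angular and the radial case.
  set c : ℝ := 1 - (1 - δ / 2) ^ (q - 1) with hc
  have hc0 : 0 < c := sub_pos.2 (Real.rpow_lt_one (by linarith) (by linarith) (by linarith))
  set m : ℝ := min (δ ^ 2 / 4) (c * (δ / 2)) with hm
  have hm0 : 0 < m := lt_min (by positivity) (by positivity)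
  have key : ∀ (p : ℝ) (ξ η : E), q ≤ p → p ≤ P → ‖η‖ ≤ ‖ξ‖ →
      ‖ξ - η‖ ^ p ≤ δ * (‖ξ‖ ^ p + ‖η‖ ^ p) + 2 ^ P / m *
        inner ℝ (‖ξ‖ ^ (p - 2) • ξ - ‖η‖ ^ (p - 2) • η) (ξ - η) := by
    intro p ξ η hp hP hle
    have hp1 : 1 < p := by linarith
    have hE := inner_rpow_smul_sub_nonneg hp1 ξ η
    by_cases hcase : ‖ξ - η‖ ^ p ≤ δ * (‖ξ‖ ^ p + ‖η‖ ^ p)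
    · have : 0 ≤ 2 ^ P / m * inner ℝ (‖ξ‖ ^ (p - 2) • ξ - ‖η‖ ^ (p - 2) • η) (ξ - η) := by
        positivity
      linarith
    · have hs0 : 0 < ‖ξ‖ := by
        rcases (norm_nonneg ξ).eq_or_lt with h | h
        · exfalso
          apply hcase
          have hη : η = 0 := norm_le_zero_iff.1 (hle.trans h.symm.le)
          have hξ : ξ = 0 := norm_eq_zero.1 h.symm
          rw [hη, hξ, sub_zero, norm_zero, Real.zero_rpow (by linarith)]
          simp
        · exact h
      set s := ‖ξ‖ with hs
      set t := ‖η‖ with ht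
      have ht0 : 0 ≤ t := norm_nonneg η
      -- If the first term does not already dominate, then `ξ` and `η` are apart by a fixed fraction
      -- of `s`, because `δ^p ≤ δ`.
      have hd : δ * s < ‖ξ - η‖ := by
        by_contra hle'
        apply hcase
        calc ‖ξ - η‖ ^ p ≤ (δ * s) ^ p :=
              Real.rpow_le_rpow (norm_nonneg _) (not_lt.1 hle') (by linarith)
          _ = δ ^ p * s ^ p := Real.mul_rpow hδ.le hs0.le
          _ ≤ δ ^ (1 : ℝ) * s ^ p := by
            gcongr ?_ * _
            exact Real.rpow_le_rpow_of_exponent_ge hδ hδ1 hp1.le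
          _ ≤ δ * (s ^ p + t ^ p) := by
            rw [Real.rpow_one]
            gcongr
            have : 0 ≤ t ^ p := by positivity
            linarith
      have hnorm : ‖ξ - η‖ ^ 2 = (s - t) ^ 2 + 2 * (s * t - inner ℝ ξ η) := by
        rw [norm_sub_sq_real]
        ring
      have hD : 0 ≤ s * t - inner ℝ ξ η := sub_nonneg.2 (real_inner_le_norm ξ η)
      have hmE : m * s ^ p
          ≤ inner ℝ (‖ξ‖ ^ (p - 2) • ξ - ‖η‖ ^ (p - 2) • η) (ξ - η) := by
        rw [inner_rpow_smul_sub hp1]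
        have hn1 := rpow_norm_sub_mul_nonneg hp1 hs0.le ht0
        have hn2 : 0 ≤ t ^ (p - 2) * (s * t - inner ℝ ξ η) := by positivity
        have hn3 : 0 ≤ s ^ (p - 2) * (s * t - inner ℝ ξ η) := by positivity
        have hsp : 0 ≤ s ^ p := by positivity
        have hsq : (δ * s) ^ 2 < ‖ξ - η‖ ^ 2 :=
          pow_lt_pow_left₀ hd (by positivity) two_ne_zero
        -- Since `|ξ - η|² = (s - t)² + 2 (s t - ξ·η)` exceeds `δ² s²`, either the angular defect is
        -- at least `δ² s²/4` or the radial gap `s - t` is at least `δ s/2`.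
        rcases le_total (δ ^ 2 / 4 * s ^ 2) (s * t - inner ℝ ξ η) with h | h
        · have h5 : δ ^ 2 / 4 * s ^ p ≤ s ^ (p - 2) * (s * t - inner ℝ ξ η) := by
            have : s ^ p = s ^ (p - 2) * s ^ 2 := by
              rw [← Real.rpow_add_natCast hs0.ne']
              norm_num
            rw [this]
            calc δ ^ 2 / 4 * (s ^ (p - 2) * s ^ 2) = s ^ (p - 2) * (δ ^ 2 / 4 * s ^ 2) := by ring
              _ ≤ _ := by gcongr
          have h6 : m * s ^ p ≤ δ ^ 2 / 4 * s ^ p := by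
            gcongr
            exact min_le_left _ _
          rw [← hs, ← ht]
          linarith
        · have h4 : δ / 2 * s ≤ s - t := by
            refine le_of_sq_le_sq ?_ (by linarith)
            nlinarith
          have h5 : t ≤ (1 - δ / 2) * s := by linarith
          have h7 : t ^ (p - 1) ≤ (1 - δ / 2) ^ (q - 1) * s ^ (p - 1) :=
            calc t ^ (p - 1) ≤ ((1 - δ / 2) * s) ^ (p - 1) :=
                  Real.rpow_le_rpow ht0 h5 (by linarith)
              _ = (1 - δ / 2) ^ (p - 1) * s ^ (p - 1) := Real.mul_rpow (by linarith) hs0.le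
              _ ≤ _ := by
                gcongr ?_ * _
                exact Real.rpow_le_rpow_of_exponent_ge (by linarith) (by linarith) (by linarith)
          have h8 : c * s ^ (p - 1) ≤ s ^ (p - 1) - t ^ (p - 1) := by
            rw [hc]
            linarith
          have h9 : c * (δ / 2) * s ^ p ≤ (s ^ (p - 1) - t ^ (p - 1)) * (s - t) := by
            rw [← rpow_sub_one_mul_self hs0.le hp1]
            calc c * (δ / 2) * (s ^ (p - 1) * s) = (c * s ^ (p - 1)) * (δ / 2 * s) := by ring
              _ ≤ _ := mul_le_mul h8 h4 (by positivity)
                (le_trans (by positivity) h8)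
          have h6 : m * s ^ p ≤ c * (δ / 2) * s ^ p := by
            gcongr
            exact min_le_right _ _
          rw [← hs, ← ht]
          linarith
      have hup : ‖ξ - η‖ ^ p ≤ 2 ^ P * s ^ p :=
        calc ‖ξ - η‖ ^ p ≤ (2 * s) ^ p := by
              refine Real.rpow_le_rpow (norm_nonneg _) ?_ (by linarith)
              linarith [norm_sub_le ξ η]
          _ = 2 ^ p * s ^ p := Real.mul_rpow (by norm_num) hs0.le
          _ ≤ 2 ^ P * s ^ p := by
            gcongr ?_ * _
            exact Real.rpow_le_rpow_of_exponent_le (by norm_num) hP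
      have h10 : 2 ^ P * s ^ p ≤ 2 ^ P / m *
          inner ℝ (‖ξ‖ ^ (p - 2) • ξ - ‖η‖ ^ (p - 2) • η) (ξ - η) :=
        calc (2 : ℝ) ^ P * s ^ p = 2 ^ P / m * (m * s ^ p) := by field_simp
          _ ≤ _ := by gcongr
      have : 0 ≤ δ * (s ^ p + t ^ p) := by positivity
      linarith
  refine ⟨2 ^ P / m, by positivity, fun p ξ η hp hP => ?_⟩
  rcases le_total ‖η‖ ‖ξ‖ with h | h
  · exact key p ξ η hp hP h
  · have := key p η ξ hp hP h
    rw [norm_sub_rev, add_comm (‖ξ‖ ^ p)]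
    convert this using 3
    rw [← neg_sub η ξ, inner_neg_right, ← inner_neg_left, neg_sub]

end Inequalities

/-! ### Integrability and duality for a variable exponent. -/

section VariableExponent

/-- `p` is a measurable exponent with values a.e. in `[q, P] ⊂ (1, ∞)`. -/
structure IsExponent {α : Type*} [MeasurableSpace α] (μ : Measure α) (p : α → ℝ) (q P : ℝ) :
    Prop where
  aemeasurable : AEMeasurable p μ
  one_lt : 1 < q
  ae_mem : ∀ᵐ x ∂μ, q ≤ p x ∧ p x ≤ P

variable {α E : Type*} [MeasurableSpace α] {μ : Measure α} [NormedAddCommGroup E]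
  {p : α → ℝ} {q P : ℝ}

theorem IsExponent.aestronglyMeasurable_rpow (hp : IsExponent μ p q P) {F : α → E}
    (hF : AEStronglyMeasurable F μ) : AEStronglyMeasurable (fun x => ‖F x‖ ^ p x) μ :=
  (hF.norm.aemeasurable.pow hp.aemeasurable).aestronglyMeasurable

theorem IsExponent.aestronglyMeasurable_rpow_conj (hp : IsExponent μ p q P) {F : α → E}
    (hF : AEStronglyMeasurable F μ) :
    AEStronglyMeasurable (fun x => ‖F x‖ ^ (p x / (p x - 1))) μ :=
  (hF.norm.aemeasurable.pow
    (hp.aemeasurable.div (hp.aemeasurable.sub_const 1))).aestronglyMeasurable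

/-- Raising the base to at least 1 makes the bound independent of the exponent, which varies with
the point. -/
theorem rpow_le_max_rpow {y B e Q : ℝ} (hy : 0 ≤ y) (hB : y ≤ B) (he : 0 ≤ e) (hQ : e ≤ Q) :
    y ^ e ≤ max 1 B ^ Q :=
  (Real.rpow_le_rpow hy (hB.trans (le_max_right _ _)) he).trans
    (Real.rpow_le_rpow_of_exponent_le (le_max_left _ _) hQ)

theorem IsExponent.conj_le (hq : 1 < q) {p : ℝ} (h : q ≤ p) : p / (p - 1) ≤ q / (q - 1) := by
  rw [div_le_div_iff₀ (by linarith) (by linarith)]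
  linarith

theorem conj_pos {p : ℝ} (h : 1 < p) : 0 < p / (p - 1) :=
  div_pos (by linarith) (by linarith)

theorem IsExponent.integrable_rpow_of_bound [IsFiniteMeasure μ] (hp : IsExponent μ p q P)
    {F : α → E} (hF : AEStronglyMeasurable F μ) {B : ℝ} (hB : ∀ᵐ x ∂μ, ‖F x‖ ≤ B) :
    Integrable (fun x => ‖F x‖ ^ p x) μ := by
  refine Integrable.of_bound (hp.aestronglyMeasurable_rpow hF) (max 1 B ^ P) ?_
  filter_upwards [hB, hp.ae_mem] with x hx hpx
  rw [Real.norm_of_nonneg (by positivity)]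
  exact rpow_le_max_rpow (norm_nonneg _) hx (by linarith [hp.one_lt]) hpx.2

theorem IsExponent.integrable_rpow_conj_of_bound [IsFiniteMeasure μ] (hp : IsExponent μ p q P)
    {F : α → E} (hF : AEStronglyMeasurable F μ) {B : ℝ} (hB : ∀ᵐ x ∂μ, ‖F x‖ ≤ B) :
    Integrable (fun x => ‖F x‖ ^ (p x / (p x - 1))) μ := by
  refine Integrable.of_bound (hp.aestronglyMeasurable_rpow_conj hF) (max 1 B ^ (q / (q - 1))) ?_
  filter_upwards [hB, hp.ae_mem] with x hx hpx
  rw [Real.norm_of_nonneg (by positivity)]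
  exact rpow_le_max_rpow (norm_nonneg _) hx (conj_pos (hp.one_lt.trans_le hpx.1)).le
    (IsExponent.conj_le hp.one_lt hpx.1)

theorem IsExponent.integrable_of_rpow [IsFiniteMeasure μ] (hp : IsExponent μ p q P) {F : α → E}
    (hF : AEStronglyMeasurable F μ) (h : Integrable (fun x => ‖F x‖ ^ p x) μ) :
    Integrable F μ := by
  refine Integrable.mono' ((integrable_const (1 : ℝ)).add h) hF ?_
  filter_upwards [hp.ae_mem] with x hx
  show ‖F x‖ ≤ 1 + ‖F x‖ ^ p x
  have h0 : 0 ≤ ‖F x‖ ^ p x := by positivity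
  rcases le_total ‖F x‖ 1 with h | h
  · linarith
  · have := Real.rpow_le_rpow_of_exponent_le h (show (1 : ℝ) ≤ p x by linarith [hp.one_lt])
    rw [Real.rpow_one] at this
    linarith

theorem IsExponent.integrable_rpow_mono {E' : Type*} [NormedAddCommGroup E']
    (hp : IsExponent μ p q P) {F : α → E} {H : α → E'}
    (hF : AEStronglyMeasurable F μ) (hH : Integrable (fun x => ‖H x‖ ^ p x) μ)
    (hle : ∀ᵐ x ∂μ, ‖F x‖ ≤ ‖H x‖) : Integrable (fun x => ‖F x‖ ^ p x) μ := by
  refine hH.mono' (hp.aestronglyMeasurable_rpow hF) ?_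
  filter_upwards [hle, hp.ae_mem] with x hx hpx
  rw [Real.norm_of_nonneg (by positivity)]
  exact Real.rpow_le_rpow (norm_nonneg _) hx (by linarith [hp.one_lt])

theorem add_rpow_le_two_rpow {a b p P : ℝ} (ha : 0 ≤ a) (hb : 0 ≤ b) (hp : 0 ≤ p) (hP : p ≤ P) :
    (a + b) ^ p ≤ 2 ^ P * (a ^ p + b ^ p) := by
  have h1 : (a + b) ^ p ≤ (2 * max a b) ^ p := by
    refine Real.rpow_le_rpow (by positivity) ?_ hp
    linarith [le_max_left a b, le_max_right a b]
  have h2 : (2 * max a b) ^ p = 2 ^ p * max a b ^ p :=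
    Real.mul_rpow (by norm_num) (ha.trans (le_max_left _ _))
  have h3 : max a b ^ p ≤ a ^ p + b ^ p := by
    have := Real.rpow_nonneg ha p
    have := Real.rpow_nonneg hb p
    rcases max_cases a b with h | h <;> rw [h.1] <;> linarith
  have h4 : (2 : ℝ) ^ p ≤ 2 ^ P := Real.rpow_le_rpow_of_exponent_le (by norm_num) hP
  calc (a + b) ^ p ≤ 2 ^ p * max a b ^ p := h1.trans h2.le
    _ ≤ 2 ^ P * (a ^ p + b ^ p) := by gcongr

theorem IsExponent.integrable_rpow_add (hp : IsExponent μ p q P) {F H : α → E}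
    (hFm : AEStronglyMeasurable F μ) (hHm : AEStronglyMeasurable H μ)
    (hF : Integrable (fun x => ‖F x‖ ^ p x) μ) (hH : Integrable (fun x => ‖H x‖ ^ p x) μ) :
    Integrable (fun x => ‖F x + H x‖ ^ p x) μ := by
  refine ((hF.add hH).const_mul (2 ^ P)).mono' (hp.aestronglyMeasurable_rpow (hFm.add hHm)) ?_
  filter_upwards [hp.ae_mem] with x hpx
  have : 0 ≤ p x := by linarith [hp.one_lt]
  rw [Real.norm_of_nonneg (by positivity)]
  exact (Real.rpow_le_rpow (norm_nonneg _) (norm_add_le _ _) this).trans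
    (add_rpow_le_two_rpow (norm_nonneg _) (norm_nonneg _) this hpx.2)

theorem IsExponent.integrable_rpow_sub (hp : IsExponent μ p q P) {F H : α → E}
    (hFm : AEStronglyMeasurable F μ) (hHm : AEStronglyMeasurable H μ)
    (hF : Integrable (fun x => ‖F x‖ ^ p x) μ) (hH : Integrable (fun x => ‖H x‖ ^ p x) μ) :
    Integrable (fun x => ‖F x - H x‖ ^ p x) μ := by
  simpa [sub_eq_add_neg] using hp.integrable_rpow_add hFm hHm.neg hF (by simpa using hH)

variable [InnerProductSpace ℝ E]

theorem IsExponent.integrable_inner (hp : IsExponent μ p q P) {F G : α → E}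
    (hF : AEStronglyMeasurable F μ) (hG : AEStronglyMeasurable G μ)
    (hFi : Integrable (fun x => ‖F x‖ ^ (p x / (p x - 1))) μ)
    (hGi : Integrable (fun x => ‖G x‖ ^ p x) μ) : Integrable (fun x => inner ℝ (F x) (G x)) μ := by
  obtain ⟨C, hC, h⟩ := exists_mul_le_rpow_add hp.one_lt one_pos
  refine Integrable.mono' ((hGi.const_mul 1).add (hFi.const_mul C)) (hF.inner hG) ?_
  filter_upwards [hp.ae_mem] with x hx
  exact (norm_inner_le_norm _ _).trans (h _ _ _ hx.1 (norm_nonneg _) (norm_nonneg _))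

/-- The error `∫ (F - F_m) · G_j` is uniform in `j`: Young's inequality puts a small factor on the
bounded modular of `G_j` and a fixed constant on the modular of `F - F_m` in the conjugate exponent,
after which `m` is chosen. -/
theorem IsExponent.tendsto_integral_inner_of_approx (hp : IsExponent μ p q P)
    {Gn : ℕ → α → E} {G F : α → E} {Fm : ℕ → α → E} {M : ℝ}
    (hGm : ∀ j, AEStronglyMeasurable (Gn j) μ) (hGi : ∀ j, Integrable (fun x => ‖Gn j x‖ ^ p x) μ)
    (hGM : ∀ j, ∫ x, ‖Gn j x‖ ^ p x ∂μ ≤ M) (hF : AEStronglyMeasurable F μ)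
    (hFm : ∀ m, AEStronglyMeasurable (Fm m) μ)
    (hFi : Integrable (fun x => ‖F x‖ ^ (p x / (p x - 1))) μ)
    (hFmi : ∀ m, Integrable (fun x => ‖F x - Fm m x‖ ^ (p x / (p x - 1))) μ)
    (h0 : Tendsto (fun m => ∫ x, ‖F x - Fm m x‖ ^ (p x / (p x - 1)) ∂μ) atTop (𝓝 0))
    (h1 : ∀ m, Tendsto (fun j => ∫ x, inner ℝ (Fm m x) (Gn j x) ∂μ) atTop
      (𝓝 (∫ x, inner ℝ (Fm m x) (G x) ∂μ)))
    (h2 : Tendsto (fun m => ∫ x, inner ℝ (Fm m x) (G x) ∂μ) atTop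
      (𝓝 (∫ x, inner ℝ (F x) (G x) ∂μ))) :
    Tendsto (fun j => ∫ x, inner ℝ (F x) (Gn j x) ∂μ) atTop
      (𝓝 (∫ x, inner ℝ (F x) (G x) ∂μ)) := by
  rw [Metric.tendsto_atTop]
  intro ε hε
  obtain ⟨C, hC, hY⟩ := exists_mul_le_rpow_add hp.one_lt
    (show 0 < ε / (4 * (|M| + 1)) by positivity)
  have h0' : Tendsto (fun m => C * ∫ x, ‖F x - Fm m x‖ ^ (p x / (p x - 1)) ∂μ) atTop (𝓝 0) := by
    simpa using h0.const_mul C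
  obtain ⟨m, hm1, hm2⟩ := ((h0'.eventually_lt_const (show 0 < ε / 4 by positivity)).and
    (Metric.tendsto_nhds.1 h2 (ε / 4) (by positivity))).exists
  obtain ⟨J, hJ⟩ := Metric.tendsto_atTop.1 (h1 m) (ε / 4) (by positivity)
  refine ⟨J, fun j hj => ?_⟩
  have hj1 := hJ j hj
  have i1 := hp.integrable_inner hF (hGm j) hFi (hGi j)
  have i2 := hp.integrable_inner (hF.sub (hFm m)) (hGm j) (hFmi m) (hGi j)
  have e1 : (∫ x, inner ℝ (Fm m x) (Gn j x) ∂μ)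
      = (∫ x, inner ℝ (F x) (Gn j x) ∂μ) - ∫ x, inner ℝ ((F - Fm m) x) (Gn j x) ∂μ := by
    rw [← integral_sub i1 i2]
    refine integral_congr_ae (Eventually.of_forall fun x => ?_)
    simp [inner_sub_left]
  have e2 : |∫ x, inner ℝ ((F - Fm m) x) (Gn j x) ∂μ| < ε / 2 := by
    have b1 : ‖∫ x, inner ℝ ((F - Fm m) x) (Gn j x) ∂μ‖ ≤
        ∫ x, (ε / (4 * (|M| + 1)) * ‖Gn j x‖ ^ p x
          + C * ‖F x - Fm m x‖ ^ (p x / (p x - 1))) ∂μ := by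
      refine norm_integral_le_of_norm_le (((hGi j).const_mul _).add ((hFmi m).const_mul C)) ?_
      filter_upwards [hp.ae_mem] with x hx
      exact (norm_inner_le_norm _ _).trans (hY _ _ _ hx.1 (norm_nonneg _) (norm_nonneg _))
    rw [integral_add ((hGi j).const_mul _) ((hFmi m).const_mul C), integral_const_mul,
      integral_const_mul, Real.norm_eq_abs] at b1
    have b2 : ε / (4 * (|M| + 1)) * ∫ x, ‖Gn j x‖ ^ p x ∂μ ≤ ε / 4 := by
      have : ∫ x, ‖Gn j x‖ ^ p x ∂μ ≤ |M| + 1 := by linarith [hGM j, le_abs_self M]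
      calc ε / (4 * (|M| + 1)) * ∫ x, ‖Gn j x‖ ^ p x ∂μ
          ≤ ε / (4 * (|M| + 1)) * (|M| + 1) := by gcongr
        _ = ε / 4 := by field_simp
    linarith
  rw [Real.dist_eq] at hj1 hm2 ⊢
  rw [abs_lt] at *
  constructor <;> linarith [hj1.1, hj1.2, hm2.1, hm2.2, e2.1, e2.2, e1]

/-- The admissible `F` are thus closed under uniformly bounded a.e. limits, the device by which weak
convergence is extended from test functions. -/
theorem IsExponent.tendsto_integral_inner_of_bounded_approx [IsFiniteMeasure μ]
    (hp : IsExponent μ p q P)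
    {Gn : ℕ → α → E} {G F : α → E} {Fm : ℕ → α → E} {M B : ℝ}
    (hGm : ∀ j, AEStronglyMeasurable (Gn j) μ) (hGi : ∀ j, Integrable (fun x => ‖Gn j x‖ ^ p x) μ)
    (hGM : ∀ j, ∫ x, ‖Gn j x‖ ^ p x ∂μ ≤ M) (hG : Integrable G μ)
    (hFm : ∀ m, AEStronglyMeasurable (Fm m) μ)
    (hB : ∀ m, ∀ᵐ x ∂μ, ‖Fm m x‖ ≤ B)
    (hlim : ∀ᵐ x ∂μ, Tendsto (fun m => Fm m x) atTop (𝓝 (F x)))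
    (h1 : ∀ m, Tendsto (fun j => ∫ x, inner ℝ (Fm m x) (Gn j x) ∂μ) atTop
      (𝓝 (∫ x, inner ℝ (Fm m x) (G x) ∂μ))) :
    Tendsto (fun j => ∫ x, inner ℝ (F x) (Gn j x) ∂μ) atTop
      (𝓝 (∫ x, inner ℝ (F x) (G x) ∂μ)) := by
  have hF : AEStronglyMeasurable F μ := aestronglyMeasurable_of_tendsto_ae atTop hFm hlim
  have hFB : ∀ᵐ x ∂μ, ‖F x‖ ≤ B := by
    filter_upwards [hlim, ae_all_iff.2 hB] with x hx hb
    exact le_of_tendsto hx.norm (Eventually.of_forall hb)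
  have hd : ∀ m, ∀ᵐ x ∂μ, ‖F x - Fm m x‖ ≤ B + B := fun m => by
    filter_upwards [hFB, hB m] with x h1 h2
    exact (norm_sub_le _ _).trans (add_le_add h1 h2)
  have hdi := fun m => hp.integrable_rpow_conj_of_bound (hF.sub (hFm m)) (hd m)
  refine hp.tendsto_integral_inner_of_approx hGm hGi hGM hF hFm
    (hp.integrable_rpow_conj_of_bound hF hFB) hdi ?_ h1 ?_
  · have := tendsto_integral_of_dominated_convergence
      (F := fun m x => ‖F x - Fm m x‖ ^ (p x / (p x - 1))) (f := fun _ => (0 : ℝ)) (μ := μ)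
      (fun _ => max 1 (B + B) ^ (q / (q - 1))) (fun m => (hdi m).aestronglyMeasurable)
      (integrable_const _) (fun m => ?_) ?_
    · simpa using this
    · filter_upwards [hd m, hp.ae_mem] with x hx hpx
      rw [Real.norm_of_nonneg (by positivity)]
      exact rpow_le_max_rpow (norm_nonneg _) hx (conj_pos (hp.one_lt.trans_le hpx.1)).le
        (IsExponent.conj_le hp.one_lt hpx.1)
    · filter_upwards [hlim, hp.ae_mem] with x hx hpx
      have he := conj_pos (hp.one_lt.trans_le hpx.1)
      have h3 : Tendsto (fun m => ‖F x - Fm m x‖) atTop (𝓝 0) := by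
        simpa using (hx.const_sub (F x)).norm
      simpa [Real.zero_rpow he.ne'] using h3.rpow_const (Or.inr he.le)
  · refine tendsto_integral_of_dominated_convergence (fun x => B * ‖G x‖)
      (fun m => (hFm m).inner hG.aestronglyMeasurable) (hG.norm.const_mul B) (fun m => ?_) ?_
    · filter_upwards [hB m] with x hx
      exact (norm_inner_le_norm _ _).trans (by gcongr)
    · filter_upwards [hlim] with x hx
      exact hx.inner tendsto_const_nhds

end VariableExponent

/-! ### From distributional to weak convergence in `L^{p(·)}`. -/

section WeakConvergence

variable {N : ℕ} {Ω : Set (EuclideanSpace ℝ (Fin N))}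

/-- Smooth cut-offs equal to 1 on `K` and vanishing outside its `1/(m+1)`-neighbourhood; a point off
the closed set `K` eventually lies outside these neighbourhoods. -/
theorem exists_isTestFun_tendsto_indicator (hΩ : IsOpen Ω) {K : Set (EuclideanSpace ℝ (Fin N))}
    (hK : IsCompact K) (hKΩ : K ⊆ Ω) :
    ∃ g : ℕ → EuclideanSpace ℝ (Fin N) → ℝ, (∀ m, IsTestFun Ω (g m)) ∧
      (∀ m x, |g m x| ≤ 1) ∧
      ∀ x, Tendsto (fun m => g m x) atTop (𝓝 (K.indicator (fun _ => 1) x)) := by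
  have hex : ∀ m : ℕ, ∃ g : EuclideanSpace ℝ (Fin N) → ℝ, IsTestFun Ω g ∧ (∀ x, |g x| ≤ 1) ∧
      (∀ x ∈ K, g x = 1) ∧ ∀ x, x ∉ Metric.thickening (1 / ((m : ℝ) + 1)) K → g x = 0 := by
    intro m
    obtain ⟨V, hV, hKV, hVU, hVc⟩ := exists_open_between_and_isCompact_closure hK
      (hΩ.inter (Metric.isOpen_thickening (δ := 1 / ((m : ℝ) + 1)) (E := K)))
      (Set.subset_inter hKΩ (Metric.self_subset_thickening (by positivity) K))
    obtain ⟨f, f0, f1, fI⟩ := exists_contMDiffMap_zero_one_of_isClosed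
      (modelWithCornersSelf ℝ (EuclideanSpace ℝ (Fin N))) (n := ⊤) hV.isClosed_compl hK.isClosed
      (Set.disjoint_left.2 fun x hx hx' => hx (hKV hx'))
    have hsupp : tsupport f ⊆ closure V := closure_mono fun x hx => by
      by_contra hxV
      exact hx (f0 hxV)
    refine ⟨f, ⟨f.contMDiff.contDiff, HasCompactSupport.of_support_subset_isCompact hVc
      (subset_closure.trans hsupp), hsupp.trans (hVU.trans Set.inter_subset_left)⟩, fun x => ?_,
      fun x hx => f1 hx, fun x hx => f0 fun hxV => hx (hVU (subset_closure hxV)).2⟩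
    rw [abs_of_nonneg (fI x).1]
    exact (fI x).2
  choose g hg hb h1 h0 using hex
  refine ⟨g, hg, hb, fun x => ?_⟩
  by_cases hx : x ∈ K
  · simp [hx, h1 _ x hx]
  · rw [Set.indicator_of_notMem hx]
    obtain ⟨ε, hε, hxε⟩ : ∃ ε, 0 < ε ∧ x ∉ Metric.thickening ε K := by
      rw [← hK.isClosed.closure_eq, Metric.closure_eq_iInter_thickening K] at hx
      simpa using hx
    refine tendsto_const_nhds.congr' ?_
    filter_upwards [(tendsto_one_div_add_atTop_nhds_zero_nat (𝕜 := ℝ)).eventually_lt_const hε]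
      with m hm
    exact (h0 m x fun h => hxε (Metric.thickening_mono hm.le K h)).symm

theorem exists_isCompact_tendsto_indicator {A : Set (EuclideanSpace ℝ (Fin N))}
    (hA : MeasurableSet A) (hfin : volume A ≠ ⊤) :
    ∃ K : ℕ → Set (EuclideanSpace ℝ (Fin N)), (∀ m, IsCompact (K m)) ∧ (∀ m, K m ⊆ A) ∧
      ∀ᵐ x ∂(volume : Measure (EuclideanSpace ℝ (Fin N))),
        Tendsto (fun m => (K m).indicator (fun _ => (1 : ℝ)) x) atTop
          (𝓝 (A.indicator (fun _ => 1) x)) := by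
  have hpos : ∀ m : ℕ, ((m : ℝ≥0∞) + 1)⁻¹ ≠ 0 := fun m => by simp
  choose L hLA hLc hL using fun m => hA.exists_isCompact_sdiff_lt hfin (hpos m)
  -- Inner regularity alone gives sets that need not be nested; their finite unions increase, so the
  -- indicators converge pointwise off a null set.
  refine ⟨Set.accumulate L, fun m => isCompact_accumulate hLc m,
    fun m => Set.iUnion₂_subset fun i _ => hLA i, ?_⟩
  have hnull : volume (A \ ⋃ i, L i) = 0 := by
    refine le_antisymm (ge_of_tendsto' (ENNReal.tendsto_inv_nat_nhds_zero.comp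
      (tendsto_add_atTop_nat 1)) fun m => ?_) zero_le
    refine (measure_mono (Set.sdiff_subset_sdiff_right (Set.subset_iUnion L m))).trans ?_
    simpa using (hL m).le
  filter_upwards [measure_eq_zero_iff_ae_notMem.1 hnull] with x hx
  by_cases hxA : x ∈ A
  · have : x ∈ ⋃ i, L i := by
      by_contra h
      exact hx ⟨hxA, h⟩
    obtain ⟨i, hi⟩ := Set.mem_iUnion.1 this
    refine tendsto_const_nhds.congr' ?_
    filter_upwards [eventually_ge_atTop i] with m hm
    rw [Set.indicator_of_mem hxA, Set.indicator_of_mem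
      (Set.mem_accumulate.2 ⟨i, hm, hi⟩)]
  · refine tendsto_const_nhds.congr fun m => ?_
    rw [Set.indicator_of_notMem hxA, Set.indicator_of_notMem]
    intro h
    obtain ⟨i, -, hi⟩ := Set.mem_accumulate.1 h
    exact hxA (hLA i hi)

variable {p : EuclideanSpace ℝ (Fin N) → ℝ} {q P M : ℝ}
  {Gn : ℕ → EuclideanSpace ℝ (Fin N) → EuclideanSpace ℝ (Fin N)}
  {F G : EuclideanSpace ℝ (Fin N) → EuclideanSpace ℝ (Fin N)}

/-- `Gn` is bounded in `L^{p(·)}(Ω)` and converges to `G ∈ L^1(Ω)` in the sense of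
distributions. -/
structure TendstoDistrib (Ω : Set (EuclideanSpace ℝ (Fin N)))
    (p : EuclideanSpace ℝ (Fin N) → ℝ) (M : ℝ)
    (Gn : ℕ → EuclideanSpace ℝ (Fin N) → EuclideanSpace ℝ (Fin N))
    (G : EuclideanSpace ℝ (Fin N) → EuclideanSpace ℝ (Fin N)) : Prop where
  meas : ∀ j, AEStronglyMeasurable (Gn j) (volume.restrict Ω)
  integrable_rpow : ∀ j, IntegrableOn (fun x => ‖Gn j x‖ ^ p x) Ω
  bound : ∀ j, ∫ x in Ω, ‖Gn j x‖ ^ p x ≤ M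
  integrable : IntegrableOn G Ω
  tendsto : ∀ φ, IsTestFun Ω φ →
    Tendsto (fun j => ∫ x in Ω, φ x • Gn j x) atTop (𝓝 (∫ x in Ω, φ x • G x))

theorem TendstoDistrib.tendsto_testFun [IsFiniteMeasure (volume.restrict Ω)]
    (hp : IsExponent (volume.restrict Ω) p q P)
    (h : TendstoDistrib Ω p M Gn G) {φ : EuclideanSpace ℝ (Fin N) → ℝ} (hφ : IsTestFun Ω φ)
    (v : EuclideanSpace ℝ (Fin N)) :
    Tendsto (fun j => ∫ x in Ω, inner ℝ (φ x • v) (Gn j x)) atTop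
      (𝓝 (∫ x in Ω, inner ℝ (φ x • v) (G x))) := by
  obtain ⟨C, -, hC⟩ := hφ.exists_bound
  have key : ∀ H : EuclideanSpace ℝ (Fin N) → EuclideanSpace ℝ (Fin N), IntegrableOn H Ω →
      ∫ x in Ω, inner ℝ (φ x • v) (H x) = inner ℝ v (∫ x in Ω, φ x • H x) := by
    intro H hH
    have hi : IntegrableOn (fun x => φ x • H x) Ω :=
      Integrable.bdd_smul hH C hφ.1.continuous.aestronglyMeasurable
        (Eventually.of_forall fun x => (hC x).1)
    rw [← integral_inner hi]
    simp only [real_inner_smul_left, real_inner_smul_right]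
  rw [key G h.integrable]
  simp only [fun j => key (Gn j) (hp.integrable_of_rpow (h.meas j) (h.integrable_rpow j))]
  exact tendsto_const_nhds.inner (h.tendsto φ hφ)

/-- Two bounded a.e. limits: cut-offs lead to indicators of compact subsets of `Ω`, and these to
indicators of measurable sets. -/
theorem TendstoDistrib.tendsto_indicator [IsFiniteMeasure (volume.restrict Ω)] (hΩ : IsOpen Ω)
    (hp : IsExponent (volume.restrict Ω) p q P) (h : TendstoDistrib Ω p M Gn G)
    {A : Set (EuclideanSpace ℝ (Fin N))} (hA : MeasurableSet A) (v : EuclideanSpace ℝ (Fin N)) :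
    Tendsto (fun j => ∫ x in Ω, inner ℝ (A.indicator (fun _ => (1 : ℝ)) x • v) (Gn j x)) atTop
      (𝓝 (∫ x in Ω, inner ℝ (A.indicator (fun _ => (1 : ℝ)) x • v) (G x))) := by
  have hcompact : ∀ K : Set (EuclideanSpace ℝ (Fin N)), IsCompact K → K ⊆ Ω →
      Tendsto (fun j => ∫ x in Ω, inner ℝ (K.indicator (fun _ => (1 : ℝ)) x • v) (Gn j x)) atTop
      (𝓝 (∫ x in Ω, inner ℝ (K.indicator (fun _ => (1 : ℝ)) x • v) (G x))) := by
    intro K hK hKΩ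
    obtain ⟨g, hg, hb, hlim⟩ := exists_isTestFun_tendsto_indicator hΩ hK hKΩ
    refine hp.tendsto_integral_inner_of_bounded_approx (Fm := fun m x => g m x • v) (B := ‖v‖)
      h.meas h.integrable_rpow h.bound h.integrable
      (fun m => ((hg m).1.continuous.smul continuous_const).aestronglyMeasurable)
      (fun m => Eventually.of_forall fun x => ?_)
      (Eventually.of_forall fun x => (hlim x).smul_const v)
      (fun m => h.tendsto_testFun hp (hg m) v)
    rw [norm_smul]
    exact mul_le_of_le_one_left (norm_nonneg _) (hb m x)
  have hfin : volume (A ∩ Ω) ≠ ⊤ := by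
    have : volume Ω < ⊤ := by simpa using measure_lt_top (volume.restrict Ω) Set.univ
    exact ((measure_mono Set.inter_subset_right).trans_lt this).ne
  obtain ⟨K, hKc, hKA, hlim⟩ :=
    exists_isCompact_tendsto_indicator (hA.inter hΩ.measurableSet) hfin
  refine hp.tendsto_integral_inner_of_bounded_approx
    (Fm := fun m x => (K m).indicator (fun _ => (1 : ℝ)) x • v) (B := ‖v‖)
    h.meas h.integrable_rpow h.bound h.integrable (fun m => ?_)
    (fun m => Eventually.of_forall fun x => ?_) ?_
    (fun m => hcompact (K m) (hKc m) ((hKA m).trans Set.inter_subset_right))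
  · exact ((measurable_const.indicator (hKc m).measurableSet).smul_const v).aestronglyMeasurable
  · rw [norm_smul]
    refine mul_le_of_le_one_left (norm_nonneg _) ?_
    by_cases hx : x ∈ K m <;> simp [hx]
  · filter_upwards [ae_restrict_of_ae hlim, ae_restrict_mem hΩ.measurableSet] with x hx hxΩ
    have : (A ∩ Ω).indicator (fun _ => (1 : ℝ)) x = A.indicator (fun _ => (1 : ℝ)) x := by
      by_cases hxA : x ∈ A <;> simp [hxA, hxΩ]
    rw [this] at hx
    exact hx.smul_const v

theorem TendstoDistrib.tendsto_of_bounded [IsFiniteMeasure (volume.restrict Ω)] (hΩ : IsOpen Ω)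
    (hp : IsExponent (volume.restrict Ω) p q P) (h : TendstoDistrib Ω p M Gn G)
    (hF : AEStronglyMeasurable F (volume.restrict Ω)) {B : ℝ}
    (hB : ∀ᵐ x ∂(volume.restrict Ω), ‖F x‖ ≤ B) :
    Tendsto (fun j => ∫ x in Ω, inner ℝ (F x) (Gn j x)) atTop
      (𝓝 (∫ x in Ω, inner ℝ (F x) (G x))) := by
  have hGni := fun j => hp.integrable_of_rpow (h.meas j) (h.integrable_rpow j)
  have hsimple : ∀ S : SimpleFunc (EuclideanSpace ℝ (Fin N)) (EuclideanSpace ℝ (Fin N)),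
      Tendsto (fun j => ∫ x in Ω, inner ℝ (S x) (Gn j x)) atTop
        (𝓝 (∫ x in Ω, inner ℝ (S x) (G x))) := by
    intro S
    induction S using SimpleFunc.induction with
    | @const c A hA =>
      have : ∀ x, (SimpleFunc.piecewise A hA (SimpleFunc.const _ c) (SimpleFunc.const _ 0)) x
          = A.indicator (fun _ => (1 : ℝ)) x • c := by
        intro x
        by_cases hx : x ∈ A <;> simp [hx]
      simp only [this]
      exact h.tendsto_indicator hΩ hp hA c
    | @add S T _ hS hT =>
      have key : ∀ H : EuclideanSpace ℝ (Fin N) → EuclideanSpace ℝ (Fin N), IntegrableOn H Ω →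
          ∫ x in Ω, inner ℝ ((S + T) x) (H x)
            = (∫ x in Ω, inner ℝ (S x) (H x)) + ∫ x in Ω, inner ℝ (T x) (H x) := by
        intro H hH
        have hi : ∀ R : SimpleFunc (EuclideanSpace ℝ (Fin N)) (EuclideanSpace ℝ (Fin N)),
            IntegrableOn (fun x => inner ℝ (R x) (H x)) Ω := by
          intro R
          obtain ⟨C, hC⟩ := R.exists_forall_norm_le
          refine Integrable.mono' (hH.norm.const_mul C)
            (R.measurable.aestronglyMeasurable.inner hH.aestronglyMeasurable)
            (Eventually.of_forall fun x => (norm_inner_le_norm _ _).trans ?_)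
          gcongr
          exact hC x
        rw [← integral_add (hi S) (hi T)]
        simp [inner_add_left]
      rw [key G h.integrable]
      simp only [fun j => key (Gn j) (hGni j)]
      exact hS.add hT
  obtain ⟨F', hF', hFF'⟩ := hF
  have hB' : ∀ᵐ x ∂(volume.restrict Ω), ‖F' x‖ ≤ max B 0 := by
    filter_upwards [hB, hFF'] with x h1 h2
    rw [← h2]
    exact h1.trans (le_max_left _ _)
  refine hp.tendsto_integral_inner_of_bounded_approx (Fm := fun m => hF'.approxBounded (max B 0) m)
    (B := max B 0) h.meas h.integrable_rpow h.bound h.integrable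
    (fun m => (SimpleFunc.measurable _).aestronglyMeasurable)
    (fun m => Eventually.of_forall (hF'.norm_approxBounded_le (le_max_right _ _) m)) ?_
    (fun m => hsimple _)
  filter_upwards [hF'.tendsto_approxBounded_ae hB', hFF'] with x h1 h2
  rw [h2]
  exact h1

/-- A duality argument. The bounded field `F_m`, which is `|G|^(p-2) G` cut off where `|G| > m`,
satisfies `F_m · G = t_m^p` and `|F_m| = t_m^(p-1)`. Young's inequality with factor `1/2` bounds `∫
F_m · G_j`, and in the limit half of `∫ t_m^p` is absorbed. The resulting bound does not depend on
`m`, and Fatou's lemma concludes. -/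
theorem TendstoDistrib.integrable_rpow_limit [IsFiniteMeasure (volume.restrict Ω)]
    (hΩ : IsOpen Ω) (hp : IsExponent (volume.restrict Ω) p q P)
    (h : TendstoDistrib Ω p M Gn G) : IntegrableOn (fun x => ‖G x‖ ^ p x) Ω := by
  have hGm := h.integrable.aestronglyMeasurable
  set t : ℕ → EuclideanSpace ℝ (Fin N) → ℝ := fun m x => if ‖G x‖ ≤ m then ‖G x‖ else 0 with ht
  have htm : ∀ m, AEStronglyMeasurable (t m) (volume.restrict Ω) := by
    intro m
    have hmeas : Measurable fun y : ℝ => if y ≤ (m : ℝ) then y else 0 :=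
      Measurable.ite measurableSet_Iic measurable_id measurable_const
    exact (hmeas.comp_aemeasurable hGm.norm.aemeasurable).aestronglyMeasurable
  have ht0 : ∀ m x, 0 ≤ t m x := fun m x => by
    simp only [ht]
    split_ifs <;> positivity
  have htm' : ∀ m x, t m x ≤ m := fun m x => by
    simp only [ht]
    split_ifs with h
    · exact h
    · positivity
  have hti : ∀ m, IntegrableOn (fun x => ‖t m x‖ ^ p x) Ω := fun m =>
    hp.integrable_rpow_of_bound (htm m) (B := m) (Eventually.of_forall fun x => by
      rw [Real.norm_of_nonneg (ht0 m x)]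
      exact htm' m x)
  simp only [Real.norm_of_nonneg (ht0 _ _)] at hti
  set F : ℕ → EuclideanSpace ℝ (Fin N) → EuclideanSpace ℝ (Fin N) :=
    fun m x => t m x ^ (p x - 2) • (if ‖G x‖ ≤ m then G x else 0) with hFdef
  have hFmeas : ∀ m, AEStronglyMeasurable (F m) (volume.restrict Ω) := by
    intro m
    refine ((htm m).aemeasurable.pow (hp.aemeasurable.sub_const 2)).aestronglyMeasurable.smul ?_
    have hmeas : Measurable fun y : EuclideanSpace ℝ (Fin N) => if ‖y‖ ≤ (m : ℝ) then y else 0 :=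
      Measurable.ite (measurableSet_le measurable_norm measurable_const) measurable_id
        measurable_const
    exact (hmeas.comp_aemeasurable hGm.aemeasurable).aestronglyMeasurable
  have hFnorm : ∀ m, ∀ᵐ x ∂(volume.restrict Ω), ‖F m x‖ = t m x ^ (p x - 1) := by
    intro m
    filter_upwards [hp.ae_mem] with x hx
    rw [← rpow_sub_two_mul_self (ht0 m x) (hp.one_lt.trans_le hx.1), hFdef]
    simp only [norm_smul, Real.norm_of_nonneg (Real.rpow_nonneg (ht0 m x) _)]
    congr 1
    simp only [ht]
    split_ifs <;> simp
  have hFG : ∀ m, ∀ᵐ x ∂(volume.restrict Ω), inner ℝ (F m x) (G x) = t m x ^ p x := by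
    intro m
    filter_upwards [hp.ae_mem] with x hx
    have h1 := hp.one_lt.trans_le hx.1
    rw [← rpow_sub_one_mul_self (ht0 m x) h1, ← rpow_sub_two_mul_self (ht0 m x) h1]
    simp only [hFdef, real_inner_smul_left, mul_assoc]
    congr 1
    simp only [ht]
    split_ifs
    · rw [real_inner_self_eq_norm_sq, sq]
    · simp
  have hbound : ∀ m, ∫ x in Ω, t m x ^ p x ≤ 2 * (2 ^ P * M) := by
    intro m
    have hlim := h.tendsto_of_bounded hΩ hp (hFmeas m) (B := max 1 (m : ℝ) ^ P) (by
      filter_upwards [hFnorm m, hp.ae_mem] with x h1 h2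
      rw [h1]
      exact rpow_le_max_rpow (ht0 m x) (htm' m x) (by linarith [hp.one_lt]) (by linarith))
    rw [integral_congr_ae (hFG m)] at hlim
    have hle : ∀ j, ∫ x in Ω, inner ℝ (F m x) (Gn j x)
        ≤ 1 / 2 * (∫ x in Ω, t m x ^ p x) + 2 ^ P * M := by
      intro j
      have h1 : ∫ x in Ω, inner ℝ (F m x) (Gn j x)
          ≤ ∫ x in Ω, (1 / 2 * t m x ^ p x + 2 ^ P * ‖Gn j x‖ ^ p x) := by
        refine integral_mono_ae ?_ (((hti m).const_mul _).add
          ((h.integrable_rpow j).const_mul _)) ?_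
        · refine hp.integrable_inner (hFmeas m) (h.meas j) (hp.integrable_rpow_conj_of_bound
            (hFmeas m) (B := max 1 (m : ℝ) ^ P) ?_) (h.integrable_rpow j)
          filter_upwards [hFnorm m, hp.ae_mem] with x h1 h2
          rw [h1]
          exact rpow_le_max_rpow (ht0 m x) (htm' m x) (by linarith [hp.one_lt]) (by linarith)
        · filter_upwards [hFnorm m, hp.ae_mem] with x h1 h2
          refine (real_inner_le_norm _ _).trans ?_
          rw [h1, mul_comm]
          have := mul_rpow_sub_one_le (norm_nonneg (Gn j x)) (ht0 m x)
            (hp.one_lt.trans_le h2.1) h2.2 (δ := 1 / 2) (by norm_num) (by norm_num)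
          simpa using this
      rw [integral_add ((hti m).const_mul _) ((h.integrable_rpow j).const_mul _),
        integral_const_mul, integral_const_mul] at h1
      have := h.bound j
      have h3 : (2 : ℝ) ^ P * ∫ x in Ω, ‖Gn j x‖ ^ p x ≤ 2 ^ P * M := by gcongr
      linarith
    have := le_of_tendsto' hlim hle
    linarith
  have hmeas := hp.aestronglyMeasurable_rpow hGm
  refine ⟨hmeas, ?_⟩
  rw [hasFiniteIntegral_iff_ofReal (Eventually.of_forall fun x => by positivity)]
  have hlim : ∀ x, Tendsto (fun m => ENNReal.ofReal (t m x ^ p x)) atTop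
      (𝓝 (ENNReal.ofReal (‖G x‖ ^ p x))) := by
    intro x
    refine tendsto_const_nhds.congr' ?_
    filter_upwards [eventually_ge_atTop ⌈‖G x‖⌉₊] with m hm
    simp only [ht]
    rw [if_pos ((Nat.le_ceil _).trans (by exact_mod_cast hm))]
  calc ∫⁻ x in Ω, ENNReal.ofReal (‖G x‖ ^ p x)
      = ∫⁻ x in Ω, liminf (fun m => ENNReal.ofReal (t m x ^ p x)) atTop :=
        lintegral_congr fun x => (hlim x).liminf_eq.symm
    _ ≤ liminf (fun m => ∫⁻ x in Ω, ENNReal.ofReal (t m x ^ p x)) atTop :=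
        lintegral_liminf_le' fun m =>
          ((htm m).aemeasurable.pow hp.aemeasurable).ennreal_ofReal
    _ ≤ ENNReal.ofReal (2 * (2 ^ P * M)) := by
        refine liminf_le_of_le (by isBoundedDefault) fun b hb => ?_
        obtain ⟨m, hm⟩ := hb.exists
        refine hm.trans ?_
        rw [← ofReal_integral_eq_lintegral_ofReal (hti m)
          (Eventually.of_forall fun x => Real.rpow_nonneg (ht0 m x) _)]
        exact ENNReal.ofReal_le_ofReal (hbound m)
    _ < ⊤ := ENNReal.ofReal_lt_top

/-- Cutting `F` off where `|F| > m` reduces to bounded fields. The limit of the right-hand sides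
uses that `G` itself lies in `L^{p(·)}`. -/
theorem TendstoDistrib.tendsto_inner [IsFiniteMeasure (volume.restrict Ω)] (hΩ : IsOpen Ω)
    (hp : IsExponent (volume.restrict Ω) p q P) (h : TendstoDistrib Ω p M Gn G)
    (hF : AEStronglyMeasurable F (volume.restrict Ω))
    (hFi : IntegrableOn (fun x => ‖F x‖ ^ (p x / (p x - 1))) Ω) :
    Tendsto (fun j => ∫ x in Ω, inner ℝ (F x) (Gn j x)) atTop
      (𝓝 (∫ x in Ω, inner ℝ (F x) (G x))) := by
  have hGp := h.integrable_rpow_limit hΩ hp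
  have hGm := h.integrable.aestronglyMeasurable
  set Fm : ℕ → EuclideanSpace ℝ (Fin N) → EuclideanSpace ℝ (Fin N) :=
    fun m x => if ‖F x‖ ≤ m then F x else 0 with hFm
  have hmeas : ∀ m, AEStronglyMeasurable (Fm m) (volume.restrict Ω) := by
    intro m
    have hmeas : Measurable fun y : EuclideanSpace ℝ (Fin N) => if ‖y‖ ≤ (m : ℝ) then y else 0 :=
      Measurable.ite (measurableSet_le measurable_norm measurable_const) measurable_id
        measurable_const
    exact (hmeas.comp_aemeasurable hF.aemeasurable).aestronglyMeasurable
  have hle : ∀ m x, ‖Fm m x‖ ≤ ‖F x‖ := fun m x => by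
    simp only [hFm]
    split_ifs <;> simp
  have hdle : ∀ m x, ‖F x - Fm m x‖ ≤ ‖F x‖ := fun m x => by
    simp only [hFm]
    split_ifs <;> simp
  have hev : ∀ x, ∀ᶠ m in atTop, Fm m x = F x := fun x => by
    filter_upwards [eventually_ge_atTop ⌈‖F x‖⌉₊] with m hm
    simp only [hFm]
    rw [if_pos ((Nat.le_ceil _).trans (by exact_mod_cast hm))]
  have hrle : ∀ m, ∀ᵐ x ∂(volume.restrict Ω), ‖‖F x - Fm m x‖ ^ (p x / (p x - 1))‖
      ≤ ‖F x‖ ^ (p x / (p x - 1)) := fun m => by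
    filter_upwards [hp.ae_mem] with x hx
    rw [Real.norm_of_nonneg (by positivity)]
    exact Real.rpow_le_rpow (norm_nonneg _) (hdle m x) (conj_pos (hp.one_lt.trans_le hx.1)).le
  have hdm := fun m => hp.aestronglyMeasurable_rpow_conj (hF.sub (hmeas m))
  refine hp.tendsto_integral_inner_of_approx h.meas h.integrable_rpow h.bound hF hmeas hFi
    (fun m => Integrable.mono' hFi (hdm m) (hrle m)) ?_
    (fun m => h.tendsto_of_bounded hΩ hp (hmeas m) (B := m)
      (Eventually.of_forall fun x => ?_)) ?_
  · have := tendsto_integral_of_dominated_convergence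
      (F := fun m x => ‖F x - Fm m x‖ ^ (p x / (p x - 1))) (f := fun _ => (0 : ℝ))
      (μ := volume.restrict Ω) _ hdm hFi hrle ?_
    · simpa using this
    · filter_upwards [hp.ae_mem] with x hx
      refine tendsto_const_nhds.congr' ?_
      filter_upwards [hev x] with m hm
      rw [hm, sub_self, norm_zero, Real.zero_rpow (conj_pos (hp.one_lt.trans_le hx.1)).ne']
  · simp only [hFm]
    split_ifs with hx
    · exact hx
    · simp
  · obtain ⟨C, hC, hY⟩ := exists_mul_le_rpow_add hp.one_lt one_pos
    refine tendsto_integral_of_dominated_convergence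
      (fun x => 1 * ‖G x‖ ^ p x + C * ‖F x‖ ^ (p x / (p x - 1)))
      (fun m => (hmeas m).inner hGm) ((hGp.const_mul 1).add (hFi.const_mul C)) (fun m => ?_) ?_
    · filter_upwards [hp.ae_mem] with x hx
      refine (norm_inner_le_norm _ _).trans
        (le_trans ?_ (hY _ _ _ hx.1 (norm_nonneg _) (norm_nonneg _)))
      gcongr
      exact hle m x
    · refine Eventually.of_forall fun x => tendsto_const_nhds.congr' ?_
      filter_upwards [hev x] with m hm
      rw [hm]

end WeakConvergence

/-! ### Modular against Luxemburg norm. -/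

section Luxemburg

variable {N : ℕ} {Ω : Set (EuclideanSpace ℝ (Fin N))} {p : EuclideanSpace ℝ (Fin N) → ℝ}
  {q P : ℝ} {F : Type*} [NormedAddCommGroup F]

theorem modular_eq_ofReal {v : EuclideanSpace ℝ (Fin N) → F}
    (h : IntegrableOn (fun x => ‖v x‖ ^ p x) Ω) :
    modular Ω p v = ENNReal.ofReal (∫ x in Ω, ‖v x‖ ^ p x) :=
  (ofReal_integral_eq_lintegral_ofReal h (Eventually.of_forall fun x => by positivity)).symm

theorem IsExponent.memLpVar_iff (hp : IsExponent (volume.restrict Ω) p q P)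
    {v : EuclideanSpace ℝ (Fin N) → F} : MemLpVar Ω p v ↔
      AEStronglyMeasurable v (volume.restrict Ω) ∧ IntegrableOn (fun x => ‖v x‖ ^ p x) Ω := by
  refine and_congr_right fun hv => ?_
  rw [IntegrableOn, Integrable, and_iff_right (hp.aestronglyMeasurable_rpow hv),
    hasFiniteIntegral_iff_ofReal (Eventually.of_forall fun x => by positivity), modular]

variable [NormedSpace ℝ F]

theorem modular_le_of_luxNorm_lt (hp : IsExponent (volume.restrict Ω) p q P)
    {v : EuclideanSpace ℝ (Fin N) → F} {C : ℝ} (hC : 1 ≤ C)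
    (h : luxNorm Ω p v < ENNReal.ofReal C) : modular Ω p v ≤ ENNReal.ofReal (C ^ P) := by
  obtain ⟨_, ⟨t, ⟨ht, hm⟩, rfl⟩, htC⟩ := sInf_lt_iff.1 h
  have htC' : t < C := (ENNReal.ofReal_lt_ofReal_iff (by linarith)).1 htC
  calc modular Ω p v
      ≤ ∫⁻ x in Ω, ENNReal.ofReal (C ^ P) * ENNReal.ofReal (‖t⁻¹ • v x‖ ^ p x) := by
        refine lintegral_mono_ae ?_
        filter_upwards [hp.ae_mem] with x hx
        have hp0 : 0 ≤ p x := by linarith [hp.one_lt]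
        rw [← ENNReal.ofReal_mul (by positivity)]
        refine ENNReal.ofReal_le_ofReal ?_
        have h1 : ‖v x‖ ≤ C * ‖t⁻¹ • v x‖ := by
          rw [norm_smul, Real.norm_of_nonneg (by positivity), ← mul_assoc, ← div_eq_mul_inv]
          exact le_mul_of_one_le_left (norm_nonneg _) ((one_le_div ht).2 htC'.le)
        calc ‖v x‖ ^ p x ≤ (C * ‖t⁻¹ • v x‖) ^ p x := Real.rpow_le_rpow (norm_nonneg _) h1 hp0
          _ = C ^ p x * ‖t⁻¹ • v x‖ ^ p x := Real.mul_rpow (by linarith) (norm_nonneg _)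
          _ ≤ C ^ P * ‖t⁻¹ • v x‖ ^ p x := by
            gcongr
            exact hx.2
    _ = ENNReal.ofReal (C ^ P) * modular Ω p (fun x => t⁻¹ • v x) :=
        lintegral_const_mul' _ _ ENNReal.ofReal_ne_top
    _ ≤ ENNReal.ofReal (C ^ P) * 1 := by gcongr
    _ = ENNReal.ofReal (C ^ P) := mul_one _

/-- Dividing a function by `e ≤ 1` multiplies its modular by at most `e^(-P)`, so a small enough
modular forces the norm below `e`. -/
theorem tendsto_luxNorm_zero (hp : IsExponent (volume.restrict Ω) p q P)
    {v : ℕ → EuclideanSpace ℝ (Fin N) → F}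
    (h : Tendsto (fun j => modular Ω p (v j)) atTop (𝓝 0)) :
    Tendsto (fun j => luxNorm Ω p (v j)) atTop (𝓝 0) := by
  rw [ENNReal.tendsto_nhds_zero]
  intro ε hε
  set e : ℝ := (min ε 1).toReal with he
  have hne : min ε 1 ≠ ⊤ := ((min_le_right _ _).trans_lt ENNReal.one_lt_top).ne
  have he0 : 0 < e := ENNReal.toReal_pos (lt_min hε one_pos).ne' hne
  have he1 : e ≤ 1 := by
    simpa using ENNReal.toReal_mono ENNReal.one_ne_top (min_le_right ε 1)
  have hl : Tendsto (fun j => ENNReal.ofReal (e⁻¹ ^ P) * modular Ω p (v j)) atTop (𝓝 0) := by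
    simpa using ENNReal.Tendsto.const_mul h (Or.inr ENNReal.ofReal_ne_top)
  filter_upwards [hl.eventually_le_const one_pos] with j hj
  have hmod : modular Ω p (fun x => e⁻¹ • v j x) ≤ 1 := by
    refine le_trans ?_ hj
    rw [modular, modular, ← lintegral_const_mul' _ _ ENNReal.ofReal_ne_top]
    refine lintegral_mono_ae ?_
    filter_upwards [hp.ae_mem] with x hx
    rw [← ENNReal.ofReal_mul (by positivity)]
    refine ENNReal.ofReal_le_ofReal ?_
    rw [norm_smul, Real.norm_of_nonneg (by positivity),
      Real.mul_rpow (by positivity) (norm_nonneg _)]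
    gcongr
    · exact (one_le_inv₀ he0).2 he1
    · exact hx.2
  have hle : luxNorm Ω p (v j) ≤ ENNReal.ofReal e := sInf_le ⟨e, ⟨he0, hmod⟩, rfl⟩
  refine hle.trans ?_
  rw [he, ENNReal.ofReal_toReal hne]
  exact min_le_left _ _

theorem HasW011Grad.memW0 {u : EuclideanSpace ℝ (Fin N) → ℝ}
    {G : EuclideanSpace ℝ (Fin N) → EuclideanSpace ℝ (Fin N)}
    (hΩ : IsOpen Ω) (hp : IsExponent (volume.restrict Ω) p q P)
    (h : HasW011Grad Ω u G) (hu : IntegrableOn (fun x => ‖u x‖ ^ p x) Ω)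
    (hG : IntegrableOn (fun x => ‖G x‖ ^ p x) Ω) : MemW0 Ω p u := by
  refine ⟨⟨⟨G, h.hasWeakGrad⟩, hp.memLpVar_iff.2 ⟨h.integrable.aestronglyMeasurable, hu⟩,
    hp.memLpVar_iff.2 ⟨?_, ?_⟩⟩, h.memW011 hΩ⟩
  · exact h.integrable_grad.aestronglyMeasurable.congr (h.weakGrad_ae hΩ).symm
  · refine Integrable.congr hG ?_
    filter_upwards [h.weakGrad_ae hΩ] with x hx
    rw [hx]

theorem MemW0.hasW011Grad {u : EuclideanSpace ℝ (Fin N) → ℝ} (h : MemW0 Ω p u) :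
    HasW011Grad Ω u (weakGrad Ω u) :=
  h.2.hasW011Grad

theorem MemW0.integrable_rpow_weakGrad {u : EuclideanSpace ℝ (Fin N) → ℝ}
    (hp : IsExponent (volume.restrict Ω) p q P) (h : MemW0 Ω p u) :
    IntegrableOn (fun x => ‖weakGrad Ω u x‖ ^ p x) Ω :=
  (hp.memLpVar_iff.1 h.1.2.2).2

theorem integral_le_of_sobNorm_le (hp : IsExponent (volume.restrict Ω) p q P)
    {u : EuclideanSpace ℝ (Fin N) → ℝ} {C : ℝ≥0} (hu : MemW0 Ω p u)
    (h : sobNorm Ω p u ≤ C) : ∫ x in Ω, ‖weakGrad Ω u x‖ ^ p x ≤ ((C : ℝ) + 1) ^ P := by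
  have h1 : luxNorm Ω p (weakGrad Ω u) < ENNReal.ofReal ((C : ℝ) + 1) := by
    refine (le_add_self.trans h).trans_lt ?_
    rw [← ENNReal.ofReal_coe_nnreal]
    have := C.2
    exact (ENNReal.ofReal_lt_ofReal_iff (by linarith)).2 (by linarith)
  have h2 := modular_le_of_luxNorm_lt hp (by linarith [C.2]) h1
  rw [modular_eq_ofReal (hu.integrable_rpow_weakGrad hp)] at h2
  have := C.2
  exact (ENNReal.ofReal_le_ofReal_iff (by positivity)).1 h2

end Luxemburg

/-! ### Pointwise bounds for the three terms of the tested equation. -/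

section Truncation

theorem trunc_of_nonneg {k s : ℝ} (hk : 0 ≤ k) (hs : 0 ≤ s) : trunc k s = min s k :=
  max_eq_right (by linarith [le_min hs hk])

theorem abs_trunc_le {k : ℝ} (hk : 0 ≤ k) (s : ℝ) : |trunc k s| ≤ k :=
  abs_le.2 ⟨le_max_left _ _, max_le (by linarith) (min_le_right _ _)⟩

theorem trunc_of_abs_le {k s : ℝ} (hs : |s| ≤ k) : trunc k s = s := by
  rw [abs_le] at hs
  rw [trunc, min_eq_left hs.2, max_eq_right hs.1]

theorem continuous_trunc (k : ℝ) : Continuous (trunc k) :=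
  continuous_const.max (continuous_id.min continuous_const)

theorem trunc_nonneg {k s : ℝ} (hk : 0 ≤ k) (hs : 0 ≤ s) : 0 ≤ trunc k s := by
  rw [trunc_of_nonneg hk hs]
  exact le_min hs hk

/-- The argument of the test function used to prove the strong convergence of truncations. -/
def truncArg (k h s t : ℝ) : ℝ := s - trunc h s + trunc k s - trunc k t

theorem truncArg_of_le {k h s t : ℝ} (hh : 0 ≤ h) (hs : 0 ≤ s) (hsh : s ≤ h) :
    truncArg k h s t = trunc k s - trunc k t := by
  rw [truncArg, trunc_of_nonneg hh hs, min_eq_left hsh]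
  ring

theorem abs_trunc_sub_trunc_le {k s t : ℝ} (hk : 0 ≤ k) (hs : 0 ≤ s) (ht : 0 ≤ t) :
    |trunc k s - trunc k t| ≤ k := by
  rw [trunc_of_nonneg hk hs, trunc_of_nonneg hk ht, abs_le]
  have := le_min hs hk
  have := le_min ht hk
  have := min_le_right s k
  have := min_le_right t k
  constructor <;> linarith

theorem trunc_truncArg_of_le {k h s t : ℝ} (hk : 0 ≤ k) (hh : 0 ≤ h) (hs : 0 ≤ s) (ht : 0 ≤ t)
    (hsh : s ≤ h) : trunc (2 * k) (truncArg k h s t) = trunc k s - trunc k t := by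
  rw [truncArg_of_le hh hs hsh]
  exact trunc_of_abs_le ((abs_trunc_sub_trunc_le hk hs ht).trans (by linarith))

/-- Only a positive test function matters. For `s ≤ h` it equals `d = T_k(s) - T_k(t) ≤ s`, so the
denominator is at least `d^γ` and the singularity costs only the power `γ < 1` of `d` in the
applications. For `s > h ≥ 1` the denominator is at least 1 and `min 1 (s/h) = 1`. -/
theorem singular_term_le {k h s t g f γ : ℝ} {n : ℕ} (hk : 0 < k) (hh : 1 ≤ h) (hs : 0 ≤ s)
    (ht : 0 ≤ t) (hg : 0 ≤ g) (hgf : g ≤ f) (hγ : 0 < γ) (hn : 1 ≤ n) :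
    g / (|s| + 1 / (n : ℝ)) ^ γ * trunc (2 * k) (truncArg k h s t)
      ≤ f * |trunc k s - trunc k t| ^ (1 - γ) + 2 * k * (f * min 1 (s / h)) := by
  have hn0 : (0 : ℝ) < 1 / (n : ℝ) := by
    have : (0 : ℝ) < n := by exact_mod_cast hn
    positivity
  have hf : 0 ≤ f := hg.trans hgf
  rw [abs_of_nonneg hs]
  have hR1 : 0 ≤ f * |trunc k s - trunc k t| ^ (1 - γ) := by positivity
  have hR2 : 0 ≤ 2 * k * (f * min 1 (s / h)) := by
    have : 0 ≤ min 1 (s / h) := le_min zero_le_one (by positivity)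
    positivity
  have hden : 0 < (s + 1 / (n : ℝ)) ^ γ := by positivity
  rcases le_or_gt (trunc (2 * k) (truncArg k h s t)) 0 with hφ | hφ
  · exact (mul_nonpos_of_nonneg_of_nonpos (by positivity) hφ).trans (by positivity)
  rcases le_or_gt s h with hsh | hsh
  · rw [trunc_truncArg_of_le hk.le (by linarith) hs ht hsh] at hφ ⊢
    set d := trunc k s - trunc k t with hd
    have hds : d ≤ s := by
      have h1 : trunc k s ≤ s := by
        rw [trunc_of_nonneg hk.le hs]
        exact min_le_left _ _
      have := trunc_nonneg hk.le ht
      linarith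
    rw [abs_of_pos hφ] at hR1 ⊢
    have h1 : d ^ γ ≤ (s + 1 / (n : ℝ)) ^ γ := Real.rpow_le_rpow hφ.le (by linarith) hγ.le
    have h2 : g / (s + 1 / (n : ℝ)) ^ γ * d ≤ f * d ^ (1 - γ) := by
      rw [Real.rpow_sub hφ, Real.rpow_one, div_mul_eq_mul_div, ← mul_div_assoc]
      gcongr
    linarith
  · have h1 : 1 ≤ (s + 1 / (n : ℝ)) ^ γ := Real.one_le_rpow (by linarith) hγ.le
    have h2 : trunc (2 * k) (truncArg k h s t) ≤ 2 * k :=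
      (le_abs_self _).trans (abs_trunc_le (by linarith) _)
    have h3 : min 1 (s / h) = 1 := min_eq_left ((one_le_div (by linarith)).2 hsh.le)
    rw [h3, mul_one] at hR2 ⊢
    have h4 : g / (s + 1 / (n : ℝ)) ^ γ ≤ f := (div_le_self hg h1).trans hgf
    have h5 : g / (s + 1 / (n : ℝ)) ^ γ * trunc (2 * k) (truncArg k h s t) ≤ f * (2 * k) := by
      gcongr
    linarith

theorem abs_rpow_sub_one_mul_self {r : ℝ} (hr : 0 < r) (s : ℝ) : |(|s| ^ (r - 1) * s)| = |s| ^ r := by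
  rcases eq_or_ne s 0 with rfl | hs
  · simp [Real.zero_rpow hr.ne']
  · rw [abs_mul, abs_of_nonneg (by positivity), ← Real.rpow_add_one (abs_ne_zero.2 hs),
      sub_add_cancel]

/-- For `s ≥ k` the test function is nonnegative, since `T_k(s) = k ≥ T_k(t)`, and the term can be
dropped. For `s ≤ k` the power of `s` is bounded. -/
theorem absorption_term_le {k h s t b r ν R : ℝ} (hk : 0 < k) (hkh : k ≤ h) (hs : 0 ≤ s)
    (ht : 0 ≤ t) (hb : 0 ≤ b) (hbν : b ≤ ν) (hr : 0 < r) (hR : r ≤ R) :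
    -(b * (|s| ^ (r - 1) * s) * trunc (2 * k) (truncArg k h s t))
      ≤ ν * max 1 k ^ R * |trunc k s - trunc k t| := by
  have hν : 0 ≤ ν := hb.trans hbν
  have h0 : 0 ≤ |s| ^ (r - 1) * s := by positivity
  rcases le_total s k with hsk | hsk
  · rw [trunc_truncArg_of_le hk.le (by linarith) hs ht (by linarith)]
    have h1 : |s| ^ (r - 1) * s ≤ max 1 k ^ R := by
      rw [← abs_of_nonneg h0, abs_rpow_sub_one_mul_self hr, abs_of_nonneg hs]
      exact rpow_le_max_rpow hs hsk hr.le hR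
    calc -(b * (|s| ^ (r - 1) * s) * (trunc k s - trunc k t))
        = b * (|s| ^ (r - 1) * s) * (-(trunc k s - trunc k t)) := by ring
      _ ≤ b * (|s| ^ (r - 1) * s) * |trunc k s - trunc k t| := by
        gcongr
        exact neg_le_abs _
      _ ≤ ν * max 1 k ^ R * |trunc k s - trunc k t| := by gcongr
  · have h1 : 0 ≤ trunc (2 * k) (truncArg k h s t) := by
      refine trunc_nonneg (by linarith) ?_
      rw [truncArg, trunc_of_nonneg (by linarith) hs, trunc_of_nonneg hk.le hs,
        trunc_of_nonneg hk.le ht, min_eq_right hsk]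
      linarith [min_le_left s h, min_le_right t k]
    have h2 : 0 ≤ b * (|s| ^ (r - 1) * s) * trunc (2 * k) (truncArg k h s t) := by positivity
    have h3 : 0 ≤ ν * max 1 k ^ R * |trunc k s - trunc k t| := by positivity
    linarith

variable {E : Type*} [NormedAddCommGroup E] [InnerProductSpace ℝ E]

/-- For `s < k` the two fluxes coincide. For `s ≥ k` the left side is 0, the gradient of `s -
T_h(s)` contributes with a good sign, and only the product of `U` with `W` has to be paid for. -/
theorem diffusion_term_ge {k h s t a β p : ℝ} {U W : E} (hk : 0 < k) (hkh : k ≤ h) (hs : 0 ≤ s)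
    (ht : 0 ≤ t) (ha : 0 ≤ a) (haβ : a ≤ β) (hp : 1 < p) :
    a * (‖if |s| < k then U else 0‖ ^ (p - 2) *
        inner ℝ (if |s| < k then U else 0) ((if |s| < k then U else 0) - W))
      ≤ a * (‖U‖ ^ (p - 2) * inner ℝ U (if |truncArg k h s t| < 2 * k then
            U - (if |s| < h then U else 0) + (if |s| < k then U else 0) - W else 0))
        + β * ((if k ≤ s then ‖W‖ else 0) *
            ‖if |s| < h + 2 * k then U else 0‖ ^ (p - 1)) := by
  rw [abs_of_nonneg hs]
  rcases lt_or_ge s k with hsk | hsk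
  · have h1 : |truncArg k h s t| < 2 * k := by
      rw [truncArg_of_le (by linarith) hs (by linarith)]
      exact (abs_trunc_sub_trunc_le hk.le hs ht).trans_lt (by linarith)
    rw [if_pos hsk, if_pos h1, if_pos (by linarith), if_neg (by linarith)]
    simp
  · rw [if_neg (by linarith), if_pos hsk]
    have hβ : 0 ≤ β := ha.trans haβ
    simp only [inner_zero_left, mul_zero, add_zero]
    by_cases h1 : |truncArg k h s t| < 2 * k
    · have h2 : s < h + 2 * k := by
        by_contra hcon
        have h3 := (abs_lt.1 h1).2
        rw [truncArg, trunc_of_nonneg (by linarith) hs, trunc_of_nonneg hk.le hs,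
          trunc_of_nonneg hk.le ht, min_eq_right hsk, min_eq_right (by linarith)] at h3
        linarith [min_le_right t k]
      rw [if_pos h1, if_pos h2]
      have h4 : 0 ≤ inner ℝ U (U - if s < h then U else 0) := by
        split_ifs
        · simp
        · rw [sub_zero]
          exact real_inner_self_nonneg
      have h5 : -(‖U‖ * ‖W‖) ≤ inner ℝ U (U - (if s < h then U else 0) - W) := by
        rw [inner_sub_right]
        linarith [real_inner_le_norm U W]
      have h6 : a * (‖U‖ ^ (p - 2) * -(‖U‖ * ‖W‖))
          ≤ a * (‖U‖ ^ (p - 2) * inner ℝ U (U - (if s < h then U else 0) - W)) := by gcongr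
      have h7 : a * (‖U‖ ^ (p - 2) * -(‖U‖ * ‖W‖)) = -(a * (‖W‖ * ‖U‖ ^ (p - 1))) := by
        rw [← rpow_sub_two_mul_self (norm_nonneg U) hp]
        ring
      have h8 : a * (‖W‖ * ‖U‖ ^ (p - 1)) ≤ β * (‖W‖ * ‖U‖ ^ (p - 1)) := by gcongr
      linarith
    · rw [if_neg h1, inner_zero_right]
      have : 0 ≤ β * (‖W‖ * ‖if s < h + 2 * k then U else 0‖ ^ (p - 1)) := by positivity
      linarith

end Truncation

/-! ### Sign of the solutions and the tested equation. -/

section Estimates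

variable {N : ℕ}

/-- The structural hypotheses on the domain, the exponents, the coefficients and the datum. -/
structure ProblemData (Ω : Set (EuclideanSpace ℝ (Fin N)))
    (p r γ a b f : EuclideanSpace ℝ (Fin N) → ℝ) (q P R α β ν : ℝ) : Prop where
  isOpen : IsOpen Ω
  isFiniteMeasure : IsFiniteMeasure (volume.restrict Ω)
  exponent : IsExponent (volume.restrict Ω) p q P
  r_meas : AEMeasurable r (volume.restrict Ω)
  r_mem : ∀ᵐ x ∂(volume.restrict Ω), 0 < r x ∧ r x ≤ R
  γ_meas : AEMeasurable γ (volume.restrict Ω)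
  γ_mem : ∀ᵐ x ∂(volume.restrict Ω), 0 < γ x ∧ γ x < 1
  a_meas : AEMeasurable a (volume.restrict Ω)
  α_pos : 0 < α
  a_mem : ∀ᵐ x ∂(volume.restrict Ω), α ≤ a x ∧ a x ≤ β
  b_meas : AEMeasurable b (volume.restrict Ω)
  b_mem : ∀ᵐ x ∂(volume.restrict Ω), 0 < b x ∧ b x ≤ ν
  f_int : IntegrableOn f Ω
  f_nonneg : ∀ᵐ x ∂(volume.restrict Ω), 0 ≤ f x

/-- The weak gradient `χ_{|u| < k} G` of `T_k(u)`, where `G` is the weak gradient of `u`. -/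
noncomputable def truncGrad (k : ℝ) (u : EuclideanSpace ℝ (Fin N) → ℝ)
    (G : EuclideanSpace ℝ (Fin N) → EuclideanSpace ℝ (Fin N)) :
    EuclideanSpace ℝ (Fin N) → EuclideanSpace ℝ (Fin N) :=
  fun x => if |u x| < k then G x else 0

variable {Ω : Set (EuclideanSpace ℝ (Fin N))}
  {p r γ a b f g u w : EuclideanSpace ℝ (Fin N) → ℝ} {q P R α β ν : ℝ}
  {ξ ζ G W : EuclideanSpace ℝ (Fin N) → EuclideanSpace ℝ (Fin N)}

theorem HasW011Grad.hasW011Grad_trunc (hΩ : IsOpen Ω) (h : HasW011Grad Ω u G) {k : ℝ}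
    (hk : 0 < k) : HasW011Grad Ω (fun x => VarSobolev.trunc k (u x)) (truncGrad k u G) :=
  h.trunc hΩ hk

theorem norm_truncGrad_le (k : ℝ) (x : EuclideanSpace ℝ (Fin N)) :
    ‖truncGrad k u G x‖ ≤ ‖G x‖ := by
  unfold truncGrad
  split_ifs <;> simp

theorem IsExponent.integrable_mul_rpow {μ : Measure (EuclideanSpace ℝ (Fin N))}
    (hp : IsExponent μ p q P) {s t : EuclideanSpace ℝ (Fin N) → ℝ}
    (hs : AEStronglyMeasurable s μ) (ht : AEStronglyMeasurable t μ) (hs0 : ∀ x, 0 ≤ s x)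
    (ht0 : ∀ x, 0 ≤ t x) (hsi : Integrable (fun x => s x ^ p x) μ)
    (hti : Integrable (fun x => t x ^ p x) μ) :
    Integrable (fun x => s x * t x ^ (p x - 1)) μ := by
  refine Integrable.mono' ((hti.const_mul 1).add (hsi.const_mul (1⁻¹ ^ P)))
    (hs.mul (ht.aemeasurable.pow (hp.aemeasurable.sub_const 1)).aestronglyMeasurable) ?_
  filter_upwards [hp.ae_mem] with x hx
  have h0 : 0 ≤ s x * t x ^ (p x - 1) := mul_nonneg (hs0 x) (Real.rpow_nonneg (ht0 x) _)
  rw [Real.norm_of_nonneg h0]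
  exact mul_rpow_sub_one_le (hs0 x) (ht0 x) (hp.one_lt.trans_le hx.1) hx.2 one_pos le_rfl

theorem ProblemData.integrable_flux (D : ProblemData Ω p r γ a b f q P R α β ν)
    (hξ : AEStronglyMeasurable ξ (volume.restrict Ω))
    (hζ : AEStronglyMeasurable ζ (volume.restrict Ω))
    (hξi : IntegrableOn (fun x => ‖ξ x‖ ^ p x) Ω) (hζi : IntegrableOn (fun x => ‖ζ x‖ ^ p x) Ω) :
    IntegrableOn (fun x => a x * (‖ξ x‖ ^ (p x - 2) * inner ℝ (ξ x) (ζ x))) Ω := by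
  have hm : AEMeasurable (fun x => ‖ξ x‖ ^ (p x - 2)) (volume.restrict Ω) :=
    hξ.norm.aemeasurable.pow (D.exponent.aemeasurable.sub_const 2)
  refine Integrable.mono' ((D.exponent.integrable_mul_rpow hζ.norm hξ.norm
    (fun x => norm_nonneg _) (fun x => norm_nonneg _) hζi hξi).const_mul β)
    (D.a_meas.aestronglyMeasurable.mul (hm.aestronglyMeasurable.mul (hξ.inner hζ))) ?_
  filter_upwards [D.a_mem, D.exponent.ae_mem] with x ha hp
  have ha0 : 0 ≤ a x := D.α_pos.le.trans ha.1
  rw [norm_mul, norm_mul, Real.norm_of_nonneg ha0, Real.norm_of_nonneg (by positivity),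
    ← rpow_sub_two_mul_self (norm_nonneg (ξ x)) (D.exponent.one_lt.trans_le hp.1)]
  calc a x * (‖ξ x‖ ^ (p x - 2) * ‖inner ℝ (ξ x) (ζ x)‖)
      ≤ β * (‖ξ x‖ ^ (p x - 2) * (‖ξ x‖ * ‖ζ x‖)) := by
        have := norm_inner_le_norm (𝕜 := ℝ) (ξ x) (ζ x)
        have hβ : 0 ≤ β := ha0.trans ha.2
        gcongr
        exact ha.2
    _ = β * (‖ζ x‖ * (‖ξ x‖ ^ (p x - 2) * ‖ξ x‖)) := by ring

theorem ProblemData.integrable_absorption (D : ProblemData Ω p r γ a b f q P R α β ν)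
    {φ : EuclideanSpace ℝ (Fin N) → ℝ} (hu : AEStronglyMeasurable u (volume.restrict Ω))
    (hφ : AEStronglyMeasurable φ (volume.restrict Ω)) (hub : EssBdd Ω u) (hφb : EssBdd Ω φ) :
    IntegrableOn (fun x => b x * (|u x| ^ (r x - 1) * u x) * φ x) Ω := by
  have := D.isFiniteMeasure
  obtain ⟨C, hC⟩ := hub
  obtain ⟨C', hC'⟩ := hφb
  refine Integrable.of_bound ((D.b_meas.mul (((hu.norm.aemeasurable).pow
    (D.r_meas.sub_const 1)).mul hu.aemeasurable)).mul hφ.aemeasurable).aestronglyMeasurable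
    (ν * max 1 C ^ R * C') ?_
  filter_upwards [hC, hC', D.b_mem, D.r_mem] with x h1 h2 hb hr
  have hν : 0 ≤ ν := hb.1.le.trans hb.2
  rw [norm_mul, norm_mul, Real.norm_of_nonneg hb.1.le, Real.norm_eq_abs, Real.norm_eq_abs,
    abs_rpow_sub_one_mul_self hr.1]
  have h3 := rpow_le_max_rpow (abs_nonneg _) h1 hr.1.le hr.2
  have h4 := hb.2
  have h5 : 0 ≤ b x := hb.1.le
  gcongr

/-- With the test function `min(u, 0)` the diffusion and absorption terms are nonnegative and the
right-hand side is nonpositive. The absorption integrand thus vanishes a.e., which excludes `u < 0`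
because `b > 0`. -/
theorem ProblemData.nonneg (D : ProblemData Ω p r γ a b f q P R α β ν) {n : ℕ}
    (hg : ∀ᵐ x ∂(volume.restrict Ω), 0 ≤ g x) (hu : IsApproxSol Ω p r γ a b g n u) :
    ∀ᵐ x ∂(volume.restrict Ω), 0 ≤ u x := by
  have := D.isFiniteMeasure
  obtain ⟨huW, hub, hsol⟩ := hu
  have hG := huW.hasW011Grad
  have hGi := huW.integrable_rpow_weakGrad D.exponent
  have hmin := hG.min_zero D.isOpen
  obtain ⟨C, hC⟩ := hub
  have hmb : ∀ᵐ x ∂(volume.restrict Ω), ‖min (u x) 0‖ ≤ C := by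
    filter_upwards [hC] with x hx
    refine le_trans ?_ hx
    rcases le_total (u x) 0 with h | h <;> simp [h]
  have hmW : MemW0 Ω p (fun x => min (u x) 0) := by
    refine hmin.memW0 D.isOpen D.exponent
      (D.exponent.integrable_rpow_of_bound hmin.integrable.aestronglyMeasurable hmb)
      (D.exponent.integrable_rpow_mono hmin.integrable_grad.aestronglyMeasurable hGi
        (Eventually.of_forall fun x => ?_))
    split_ifs <;> simp
  have heq := hsol _ hmW ⟨C, hmb⟩
  have h1 : 0 ≤ ∫ x in Ω, a x * (‖weakGrad Ω u x‖ ^ (p x - 2) *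
      inner ℝ (weakGrad Ω u x) (weakGrad Ω (fun x => min (u x) 0) x)) := by
    refine integral_nonneg_of_ae ?_
    filter_upwards [hmin.weakGrad_ae D.isOpen, D.a_mem] with x hx ha
    have ha0 : 0 ≤ a x := D.α_pos.le.trans ha.1
    have : (0 : ℝ) ≤ inner ℝ (weakGrad Ω u x) (weakGrad Ω (fun x => min (u x) 0) x) := by
      rw [hx]
      split_ifs
      · exact real_inner_self_nonneg
      · simp
    simp only [Pi.zero_apply]
    positivity
  have h2 : ∫ x in Ω, g x / (|u x| + 1 / (n : ℝ)) ^ γ x * min (u x) 0 ≤ 0 := by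
    refine integral_nonpos_of_ae ?_
    filter_upwards [hg] with x hx
    exact mul_nonpos_of_nonneg_of_nonpos (by positivity) (min_le_right _ _)
  have hnn : 0 ≤ᵐ[volume.restrict Ω]
      fun x => b x * (|u x| ^ (r x - 1) * u x) * min (u x) 0 := by
    filter_upwards [D.b_mem] with x hb
    have hb0 := hb.1.le
    rcases le_total (u x) 0 with h | h
    · rw [min_eq_left h, mul_assoc, mul_assoc]
      have : 0 ≤ u x * u x := mul_self_nonneg _
      simp only [Pi.zero_apply]
      positivity
    · simp [min_eq_right h]
  have hzero := (integral_eq_zero_iff_of_nonneg_ae hnn (D.integrable_absorption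
    hG.integrable.aestronglyMeasurable hmin.integrable.aestronglyMeasurable ⟨C, hC⟩
    ⟨C, hmb⟩)).1 (le_antisymm (by linarith) (integral_nonneg_of_ae hnn))
  filter_upwards [hzero, D.b_mem] with x hx hb
  by_contra hneg
  rw [not_le] at hneg
  simp only [Pi.zero_apply, min_eq_left hneg.le] at hx
  have h3 : 0 < |u x| ^ (r x - 1) := Real.rpow_pos_of_pos (abs_pos.2 hneg.ne) _
  have h4 := hb.1.ne'
  simp [h3.ne', h4, hneg.ne] at hx

theorem ProblemData.main_estimate (D : ProblemData Ω p r γ a b f q P R α β ν) {n : ℕ}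
    (hn : 1 ≤ n) (hgm : AEMeasurable g (volume.restrict Ω))
    (hg : ∀ᵐ x ∂(volume.restrict Ω), 0 ≤ g x ∧ g x ≤ f x)
    (hu : IsApproxSol Ω p r γ a b g n u) (hu0 : ∀ᵐ x ∂(volume.restrict Ω), 0 ≤ u x)
    (hw : HasW011Grad Ω w W) (hw0 : ∀ᵐ x ∂(volume.restrict Ω), 0 ≤ w x) {k h : ℝ} (hk : 0 < k)
    (hkh : k ≤ h) (hh : 1 ≤ h) (hWk : IntegrableOn (fun x => ‖truncGrad k w W x‖ ^ p x) Ω) :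
    ∫ x in Ω, a x * (‖truncGrad k u (weakGrad Ω u) x‖ ^ (p x - 2) *
        inner ℝ (truncGrad k u (weakGrad Ω u) x)
          (truncGrad k u (weakGrad Ω u) x - truncGrad k w W x))
      ≤ (∫ x in Ω, f x * |trunc k (u x) - trunc k (w x)| ^ (1 - γ x))
        + 2 * k * (∫ x in Ω, f x * min 1 (u x / h))
        + ν * max 1 k ^ R * (∫ x in Ω, |trunc k (u x) - trunc k (w x)|)
        + β * ∫ x in Ω, (if k ≤ u x then ‖truncGrad k w W x‖ else 0) *
            ‖truncGrad (h + 2 * k) u (weakGrad Ω u) x‖ ^ (p x - 1) := by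
  have := D.isFiniteMeasure
  obtain ⟨huW, hub, hsol⟩ := hu
  have hp := D.exponent
  have hG := huW.hasW011Grad
  have hGi := huW.integrable_rpow_weakGrad hp
  have hum := hG.integrable.aestronglyMeasurable
  have hGm := hG.integrable_grad.aestronglyMeasurable
  have hTk := hG.hasW011Grad_trunc D.isOpen hk
  have hTh := hG.hasW011Grad_trunc D.isOpen (show 0 < h by linarith)
  have hTM := hG.hasW011Grad_trunc D.isOpen (show 0 < h + 2 * k by linarith)
  have hTw := hw.hasW011Grad_trunc D.isOpen hk
  have hTi : ∀ c, AEStronglyMeasurable (truncGrad c u (weakGrad Ω u)) (volume.restrict Ω) →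
      IntegrableOn (fun x => ‖truncGrad c u (weakGrad Ω u) x‖ ^ p x) Ω := fun c hc =>
    hp.integrable_rpow_mono hc hGi (Eventually.of_forall fun x => norm_truncGrad_le c x)
  have hTkm := hTk.integrable_grad.aestronglyMeasurable
  have hThm := hTh.integrable_grad.aestronglyMeasurable
  have hTMm := hTM.integrable_grad.aestronglyMeasurable
  have hTwm := hTw.integrable_grad.aestronglyMeasurable
  have harg := ((hG.sub hTh).add hTk).sub hTw
  have hφ := harg.hasW011Grad_trunc D.isOpen (show 0 < 2 * k by linarith)
  have hφb : ∀ᵐ x ∂(volume.restrict Ω),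
      ‖trunc (2 * k) (truncArg k h (u x) (w x))‖ ≤ 2 * k :=
    Eventually.of_forall fun x => abs_trunc_le (by linarith) _
  have hφm : AEStronglyMeasurable (fun x => trunc (2 * k) (truncArg k h (u x) (w x)))
    (volume.restrict Ω) := hφ.integrable.aestronglyMeasurable
  -- Admissible although `w` itself need not lie in `W^{1,p(·)}`: only the truncation of `w` at `k`
  -- enters, and its gradient is in `L^{p(·)}` by `hWk`.
  have hφW : MemW0 Ω p (fun x => trunc (2 * k) (truncArg k h (u x) (w x))) := by
    refine hφ.memW0 D.isOpen hp (hp.integrable_rpow_of_bound hφm hφb) ?_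
    refine hp.integrable_rpow_mono hφ.integrable_grad.aestronglyMeasurable
      (hp.integrable_rpow_sub ((hGm.sub hThm).add hTkm) hTwm
        (hp.integrable_rpow_add (hGm.sub hThm) hTkm
          (hp.integrable_rpow_sub hGm hThm hGi (hTi _ hThm)) (hTi _ hTkm)) hWk)
      (Eventually.of_forall fun x => norm_truncGrad_le _ x)
  have heq := hsol _ hφW ⟨2 * k, hφb⟩
  have hφgrad := hφ.weakGrad_ae D.isOpen
  have i0 := D.integrable_flux hTkm (hTkm.sub hTwm) (hTi _ hTkm)
    (hp.integrable_rpow_sub hTkm hTwm (hTi _ hTkm) hWk)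
  have i1 := D.integrable_flux hGm hφW.hasW011Grad.integrable_grad.aestronglyMeasurable hGi
    (hφW.integrable_rpow_weakGrad hp)
  have i2 := D.integrable_absorption hum hφm hub ⟨2 * k, hφb⟩
  have hn0 : (0 : ℝ) < n := by exact_mod_cast hn
  have i3 : IntegrableOn (fun x => g x / (|u x| + 1 / (n : ℝ)) ^ γ x *
      trunc (2 * k) (truncArg k h (u x) (w x))) Ω := by
    refine Integrable.mono' (D.f_int.mul_const (n * (2 * k))) ((hgm.div
      ((hum.norm.aemeasurable.add_const (1 / (n : ℝ))).pow D.γ_meas)).mul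
        hφm.aemeasurable).aestronglyMeasurable ?_
    filter_upwards [hg, hφb, D.γ_mem] with x hgx hφx hγ
    -- For fixed `n` the right-hand side is not singular: `1/n ≤ 1` and `γ < 1` give `(1/n)^γ ≥
    -- 1/n`.
    have hd : 1 / (n : ℝ) ≤ (|u x| + 1 / (n : ℝ)) ^ γ x := by
      calc 1 / (n : ℝ) = (1 / (n : ℝ)) ^ (1 : ℝ) := (Real.rpow_one _).symm
        _ ≤ (1 / (n : ℝ)) ^ γ x := Real.rpow_le_rpow_of_exponent_ge (by positivity)
          ((div_le_one hn0).2 (by exact_mod_cast hn)) hγ.2.le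
        _ ≤ _ := Real.rpow_le_rpow (by positivity) (by linarith [abs_nonneg (u x)]) hγ.1.le
    have hf0 : 0 ≤ f x := hgx.1.trans hgx.2
    rw [norm_mul, Real.norm_of_nonneg (div_nonneg hgx.1 (by positivity)), ← mul_assoc]
    refine mul_le_mul ?_ hφx (norm_nonneg _) (by positivity)
    calc g x / (|u x| + 1 / (n : ℝ)) ^ γ x ≤ f x / (1 / (n : ℝ)) := by
          gcongr
          exact hgx.2
      _ = f x * n := by rw [div_div_eq_mul_div, div_one]
  have hdm : AEStronglyMeasurable (fun x => |trunc k (u x) - trunc k (w x)|)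
      (volume.restrict Ω) :=
    (hTk.integrable.aestronglyMeasurable.sub hTw.integrable.aestronglyMeasurable).norm
  have hdle : ∀ᵐ x ∂(volume.restrict Ω), |trunc k (u x) - trunc k (w x)| ≤ k := by
    filter_upwards [hu0, hw0] with x h1 h2
    exact abs_trunc_sub_trunc_le hk.le h1 h2
  have j1 : IntegrableOn (fun x => f x * |trunc k (u x) - trunc k (w x)| ^ (1 - γ x)) Ω := by
    refine Integrable.mul_bdd D.f_int
      (c := max 1 k ^ (1 : ℝ))
      (hdm.aemeasurable.pow (D.γ_meas.const_sub 1)).aestronglyMeasurable ?_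
    filter_upwards [hdle, D.γ_mem] with x hx hγ
    rw [Real.norm_of_nonneg (by positivity)]
    exact rpow_le_max_rpow (abs_nonneg _) hx (by linarith) (by linarith)
  have j2 : IntegrableOn (fun x => f x * min 1 (u x / h)) Ω := by
    refine Integrable.mul_bdd D.f_int (c := 1)
      (aestronglyMeasurable_const.inf (hum.div₀ aestronglyMeasurable_const)) ?_
    filter_upwards [hu0] with x hx
    have : 0 ≤ min 1 (u x / h) := le_min zero_le_one (div_nonneg hx (by linarith))
    rw [Real.norm_of_nonneg this]
    exact min_le_left _ _
  have j3 : IntegrableOn (fun x => |trunc k (u x) - trunc k (w x)|) Ω :=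
    Integrable.of_bound hdm k (by simpa using hdle)
  have hind : AEStronglyMeasurable (fun x => if k ≤ u x then ‖truncGrad k w W x‖ else 0)
      (volume.restrict Ω) := by
    have hmeas : Measurable fun y : ℝ × ℝ => if k ≤ y.1 then y.2 else 0 :=
      Measurable.ite (measurableSet_le measurable_const measurable_fst) measurable_snd
        measurable_const
    exact (hmeas.comp_aemeasurable
      (hum.aemeasurable.prodMk hTwm.norm.aemeasurable)).aestronglyMeasurable
  have hind0 : ∀ x, 0 ≤ if k ≤ u x then ‖truncGrad k w W x‖ else 0 := fun x => by
    split_ifs <;> positivity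
  have j4 : IntegrableOn (fun x => (if k ≤ u x then ‖truncGrad k w W x‖ else 0) *
      ‖truncGrad (h + 2 * k) u (weakGrad Ω u) x‖ ^ (p x - 1)) Ω := by
    refine hp.integrable_mul_rpow hind hTMm.norm hind0 (fun x => norm_nonneg _) ?_ (hTi _ hTMm)
    refine (hp.integrable_rpow_mono hind hWk (Eventually.of_forall fun x => ?_)).congr
      (Eventually.of_forall fun x => ?_)
    · rw [Real.norm_of_nonneg (hind0 x)]
      split_ifs <;> simp
    · simp only [Real.norm_of_nonneg (hind0 x)]
  have s1 : ∫ x in Ω, a x * (‖truncGrad k u (weakGrad Ω u) x‖ ^ (p x - 2) *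
        inner ℝ (truncGrad k u (weakGrad Ω u) x)
          (truncGrad k u (weakGrad Ω u) x - truncGrad k w W x))
      ≤ (∫ x in Ω, a x * (‖weakGrad Ω u x‖ ^ (p x - 2) * inner ℝ (weakGrad Ω u x)
          (weakGrad Ω (fun x => trunc (2 * k) (truncArg k h (u x) (w x))) x)))
        + β * ∫ x in Ω, (if k ≤ u x then ‖truncGrad k w W x‖ else 0) *
            ‖truncGrad (h + 2 * k) u (weakGrad Ω u) x‖ ^ (p x - 1) := by
    rw [← integral_const_mul, ← integral_add i1 (j4.const_mul β)]
    refine integral_mono_ae i0 (i1.add (j4.const_mul β)) ?_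
    filter_upwards [hφgrad, hu0, hw0, D.a_mem, hp.ae_mem] with x hx hux hwx ha hpx
    have := diffusion_term_ge (U := weakGrad Ω u x) (W := truncGrad k w W x) hk hkh hux hwx
      (D.α_pos.le.trans ha.1) ha.2 (hp.one_lt.trans_le hpx.1)
    have hx' : weakGrad Ω (fun x => trunc (2 * k) (truncArg k h (u x) (w x))) x = _ := hx
    simp only [hx']
    exact this
  have s2 : (∫ x in Ω, g x / (|u x| + 1 / (n : ℝ)) ^ γ x *
        trunc (2 * k) (truncArg k h (u x) (w x)))
      - (∫ x in Ω, b x * (|u x| ^ (r x - 1) * u x) *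
        trunc (2 * k) (truncArg k h (u x) (w x)))
      ≤ (∫ x in Ω, f x * |trunc k (u x) - trunc k (w x)| ^ (1 - γ x))
        + 2 * k * (∫ x in Ω, f x * min 1 (u x / h))
        + ν * max 1 k ^ R * (∫ x in Ω, |trunc k (u x) - trunc k (w x)|) := by
    have j12 : IntegrableOn (fun x => f x * |trunc k (u x) - trunc k (w x)| ^ (1 - γ x)
        + 2 * k * (f x * min 1 (u x / h))) Ω := j1.add (j2.const_mul _)
    rw [← integral_sub i3 i2, ← integral_const_mul, ← integral_const_mul,
      ← integral_add j1 (j2.const_mul _), ← integral_add j12 (j3.const_mul _)]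
    refine integral_mono_ae (i3.sub i2) (j12.add (j3.const_mul _)) ?_
    filter_upwards [hu0, hw0, hg, D.γ_mem, D.b_mem, D.r_mem] with x hux hwx hgx hγ hb hr
    have h1 := singular_term_le hk hh hux hwx hgx.1 hgx.2 hγ.1 hn
    have h2 := absorption_term_le hk hkh hux hwx hb.1.le hb.2 hr.1 hr.2
    linarith
  linarith

end Estimates

/-! ### Passage to the limit and strong convergence of the gradients. -/

section Convergence

variable {N : ℕ}

/-- A sequence of approximate solutions with bounded truncations, converging a.e. to a function of
`W_0^{1,1}(Ω)`. -/
structure ApproxSeq (Ω : Set (EuclideanSpace ℝ (Fin N)))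
    (p r γ a b f : EuclideanSpace ℝ (Fin N) → ℝ)
    (v : ℕ → EuclideanSpace ℝ (Fin N) → ℝ) (w : EuclideanSpace ℝ (Fin N) → ℝ)
    (W : EuclideanSpace ℝ (Fin N) → EuclideanSpace ℝ (Fin N)) : Prop where
  sol : ∀ j, ∃ n g, 1 ≤ n ∧ AEMeasurable g (volume.restrict Ω) ∧
    (∀ᵐ x ∂(volume.restrict Ω), 0 ≤ g x ∧ g x ≤ f x) ∧ IsApproxSol Ω p r γ a b g n (v j)
  bound : ∀ k, 0 < k → ∃ M : ℝ, ∀ j,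
    ∫ x in Ω, ‖truncGrad k (v j) (weakGrad Ω (v j)) x‖ ^ p x ≤ M
  limit : HasW011Grad Ω w W
  tendsto : ∀ᵐ x ∂(volume.restrict Ω), Tendsto (fun j => v j x) atTop (𝓝 (w x))

variable {Ω : Set (EuclideanSpace ℝ (Fin N))}
  {p r γ a b f w : EuclideanSpace ℝ (Fin N) → ℝ} {q P R α β ν k : ℝ}
  {v : ℕ → EuclideanSpace ℝ (Fin N) → ℝ}
  {W : EuclideanSpace ℝ (Fin N) → EuclideanSpace ℝ (Fin N)}

theorem ApproxSeq.memW0 (S : ApproxSeq Ω p r γ a b f v w W) (j : ℕ) : MemW0 Ω p (v j) := by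
  obtain ⟨n, g, -, -, -, h⟩ := S.sol j
  exact h.1

theorem ApproxSeq.hasW011Grad (S : ApproxSeq Ω p r γ a b f v w W) (j : ℕ) :
    HasW011Grad Ω (v j) (weakGrad Ω (v j)) :=
  (S.memW0 j).hasW011Grad

theorem ApproxSeq.aestronglyMeasurable (S : ApproxSeq Ω p r γ a b f v w W) (j : ℕ) :
    AEStronglyMeasurable (v j) (volume.restrict Ω) :=
  (S.hasW011Grad j).integrable.aestronglyMeasurable

theorem ApproxSeq.aestronglyMeasurable_truncGrad (S : ApproxSeq Ω p r γ a b f v w W)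
    (hΩ : IsOpen Ω) (hk : 0 < k) (j : ℕ) :
    AEStronglyMeasurable (truncGrad k (v j) (weakGrad Ω (v j))) (volume.restrict Ω) :=
  ((S.hasW011Grad j).hasW011Grad_trunc hΩ hk).integrable_grad.aestronglyMeasurable

theorem ApproxSeq.integrable_rpow_truncGrad (S : ApproxSeq Ω p r γ a b f v w W)
    (hΩ : IsOpen Ω) (hp : IsExponent (volume.restrict Ω) p q P) (hk : 0 < k) (j : ℕ) :
    IntegrableOn (fun x => ‖truncGrad k (v j) (weakGrad Ω (v j)) x‖ ^ p x) Ω :=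
  hp.integrable_rpow_mono (S.aestronglyMeasurable_truncGrad hΩ hk j)
    ((S.memW0 j).integrable_rpow_weakGrad hp) (Eventually.of_forall fun x => norm_truncGrad_le k x)

theorem ApproxSeq.tendsto_trunc (S : ApproxSeq Ω p r γ a b f v w W) (k : ℝ) :
    ∀ᵐ x ∂(volume.restrict Ω),
      Tendsto (fun j => |trunc k (v j x) - trunc k (w x)|) atTop (𝓝 0) := by
  filter_upwards [S.tendsto] with x hx
  have h1 := (((continuous_trunc k).tendsto _).comp hx).sub_const (trunc k (w x))
  simpa using h1.abs

theorem ApproxSeq.nonneg (S : ApproxSeq Ω p r γ a b f v w W)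
    (D : ProblemData Ω p r γ a b f q P R α β ν) (j : ℕ) :
    ∀ᵐ x ∂(volume.restrict Ω), 0 ≤ v j x := by
  obtain ⟨n, g, -, -, hg, h⟩ := S.sol j
  exact D.nonneg (hg.mono fun x hx => hx.1) h

theorem ApproxSeq.limit_nonneg (S : ApproxSeq Ω p r γ a b f v w W)
    (D : ProblemData Ω p r γ a b f q P R α β ν) : ∀ᵐ x ∂(volume.restrict Ω), 0 ≤ w x := by
  filter_upwards [S.tendsto, ae_all_iff.2 (S.nonneg D)] with x hx h0
  exact ge_of_tendsto' hx h0

theorem ApproxSeq.abs_trunc_sub_le (S : ApproxSeq Ω p r γ a b f v w W)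
    (D : ProblemData Ω p r γ a b f q P R α β ν) (hk : 0 < k) (j : ℕ) :
    ∀ᵐ x ∂(volume.restrict Ω), |trunc k (v j x) - trunc k (w x)| ≤ k := by
  filter_upwards [S.nonneg D j, S.limit_nonneg D] with x h1 h2
  exact abs_trunc_sub_trunc_le hk.le h1 h2

theorem ApproxSeq.aestronglyMeasurable_abs_trunc_sub (S : ApproxSeq Ω p r γ a b f v w W)
    (k : ℝ) (j : ℕ) :
    AEStronglyMeasurable (fun x => |trunc k (v j x) - trunc k (w x)|) (volume.restrict Ω) :=
  (((continuous_trunc k).comp_aestronglyMeasurable (S.aestronglyMeasurable j)).sub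
    ((continuous_trunc k).comp_aestronglyMeasurable S.limit.integrable.aestronglyMeasurable)).norm

/-- The truncations converge boundedly a.e., hence against the gradient of any test function;
integration by parts moves this to their gradients. -/
theorem ApproxSeq.exists_tendstoDistrib (S : ApproxSeq Ω p r γ a b f v w W)
    (D : ProblemData Ω p r γ a b f q P R α β ν) (hk : 0 < k) :
    ∃ M, TendstoDistrib Ω p M (fun j => truncGrad k (v j) (weakGrad Ω (v j)))
      (truncGrad k w W) := by
  have := D.isFiniteMeasure
  obtain ⟨M, hM⟩ := S.bound k hk
  have hTw := S.limit.hasW011Grad_trunc D.isOpen hk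
  refine ⟨M, S.aestronglyMeasurable_truncGrad D.isOpen hk,
    S.integrable_rpow_truncGrad D.isOpen D.exponent hk, hM, hTw.integrable_grad, fun φ hφ => ?_⟩
  have hTv := fun j => (S.hasW011Grad j).hasW011Grad_trunc D.isOpen hk
  obtain ⟨C, hC0, hC⟩ := hφ.exists_bound
  have h1 : Tendsto (fun j => ∫ x in Ω, trunc k (v j x) • gradient φ x) atTop
      (𝓝 (∫ x in Ω, trunc k (w x) • gradient φ x)) := by
    refine tendsto_integral_of_dominated_convergence (fun _ => k * C)
      (fun j => (hTv j).integrable.aestronglyMeasurable.smul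
        hφ.continuous_gradient.aestronglyMeasurable) (integrable_const _)
      (fun j => Eventually.of_forall fun x => ?_) ?_
    · rw [norm_smul]
      exact mul_le_mul (abs_trunc_le hk.le _) (hC x).2 (norm_nonneg _) hk.le
    · filter_upwards [S.tendsto] with x hx
      exact (((continuous_trunc k).tendsto _).comp hx).smul_const _
  have h2 := h1.neg
  rw [hTw.hasWeakGrad.2.2 φ hφ, neg_neg] at h2
  refine h2.congr fun j => ?_
  rw [(hTv j).hasWeakGrad.2.2 φ hφ, neg_neg]

theorem ApproxSeq.integrable_rpow_limit (S : ApproxSeq Ω p r γ a b f v w W)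
    (D : ProblemData Ω p r γ a b f q P R α β ν) (hk : 0 < k) :
    IntegrableOn (fun x => ‖truncGrad k w W x‖ ^ p x) Ω := by
  have := D.isFiniteMeasure
  obtain ⟨M, hM⟩ := S.exists_tendstoDistrib D hk
  exact hM.integrable_rpow_limit D.isOpen D.exponent

theorem ApproxSeq.tendsto_integral_singular (S : ApproxSeq Ω p r γ a b f v w W)
    (D : ProblemData Ω p r γ a b f q P R α β ν) (hk : 0 < k) :
    Tendsto (fun j => ∫ x in Ω, f x * |trunc k (v j x) - trunc k (w x)| ^ (1 - γ x)) atTop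
      (𝓝 0) := by
  have := tendsto_integral_of_dominated_convergence (μ := volume.restrict Ω)
    (F := fun j x => f x * |trunc k (v j x) - trunc k (w x)| ^ (1 - γ x)) (f := fun _ => (0 : ℝ))
    (fun x => f x * max 1 k ^ (1 : ℝ))
    (fun j => D.f_int.aestronglyMeasurable.mul
      ((S.aestronglyMeasurable_abs_trunc_sub k j).aemeasurable.pow
        (D.γ_meas.const_sub 1)).aestronglyMeasurable)
    (D.f_int.mul_const _) (fun j => ?_) ?_
  · simpa using this
  · filter_upwards [S.abs_trunc_sub_le D hk j, D.γ_mem, D.f_nonneg] with x hx hγ hf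
    rw [norm_mul, Real.norm_of_nonneg hf, Real.norm_of_nonneg (by positivity)]
    gcongr
    exact rpow_le_max_rpow (abs_nonneg _) hx (by linarith) (by linarith)
  · filter_upwards [S.tendsto_trunc k, D.γ_mem] with x hx hγ
    have h0 : 0 < 1 - γ x := by linarith
    simpa [Real.zero_rpow h0.ne'] using (hx.rpow_const (Or.inr h0.le)).const_mul (f x)

theorem ApproxSeq.tendsto_integral_abs_trunc_sub (S : ApproxSeq Ω p r γ a b f v w W)
    (D : ProblemData Ω p r γ a b f q P R α β ν) (hk : 0 < k) :
    Tendsto (fun j => ∫ x in Ω, |trunc k (v j x) - trunc k (w x)|) atTop (𝓝 0) := by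
  have := D.isFiniteMeasure
  have := tendsto_integral_of_dominated_convergence (μ := volume.restrict Ω)
    (F := fun j x => |trunc k (v j x) - trunc k (w x)|) (f := fun _ => (0 : ℝ))
    (fun _ => k) (S.aestronglyMeasurable_abs_trunc_sub k) (integrable_const _)
    (fun j => by simpa using S.abs_trunc_sub_le D hk j) (S.tendsto_trunc k)
  simpa using this

theorem ApproxSeq.tendsto_integral_rpow_trunc_sub (S : ApproxSeq Ω p r γ a b f v w W)
    (D : ProblemData Ω p r γ a b f q P R α β ν) (hk : 0 < k) :
    Tendsto (fun j => ∫ x in Ω, |trunc k (v j x) - trunc k (w x)| ^ p x) atTop (𝓝 0) := by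
  have := D.isFiniteMeasure
  have := tendsto_integral_of_dominated_convergence (μ := volume.restrict Ω)
    (F := fun j x => |trunc k (v j x) - trunc k (w x)| ^ p x) (f := fun _ => (0 : ℝ))
    (fun _ => max 1 k ^ P) (fun j => ((S.aestronglyMeasurable_abs_trunc_sub k j).aemeasurable.pow
      D.exponent.aemeasurable).aestronglyMeasurable) (integrable_const _) (fun j => ?_) ?_
  · simpa using this
  · filter_upwards [S.abs_trunc_sub_le D hk j, D.exponent.ae_mem] with x hx hp
    rw [Real.norm_of_nonneg (by positivity)]
    exact rpow_le_max_rpow (abs_nonneg _) hx (by linarith [D.exponent.one_lt]) hp.2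
  · filter_upwards [S.tendsto_trunc k, D.exponent.ae_mem] with x hx hp
    have h0 : 0 < p x := by linarith [D.exponent.one_lt]
    simpa [Real.zero_rpow h0.ne'] using hx.rpow_const (Or.inr h0.le)

/-- Using `min 1 (v/h)` instead of the indicator of `{v > h}` keeps the integrand continuous in `v`,
so no level set of the limit interferes. -/
theorem ApproxSeq.tendsto_integral_tail (S : ApproxSeq Ω p r γ a b f v w W)
    (D : ProblemData Ω p r γ a b f q P R α β ν) {h : ℝ} (hh : 0 < h) :
    Tendsto (fun j => ∫ x in Ω, f x * min 1 (v j x / h)) atTop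
      (𝓝 (∫ x in Ω, f x * min 1 (w x / h))) := by
  refine tendsto_integral_of_dominated_convergence f
    (fun j => D.f_int.aestronglyMeasurable.mul (aestronglyMeasurable_const.inf
      ((S.aestronglyMeasurable j).div₀ aestronglyMeasurable_const))) D.f_int (fun j => ?_) ?_
  · filter_upwards [S.nonneg D j, D.f_nonneg] with x hx hf
    have : 0 ≤ min 1 (v j x / h) := le_min zero_le_one (div_nonneg hx hh.le)
    rw [Real.norm_of_nonneg (mul_nonneg hf this)]
    exact mul_le_of_le_one_right hf (min_le_left _ _)
  · filter_upwards [S.tendsto] with x hx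
    exact (tendsto_const_nhds.min (hx.div_const h)).const_mul _

theorem ApproxSeq.tendsto_integral_limit_tail (S : ApproxSeq Ω p r γ a b f v w W)
    (D : ProblemData Ω p r γ a b f q P R α β ν) :
    Tendsto (fun m : ℕ => ∫ x in Ω, f x * min 1 (w x / m)) atTop (𝓝 0) := by
  have := tendsto_integral_of_dominated_convergence (μ := volume.restrict Ω)
    (F := fun (m : ℕ) x => f x * min 1 (w x / m)) (f := fun _ => (0 : ℝ)) f
    (fun j => D.f_int.aestronglyMeasurable.mul (aestronglyMeasurable_const.inf
      (S.limit.integrable.aestronglyMeasurable.div₀ aestronglyMeasurable_const))) D.f_int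
    (fun m => ?_) ?_
  · simpa using this
  · filter_upwards [S.limit_nonneg D, D.f_nonneg] with x hx hf
    have : 0 ≤ min 1 (w x / m) := le_min zero_le_one (by positivity)
    rw [Real.norm_of_nonneg (mul_nonneg hf this)]
    exact mul_le_of_le_one_right hf (min_le_left _ _)
  · refine Eventually.of_forall fun x => ?_
    have h1 : Tendsto (fun m : ℕ => w x / m) atTop (𝓝 0) :=
      tendsto_const_nhds.div_atTop tendsto_natCast_atTop_atTop
    simpa using ((tendsto_const_nhds (x := (1 : ℝ))).min h1).const_mul (f x)

/-- The first factor tends to 0 a.e.: if `w < k` then eventually `v_j < k`, and if `w ≥ k` the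
gradient of `T_k(w)` is 0. Being dominated by `|∇T_k(w)|`, it has vanishing modular, and Young's
inequality absorbs the bounded second factor. -/
theorem ApproxSeq.tendsto_integral_cross (S : ApproxSeq Ω p r γ a b f v w W)
    (D : ProblemData Ω p r γ a b f q P R α β ν) (hk : 0 < k) {l : ℝ} (hl : 0 < l) :
    Tendsto (fun j => ∫ x in Ω, (if k ≤ v j x then ‖truncGrad k w W x‖ else 0) *
      ‖truncGrad l (v j) (weakGrad Ω (v j)) x‖ ^ (p x - 1)) atTop (𝓝 0) := by
  have hp := D.exponent
  have hWk := S.integrable_rpow_limit D hk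
  have hWm := (S.limit.hasW011Grad_trunc D.isOpen hk).integrable_grad.aestronglyMeasurable
  obtain ⟨M, hM⟩ := S.bound l hl
  set z : ℕ → EuclideanSpace ℝ (Fin N) → ℝ :=
    fun j x => if k ≤ v j x then ‖truncGrad k w W x‖ else 0 with hz
  have hz0 : ∀ j x, 0 ≤ z j x := fun j x => by
    simp only [hz]
    split_ifs <;> positivity
  have hzm : ∀ j, AEStronglyMeasurable (z j) (volume.restrict Ω) := fun j => by
    have hmeas : Measurable fun y : ℝ × ℝ => if k ≤ y.1 then y.2 else 0 :=
      Measurable.ite (measurableSet_le measurable_const measurable_fst) measurable_snd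
        measurable_const
    exact (hmeas.comp_aemeasurable
      ((S.aestronglyMeasurable j).aemeasurable.prodMk
        hWm.norm.aemeasurable)).aestronglyMeasurable
  have hzle : ∀ j, ∀ᵐ x ∂(volume.restrict Ω), ‖z j x ^ p x‖ ≤ ‖truncGrad k w W x‖ ^ p x :=
    fun j => by
    filter_upwards [hp.ae_mem] with x hpx
    rw [Real.norm_of_nonneg (Real.rpow_nonneg (hz0 j x) _)]
    refine Real.rpow_le_rpow (hz0 j x) ?_ (by linarith [hp.one_lt])
    simp only [hz]
    split_ifs <;> simp
  have hzpm : ∀ j, AEStronglyMeasurable (fun x => z j x ^ p x) (volume.restrict Ω) := fun j =>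
    ((hzm j).aemeasurable.pow hp.aemeasurable).aestronglyMeasurable
  have hzi : ∀ j, IntegrableOn (fun x => z j x ^ p x) Ω := fun j => hWk.mono' (hzpm j) (hzle j)
  have hz1 : Tendsto (fun j => ∫ x in Ω, z j x ^ p x) atTop (𝓝 0) := by
    have := tendsto_integral_of_dominated_convergence (μ := volume.restrict Ω)
      (F := fun j x => z j x ^ p x) (f := fun _ => (0 : ℝ)) _ hzpm hWk hzle ?_
    · simpa using this
    · filter_upwards [S.tendsto, hp.ae_mem] with x hx hpx
      refine tendsto_const_nhds.congr' ?_
      have h0 : ∀ᶠ j in atTop, z j x = 0 := by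
        rcases lt_or_ge (w x) k with h | h
        · filter_upwards [hx.eventually_lt_const h] with j hj
          simp only [hz]
          rw [if_neg (by linarith)]
        · refine Eventually.of_forall fun j => ?_
          have : truncGrad k w W x = 0 := if_neg (by linarith [le_abs_self (w x)])
          simp [hz, this]
      filter_upwards [h0] with j hj
      rw [hj, Real.zero_rpow (by linarith [hp.one_lt])]
  refine tendsto_order.2 ⟨fun c hc => Eventually.of_forall fun j => hc.trans_le
    (integral_nonneg fun x => mul_nonneg (hz0 j x) (by positivity)), fun ε hε => ?_⟩
  set δ : ℝ := min 1 (ε / (2 * (|M| + 1))) with hδ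
  have hδ0 : 0 < δ := lt_min one_pos (by positivity)
  have hlim : Tendsto (fun j => δ⁻¹ ^ P * ∫ x in Ω, z j x ^ p x) atTop (𝓝 0) := by
    simpa using hz1.const_mul (δ⁻¹ ^ P)
  filter_upwards [hlim.eventually_lt_const (show 0 < ε / 2 by positivity)] with j hj
  have hUi := S.integrable_rpow_truncGrad D.isOpen hp hl j
  have hUm := S.aestronglyMeasurable_truncGrad D.isOpen hl j
  have h1 : ∫ x in Ω, z j x * ‖truncGrad l (v j) (weakGrad Ω (v j)) x‖ ^ (p x - 1)
      ≤ ∫ x in Ω, (δ * ‖truncGrad l (v j) (weakGrad Ω (v j)) x‖ ^ p x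
        + δ⁻¹ ^ P * z j x ^ p x) := by
    refine integral_mono_ae (hp.integrable_mul_rpow (hzm j) hUm.norm (hz0 j)
      (fun x => norm_nonneg _) (hzi j) hUi) ((hUi.const_mul _).add ((hzi j).const_mul _)) ?_
    filter_upwards [hp.ae_mem] with x hpx
    exact mul_rpow_sub_one_le (hz0 j x) (norm_nonneg _) (hp.one_lt.trans_le hpx.1) hpx.2 hδ0
      (min_le_left _ _)
  rw [integral_add (hUi.const_mul _) ((hzi j).const_mul _), integral_const_mul,
    integral_const_mul] at h1
  have h2 : δ * ∫ x in Ω, ‖truncGrad l (v j) (weakGrad Ω (v j)) x‖ ^ p x ≤ ε / 2 := by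
    have : ∫ x in Ω, ‖truncGrad l (v j) (weakGrad Ω (v j)) x‖ ^ p x ≤ |M| + 1 := by
      linarith [hM j, le_abs_self M]
    calc δ * ∫ x in Ω, ‖truncGrad l (v j) (weakGrad Ω (v j)) x‖ ^ p x
        ≤ ε / (2 * (|M| + 1)) * (|M| + 1) :=
          mul_le_mul (min_le_right _ _) this (integral_nonneg fun x => by positivity)
            (by positivity)
      _ = ε / 2 := by field_simp
  linarith

/-- The upper limit of the diffusion terms is nonpositive. -/
theorem ApproxSeq.eventually_diffusion_lt (S : ApproxSeq Ω p r γ a b f v w W)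
    (D : ProblemData Ω p r γ a b f q P R α β ν) (hk : 0 < k) {ε : ℝ} (hε : 0 < ε) :
    ∀ᶠ j in atTop, ∫ x in Ω, a x * (‖truncGrad k (v j) (weakGrad Ω (v j)) x‖ ^ (p x - 2) *
        inner ℝ (truncGrad k (v j) (weakGrad Ω (v j)) x)
          (truncGrad k (v j) (weakGrad Ω (v j)) x - truncGrad k w W x)) < ε := by
  have htail : Tendsto (fun m : ℕ => 2 * k * ∫ x in Ω, f x * min 1 (w x / m)) atTop (𝓝 0) := by
    simpa using (S.tendsto_integral_limit_tail D).const_mul (2 * k)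
  -- The level `h = m` is fixed first, so that the tail of the limit is below `ε`; only then does `j
  -- → ∞`.
  obtain ⟨m, hm1, hm2, hm3⟩ := ((htail.eventually_lt_const hε).and
    ((eventually_ge_atTop ⌈k⌉₊).and (eventually_ge_atTop 1))).exists
  have hkm : k ≤ m := (Nat.le_ceil k).trans (by exact_mod_cast hm2)
  have h1m : (1 : ℝ) ≤ m := by exact_mod_cast hm3
  have hlim := (((S.tendsto_integral_singular D hk).add
    ((S.tendsto_integral_tail D (show (0 : ℝ) < m by linarith)).const_mul (2 * k))).add
    ((S.tendsto_integral_abs_trunc_sub D hk).const_mul (ν * max 1 k ^ R))).add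
    ((S.tendsto_integral_cross D hk (show (0 : ℝ) < m + 2 * k by linarith)).const_mul β)
  simp only [mul_zero, add_zero, zero_add] at hlim
  filter_upwards [hlim.eventually_lt_const hm1] with j hj
  obtain ⟨n, g, hn, hgm, hg, hsol⟩ := S.sol j
  exact (D.main_estimate hn hgm hg hsol (S.nonneg D j) S.limit (S.limit_nonneg D) hk hkm h1m
    (S.integrable_rpow_limit D hk)).trans_lt hj

/-- The fixed field `a |∇T_k(w)|^(p-2) ∇T_k(w)` lies in the space with the conjugate exponent, so
weak convergence of the gradients applies. -/
theorem ApproxSeq.tendsto_integral_flux_limit (S : ApproxSeq Ω p r γ a b f v w W)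
    (D : ProblemData Ω p r γ a b f q P R α β ν) (hk : 0 < k) :
    Tendsto (fun j => ∫ x in Ω, a x * (‖truncGrad k w W x‖ ^ (p x - 2) *
        inner ℝ (truncGrad k w W x)
          (truncGrad k (v j) (weakGrad Ω (v j)) x - truncGrad k w W x))) atTop (𝓝 0) := by
  have := D.isFiniteMeasure
  have hp := D.exponent
  obtain ⟨M, hM⟩ := S.exists_tendstoDistrib D hk
  have hWk := S.integrable_rpow_limit D hk
  have hWm := hM.integrable.aestronglyMeasurable
  set F : EuclideanSpace ℝ (Fin N) → EuclideanSpace ℝ (Fin N) :=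
    fun x => (a x * ‖truncGrad k w W x‖ ^ (p x - 2)) • truncGrad k w W x with hF
  have hFm : AEStronglyMeasurable F (volume.restrict Ω) :=
    (D.a_meas.mul (hWm.norm.aemeasurable.pow
      (hp.aemeasurable.sub_const 2))).aestronglyMeasurable.smul hWm
  have hFi : IntegrableOn (fun x => ‖F x‖ ^ (p x / (p x - 1))) Ω := by
    refine Integrable.mono' (hWk.const_mul (max 1 β ^ (q / (q - 1))))
      (hp.aestronglyMeasurable_rpow_conj hFm) ?_
    filter_upwards [hp.ae_mem, D.a_mem] with x hpx ha
    have hp1 := hp.one_lt.trans_le hpx.1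
    have ha0 : 0 ≤ a x := D.α_pos.le.trans ha.1
    have hn : ‖F x‖ = a x * ‖truncGrad k w W x‖ ^ (p x - 1) := by
      rw [← rpow_sub_two_mul_self (norm_nonneg _) hp1, hF]
      simp only [norm_smul, norm_mul, Real.norm_of_nonneg ha0,
        Real.norm_of_nonneg (Real.rpow_nonneg (norm_nonneg (truncGrad k w W x)) (p x - 2))]
      ring
    have he : (p x - 1) * (p x / (p x - 1)) = p x := by
      have : p x - 1 ≠ 0 := by linarith
      field_simp
    rw [Real.norm_of_nonneg (by positivity), hn, Real.mul_rpow ha0 (by positivity),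
      ← Real.rpow_mul (norm_nonneg _), he]
    gcongr
    exact rpow_le_max_rpow ha0 ha.2 (conj_pos hp1).le (IsExponent.conj_le hp.one_lt hpx.1)
  have h1 := (hM.tendsto_inner D.isOpen hp hFm hFi).sub_const
    (∫ x in Ω, inner ℝ (F x) (truncGrad k w W x))
  rw [sub_self] at h1
  refine h1.congr fun j => ?_
  rw [← integral_sub (hp.integrable_inner hFm (hM.meas j) hFi (hM.integrable_rpow j))
    (hp.integrable_inner hFm hWm hFi hWk)]
  refine integral_congr_ae (Eventually.of_forall fun x => ?_)
  simp only [hF, real_inner_smul_left, inner_sub_right]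
  ring

theorem rpow_mul_inner_sub {E : Type*} [NormedAddCommGroup E] [InnerProductSpace ℝ E] (p : ℝ)
    (ξ η ζ : E) : ‖ξ‖ ^ (p - 2) * inner ℝ ξ ζ - ‖η‖ ^ (p - 2) * inner ℝ η ζ
      = inner ℝ (‖ξ‖ ^ (p - 2) • ξ - ‖η‖ ^ (p - 2) • η) ζ := by
  rw [inner_sub_left, real_inner_smul_left, real_inner_smul_left]

/-- Strong convergence of the gradients of the truncations. -/
theorem ApproxSeq.tendsto_integral_rpow_truncGrad_sub (S : ApproxSeq Ω p r γ a b f v w W)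
    (D : ProblemData Ω p r γ a b f q P R α β ν) (hk : 0 < k) :
    Tendsto (fun j => ∫ x in Ω,
      ‖truncGrad k (v j) (weakGrad Ω (v j)) x - truncGrad k w W x‖ ^ p x) atTop (𝓝 0) := by
  have hp := D.exponent
  have hWk := S.integrable_rpow_limit D hk
  have hWm := (S.limit.hasW011Grad_trunc D.isOpen hk).integrable_grad.aestronglyMeasurable
  obtain ⟨M, hM⟩ := S.bound k hk
  refine tendsto_order.2 ⟨fun c hc => Eventually.of_forall fun j => hc.trans_le
    (integral_nonneg fun x => by positivity), fun ε hε => ?_⟩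
  set M' : ℝ := |M| + (∫ x in Ω, ‖truncGrad k w W x‖ ^ p x) + 1 with hM'
  have hI : 0 ≤ ∫ x in Ω, ‖truncGrad k w W x‖ ^ p x := integral_nonneg fun x => by positivity
  have hM0 : 0 < M' := by positivity
  -- `M'` bounds the sum of the two modulars, so the first term of the monotonicity inequality costs
  -- at most `ε/2`. The threshold in `hη` makes the second cost less than `ε/2`; `C + 1` allows for
  -- `C = 0`.
  obtain ⟨C, hC, hmono⟩ := exists_rpow_norm_sub_le (E := EuclideanSpace ℝ (Fin N)) (P := P)
    hp.one_lt (show 0 < ε / (2 * M') by positivity)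
  have hη : 0 < ε * α / (4 * (C + 1)) := by
    have := D.α_pos
    positivity
  filter_upwards [S.eventually_diffusion_lt D hk hη,
    (S.tendsto_integral_flux_limit D hk).eventually_const_lt (neg_lt_zero.2 hη)] with j hj1 hj2
  have hUi := S.integrable_rpow_truncGrad D.isOpen hp hk j
  have hUm := S.aestronglyMeasurable_truncGrad D.isOpen hk j
  have hdi := hp.integrable_rpow_sub hUm hWm hUi hWk
  have i1 := D.integrable_flux hUm (hUm.sub hWm) hUi hdi
  have i2 := D.integrable_flux hWm (hUm.sub hWm) hWk hdi
  simp only [Pi.sub_apply] at i1 i2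
  have h1 : ∫ x in Ω, ‖truncGrad k (v j) (weakGrad Ω (v j)) x - truncGrad k w W x‖ ^ p x
      ≤ ∫ x in Ω, (ε / (2 * M') * (‖truncGrad k (v j) (weakGrad Ω (v j)) x‖ ^ p x
        + ‖truncGrad k w W x‖ ^ p x) + C / α *
        (a x * (‖truncGrad k (v j) (weakGrad Ω (v j)) x‖ ^ (p x - 2) *
        inner ℝ (truncGrad k (v j) (weakGrad Ω (v j)) x)
          (truncGrad k (v j) (weakGrad Ω (v j)) x - truncGrad k w W x))
        - a x * (‖truncGrad k w W x‖ ^ (p x - 2) * inner ℝ (truncGrad k w W x)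
          (truncGrad k (v j) (weakGrad Ω (v j)) x - truncGrad k w W x)))) := by
    refine integral_mono_ae hdi (((hUi.add hWk).const_mul _).add ((i1.sub i2).const_mul _)) ?_
    filter_upwards [hp.ae_mem, D.a_mem] with x hpx ha
    refine (hmono (p x) _ _ hpx.1 hpx.2).trans ?_
    have hE := inner_rpow_smul_sub_nonneg (hp.one_lt.trans_le hpx.1)
      (truncGrad k (v j) (weakGrad Ω (v j)) x) (truncGrad k w W x)
    have hα := D.α_pos
    refine add_le_add le_rfl ?_
    rw [← mul_sub, rpow_mul_inner_sub, ← mul_assoc]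
    refine mul_le_mul_of_nonneg_right ?_ hE
    rw [div_mul_eq_mul_div, le_div_iff₀ hα]
    exact mul_le_mul_of_nonneg_left ha.1 hC
  have i3 : IntegrableOn (fun x => ε / (2 * M') *
      (‖truncGrad k (v j) (weakGrad Ω (v j)) x‖ ^ p x + ‖truncGrad k w W x‖ ^ p x)) Ω :=
    (hUi.add hWk).const_mul _
  have e1 := integral_add i3 ((i1.sub i2).const_mul (C / α))
  simp only [Pi.sub_apply] at e1
  rw [e1, integral_const_mul, integral_const_mul, integral_add hUi hWk, integral_sub i1 i2] at h1
  have h2 : ε / (2 * M') * ((∫ x in Ω, ‖truncGrad k (v j) (weakGrad Ω (v j)) x‖ ^ p x)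
      + ∫ x in Ω, ‖truncGrad k w W x‖ ^ p x) ≤ ε / 2 := by
    calc _ ≤ ε / (2 * M') * M' := by
          gcongr
          linarith [hM j, le_abs_self M]
      _ = ε / 2 := by field_simp
  have h3 : ∀ y : ℝ, y < 2 * (ε * α / (4 * (C + 1))) → C / α * y < ε / 2 := by
    intro y hy
    have hα := D.α_pos
    calc C / α * y ≤ C / α * (2 * (ε * α / (4 * (C + 1)))) := by gcongr
      _ = (C / (C + 1)) * (ε / 2) := by field_simp; ring
      _ < 1 * (ε / 2) := by
        gcongr
        rw [div_lt_one (by positivity)]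
        linarith
      _ = ε / 2 := one_mul _
  have h4 := h3 _ ((sub_lt_sub hj1 hj2).trans_eq (by ring))
  exact lt_of_le_of_lt h1 (by linarith)

/-- A diagonal sequence whose `m`-th term is compared with the limit at truncation level `m + 1`,
with modular error below `1/(m+1)`. A further subsequence makes the differences tend to 0 a.e. -/
theorem ApproxSeq.exists_tendsto_weakGrad (S : ApproxSeq Ω p r γ a b f v w W)
    (D : ProblemData Ω p r γ a b f q P R α β ν) :
    ∃ t : ℕ → ℕ, StrictMono t ∧ ∀ᵐ x ∂(volume.restrict Ω),
      Tendsto (fun j => weakGrad Ω (v (t j)) x) atTop (𝓝 (W x)) := by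
  have hp := D.exponent
  have hpos : ∀ m : ℕ, (0 : ℝ) < (m : ℝ) + 1 := fun m => by positivity
  obtain ⟨t, ht, htm⟩ := extraction_forall_of_eventually (fun m : ℕ =>
    (S.tendsto_integral_rpow_truncGrad_sub D (hpos m)).eventually_lt_const
      (show (0 : ℝ) < 1 / ((m : ℝ) + 1) by positivity))
  set d : ℕ → EuclideanSpace ℝ (Fin N) → EuclideanSpace ℝ (Fin N) := fun m x =>
    truncGrad (m + 1) (v (t m)) (weakGrad Ω (v (t m))) x - truncGrad (m + 1) w W x with hd
  have hUm := fun m => S.aestronglyMeasurable_truncGrad D.isOpen (hpos m) (t m)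
  have hWm := fun m =>
    (S.limit.hasW011Grad_trunc D.isOpen (hpos m)).integrable_grad.aestronglyMeasurable
  have hdi : ∀ m, IntegrableOn (fun x => ‖d m x‖ ^ p x) Ω := fun m =>
    hp.integrable_rpow_sub (hUm m) (hWm m)
      (S.integrable_rpow_truncGrad D.isOpen hp (hpos m) (t m)) (S.integrable_rpow_limit D (hpos m))
  have hlim : Tendsto (fun m => ∫ x in Ω, ‖d m x‖ ^ p x) atTop (𝓝 0) :=
    tendsto_of_tendsto_of_tendsto_of_le_of_le tendsto_const_nhds
      (tendsto_one_div_add_atTop_nhds_zero_nat (𝕜 := ℝ))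
      (fun m => integral_nonneg fun x => by positivity) (fun m => (htm m).le)
  have hmeas : TendstoInMeasure (volume.restrict Ω) (fun m x => ‖d m x‖ ^ p x) atTop
      (fun _ => (0 : ℝ)) := by
    refine tendstoInMeasure_of_tendsto_eLpNorm one_ne_zero
      (fun m => (hdi m).aestronglyMeasurable) aestronglyMeasurable_const ?_
    have := ENNReal.tendsto_ofReal hlim
    rw [ENNReal.ofReal_zero] at this
    refine this.congr fun m => ?_
    rw [eLpNorm_one_eq_lintegral_enorm, ofReal_integral_eq_lintegral_ofReal (hdi m)
      (Eventually.of_forall fun x => by positivity)]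
    refine lintegral_congr fun x => ?_
    rw [Pi.sub_apply, sub_zero, Real.enorm_eq_ofReal (by positivity)]
  obtain ⟨ns, hns, hae⟩ := hmeas.exists_seq_tendsto_ae
  refine ⟨t ∘ ns, ht.comp hns, ?_⟩
  filter_upwards [hae, hp.ae_mem, S.tendsto] with x hx hpx hvx
  have hp0 : 0 < p x := by linarith [hp.one_lt]
  have hd0 : Tendsto (fun i => d (ns i) x) atTop (𝓝 0) := by
    rw [tendsto_zero_iff_norm_tendsto_zero]
    have := hx.rpow_const (p := (p x)⁻¹) (Or.inr (inv_nonneg.2 hp0.le))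
    rw [Real.zero_rpow (inv_ne_zero hp0.ne')] at this
    refine this.congr fun i => ?_
    exact Real.rpow_rpow_inv (norm_nonneg _) hp0.ne'
  -- At a point of convergence the levels eventually exceed `|w x| + 1`, hence both `|w x|` and `|v
  -- (t (ns i)) x|`, and neither gradient is cut off.
  have hev : ∀ᶠ i in atTop, d (ns i) x + W x = weakGrad Ω (v (t (ns i))) x := by
    have hv : Tendsto (fun i => |v (t (ns i)) x|) atTop (𝓝 |w x|) :=
      (hvx.comp ((ht.comp hns).tendsto_atTop)).abs
    have hl := hns.tendsto_atTop.eventually (eventually_ge_atTop ⌈|w x| + 1⌉₊)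
    filter_upwards [hv.eventually_lt_const (lt_add_one |w x|), hl] with i h1 h2
    have h3 : |w x| + 1 ≤ ns i := (Nat.le_ceil _).trans (by exact_mod_cast h2)
    simp only [hd, truncGrad]
    rw [if_pos (by linarith), if_pos (by linarith), sub_add_cancel]
  have := hd0.add_const (W x)
  rw [zero_add] at this
  exact this.congr' hev

end Convergence

/-! ### Strong convergence in the Sobolev norm. -/

section Conclusion

variable {N : ℕ} {Ω : Set (EuclideanSpace ℝ (Fin N))}
  {p r γ a b f w : EuclideanSpace ℝ (Fin N) → ℝ} {q P R α β ν k : ℝ}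
  {v : ℕ → EuclideanSpace ℝ (Fin N) → ℝ}
  {W : EuclideanSpace ℝ (Fin N) → EuclideanSpace ℝ (Fin N)}

theorem ApproxSeq.memW0_trunc (S : ApproxSeq Ω p r γ a b f v w W)
    (D : ProblemData Ω p r γ a b f q P R α β ν) (hk : 0 < k) :
    MemW0 Ω p (fun x => trunc k (w x)) := by
  have := D.isFiniteMeasure
  have h := S.limit.hasW011Grad_trunc D.isOpen hk
  exact h.memW0 D.isOpen D.exponent (D.exponent.integrable_rpow_of_bound
    h.integrable.aestronglyMeasurable (B := k) (Eventually.of_forall fun x =>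
      abs_trunc_le hk.le _)) (S.integrable_rpow_limit D hk)

theorem ApproxSeq.tendsto_sobNorm (S : ApproxSeq Ω p r γ a b f v w W)
    (D : ProblemData Ω p r γ a b f q P R α β ν) (hk : 0 < k) :
    Tendsto (fun j => sobNorm Ω p (fun x => trunc k (v j x) - trunc k (w x))) atTop (𝓝 0) := by
  have := D.isFiniteMeasure
  have hp := D.exponent
  have hw := S.limit.hasW011Grad_trunc D.isOpen hk
  have hv := fun j => (S.hasW011Grad j).hasW011Grad_trunc D.isOpen hk
  have h1 : Tendsto (fun j => luxNorm Ω p (fun x => trunc k (v j x) - trunc k (w x))) atTop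
      (𝓝 0) := by
    refine tendsto_luxNorm_zero hp ?_
    have := ENNReal.tendsto_ofReal (S.tendsto_integral_rpow_trunc_sub D hk)
    rw [ENNReal.ofReal_zero] at this
    refine this.congr fun j => (modular_eq_ofReal ?_).symm
    exact hp.integrable_rpow_of_bound
      ((hv j).integrable.aestronglyMeasurable.sub hw.integrable.aestronglyMeasurable)
      (S.abs_trunc_sub_le D hk j)
  have h2 : Tendsto (fun j => luxNorm Ω p
      (weakGrad Ω (fun x => trunc k (v j x) - trunc k (w x)))) atTop (𝓝 0) := by
    refine tendsto_luxNorm_zero hp ?_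
    have := ENNReal.tendsto_ofReal (S.tendsto_integral_rpow_truncGrad_sub D hk)
    rw [ENNReal.ofReal_zero] at this
    refine this.congr fun j => ?_
    rw [← modular_eq_ofReal (hp.integrable_rpow_sub
      (S.aestronglyMeasurable_truncGrad D.isOpen hk j) hw.integrable_grad.aestronglyMeasurable
      (S.integrable_rpow_truncGrad D.isOpen hp hk j) (S.integrable_rpow_limit D hk))]
    refine lintegral_congr_ae ?_
    filter_upwards [((hv j).sub hw).weakGrad_ae D.isOpen] with x hx
    rw [hx]
  simpa [sobNorm] using h1.add h2

end Conclusion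

theorem exists_isExponent {N : ℕ} {Ω : Set (EuclideanSpace ℝ (Fin N))} (hΩo : IsOpen Ω)
    (hΩb : Bornology.IsBounded Ω) (hne : Ω.Nonempty) {p : EuclideanSpace ℝ (Fin N) → ℝ}
    (hp : ContinuousOn p (closure Ω)) (hp1 : ∀ x ∈ closure Ω, 1 < p x) :
    ∃ q P, IsExponent (volume.restrict Ω) p q P := by
  have hc : IsCompact (closure Ω) := hΩb.isCompact_closure
  obtain ⟨x, hx, hmin⟩ := hc.exists_isMinOn hne.closure hp
  obtain ⟨y, hy, hmax⟩ := hc.exists_isMaxOn hne.closure hp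
  refine ⟨p x, p y, (hp.mono subset_closure).aemeasurable hΩo.measurableSet, hp1 x hx, ?_⟩
  filter_upwards [ae_restrict_mem hΩo.measurableSet] with z hz
  exact ⟨hmin (subset_closure hz), hmax (subset_closure hz)⟩

end VarSobolev

/-! ### Assembly of the theorem. -/

open VarSobolev
theorem proposition4p1 (N : ℕ) (hN : 2 ≤ N)
    -- the domain
    (Ω : Set (EuclideanSpace ℝ (Fin N))) (hΩo : IsOpen Ω) (hΩb : Bornology.IsBounded Ω)
    -- the exponents; on the compact set `closure Ω` the pointwise strict bounds on the continuous
    -- functions `p` and `γ` are the same as strict bounds on their infimum and supremum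
    (p r γ : EuclideanSpace ℝ (Fin N) → ℝ)
    (hp : ContinuousOn p (closure Ω)) (hr : ContinuousOn r (closure Ω))
    (hγ : ContinuousOn γ (closure Ω))
    (hp1 : ∀ x ∈ closure Ω, 1 < p x) (hpN : ∀ x ∈ closure Ω, p x < N)
    (hr0 : ∀ x ∈ closure Ω, 0 < r x) (hpr : ∀ x ∈ closure Ω, p x - 1 < r x)
    (hγ01 : ∀ x ∈ closure Ω, 0 < γ x ∧ γ x < 1)
    (hγd : WeaklyDiff Ω γ) (hγb : EssBdd Ω (fun x => ‖weakGrad Ω γ x‖))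
    (hpq : ∀ x ∈ closure Ω, 1 + (1 - γ x) / r x < p x)
    -- the coefficients
    (a b : EuclideanSpace ℝ (Fin N) → ℝ)
    (ha : AEMeasurable a (volume.restrict Ω)) (hb : AEMeasurable b (volume.restrict Ω))
    (α β μ ν : ℝ) (hα : 0 < α) (hμ : 0 < μ)
    (hab : ∀ᵐ x ∂(volume.restrict Ω), α ≤ a x ∧ a x ≤ β)
    (hbb : ∀ᵐ x ∂(volume.restrict Ω), μ ≤ b x ∧ b x ≤ ν)
    -- the datum and its approximations
    (f : EuclideanSpace ℝ (Fin N) → ℝ) (hf : IntegrableOn f Ω)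
    (hf0 : ∀ᵐ x ∂(volume.restrict Ω), 0 ≤ f x) (hfne : ¬ f =ᵐ[volume.restrict Ω] 0)
    (fn : ℕ → EuclideanSpace ℝ (Fin N) → ℝ)
    (hfm : ∀ n, 1 ≤ n → AEMeasurable (fn n) (volume.restrict Ω))
    (hfn : ∀ n, 1 ≤ n → ∀ᵐ x ∂(volume.restrict Ω), 0 ≤ fn n x ∧ fn n x ≤ n ∧ fn n x ≤ f x)
    (hfl : Tendsto (fun n => ∫⁻ x in Ω, ‖fn n x - f x‖ₑ) atTop (𝓝 0))
    -- the approximate solutions, whose truncations are bounded in `W_0^{1,p(·)}(Ω)`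
    (un : ℕ → EuclideanSpace ℝ (Fin N) → ℝ)
    (hun : ∀ n, 1 ≤ n → IsApproxSol Ω p r γ a b (fn n) n (un n))
    (hbdd : ∀ k : ℝ, 0 < k → ∃ C : ℝ≥0, ∀ n, 1 ≤ n →
      MemW0 Ω p (fun x => trunc k (un n x)) ∧ sobNorm Ω p (fun x => trunc k (un n x)) ≤ C)
    -- the limit `u` of a subsequence
    (s : ℕ → ℕ) (hs : StrictMono s)
    (u : EuclideanSpace ℝ (Fin N) → ℝ)
    (hu : MemW0 Ω (fun x => p x / (1 + (1 - γ x) / r x)) u)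
    (hlim : ∀ᵐ x ∂(volume.restrict Ω), Tendsto (fun j => un (s j) x) atTop (𝓝 (u x))) :
    (∀ k : ℝ, 0 < k → MemW0 Ω p (fun x => trunc k (u x)) ∧
      Tendsto (fun j => sobNorm Ω p (fun x => trunc k (un (s j) x) - trunc k (u x)))
        atTop (𝓝 0)) ∧
    ∃ t : ℕ → ℕ, StrictMono t ∧
      ∀ᵐ x ∂(volume.restrict Ω),
        Tendsto (fun j => weakGrad Ω (un (s (t j))) x) atTop (𝓝 (weakGrad Ω u x)) := by
  have hΩm := hΩo.measurableSet
  have hmem : ∀ᵐ x ∂(volume.restrict Ω), x ∈ closure Ω := by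
    filter_upwards [ae_restrict_mem hΩm] with x hx
    exact subset_closure hx
  -- Needed for the exponents to attain their extrema on `closure Ω`; on an empty set `f` would be
  -- a.e. zero.
  have hne : Ω.Nonempty := by
    by_contra h
    rw [Set.not_nonempty_iff_eq_empty] at h
    apply hfne
    rw [h, Measure.restrict_empty]
    exact ae_zero.le (by simp)
  obtain ⟨q, P, hexp⟩ := exists_isExponent hΩo hΩb hne hp hp1
  obtain ⟨y, hy, hmax⟩ := hΩb.isCompact_closure.exists_isMaxOn hne.closure hr
  have D : ProblemData Ω p r γ a b f q P (r y) α β ν :=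
    { isOpen := hΩo
      isFiniteMeasure := ⟨by simpa using hΩb.measure_lt_top⟩
      exponent := hexp
      r_meas := (hr.mono subset_closure).aemeasurable hΩm
      r_mem := hmem.mono fun x hx => ⟨hr0 x hx, hmax hx⟩
      γ_meas := (hγ.mono subset_closure).aemeasurable hΩm
      γ_mem := hmem.mono hγ01
      a_meas := ha
      α_pos := hα
      a_mem := hab
      b_meas := hb
      b_mem := hbb.mono fun x hx => ⟨hμ.trans_le hx.1, hx.2⟩
      f_int := hf
      f_nonneg := hf0 }
  -- The index `s 0` may be 0, where nothing is assumed about `un`. The sequence is therefore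
  -- shifted by one, which does not affect limits.
  have hs1 : ∀ j, 1 ≤ s (j + 1) := fun j => (Nat.le_add_left 1 j).trans (hs.id_le (j + 1))
  have S : ApproxSeq Ω p r γ a b f (fun j => un (s (j + 1))) u (weakGrad Ω u) :=
    { sol := fun j => ⟨s (j + 1), fn (s (j + 1)), hs1 j, hfm _ (hs1 j),
        (hfn _ (hs1 j)).mono fun x hx => ⟨hx.1, hx.2.2⟩, hun _ (hs1 j)⟩
      bound := by
        intro k hk
        obtain ⟨C, hC⟩ := hbdd k hk
        refine ⟨((C : ℝ) + 1) ^ P, fun j => ?_⟩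
        obtain ⟨hm, hle⟩ := hC _ (hs1 j)
        refine le_of_eq_of_le (integral_congr_ae ?_) (integral_le_of_sobNorm_le hexp hm hle)
        filter_upwards [((hun _ (hs1 j)).1.hasW011Grad.hasW011Grad_trunc hΩo hk).weakGrad_ae hΩo]
          with x hx
        rw [hx]
      limit := hu.hasW011Grad
      tendsto := hlim.mono fun x hx => (tendsto_add_atTop_iff_nat 1).2 hx }
  refine ⟨fun k hk => ⟨S.memW0_trunc D hk, ?_⟩, ?_⟩
  · exact (tendsto_add_atTop_iff_nat 1).1 (S.tendsto_sobNorm D hk)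
  · obtain ⟨t, ht, hae⟩ := S.exists_tendsto_weakGrad D
    exact ⟨fun j => t j + 1, fun i j hij => Nat.succ_lt_succ (ht hij), hae⟩
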